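/- All graphs are finite and simple. Consider the following two reductions of a graph $G$. (D3a) If $p,q,r$ are three vertices of degree three that induce a triangle in $G$ and whose neighbors outside $\{p,q,r\}$ are all distinct, replace $p,q,r$ by a single vertex with the same three outside neighbors. (D3b) If $p,q,r$ are three vertices of degree three that induce a path in $G$ with middle vertex $q$, and some vertex $s$ is adjacent to all of $p,q,r$, delete $q$ and add the edge $pr$. A graph is called D3-reducible if it can be reduced to the complete graph $K_4$ by a (possibly empty) sequence of such reductions. Corollary. Let $G$ be a D3-reducible graph. Then $G$ is connected and has a planar embedding, and for every planar embedding of $G$ the dual graph, whose vertices are the faces of the embedding, two distinct faces being adjacent when they share an edge of $G$, has treewidth exactly three. (Planar embeddings are described combinatorially, by a cyclic order of the edges around each vertex whose face walks satisfy Euler's formula $|V|-|E|+|F|=2$.) -/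

import Mathlib

universe u

namespace D3

/-! D3 reductions. -/

section Reductions

variable {V : Type u}

/-- Precondition of a D3a reduction: `p`, `q`, `r` have degree three, induce a triangle, and
their neighbours outside of the triangle are distinct (no outside vertex is adjacent to two of
them). -/
structure CanReduceA (G : SimpleGraph V) (p q r : V) : Prop where
  deg_p : (G.neighborSet p).ncard = 3
  deg_q : (G.neighborSet q).ncard = 3
  deg_r : (G.neighborSet r).ncard = 3
  adj_pq : G.Adj p q
  adj_qr : G.Adj q r
  adj_pr : G.Adj p r
  distinct_pq : ∀ x, x ≠ r → ¬ (G.Adj p x ∧ G.Adj q x)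
  distinct_qr : ∀ x, x ≠ p → ¬ (G.Adj q x ∧ G.Adj r x)
  distinct_pr : ∀ x, x ≠ q → ¬ (G.Adj p x ∧ G.Adj r x)

/-- The result of a D3a reduction: the vertices `p`, `q`, `r` are replaced by the single new
vertex `none`, adjacent to their neighbours outside of `{p, q, r}`. -/
def reduceA (G : SimpleGraph V) (p q r : V) :
    SimpleGraph (Option {v : V // v ≠ p ∧ v ≠ q ∧ v ≠ r}) where
  Adj
    | none, none => False
    | none, some y => G.Adj p y ∨ G.Adj q y ∨ G.Adj r y
    | some x, none => G.Adj p x ∨ G.Adj q x ∨ G.Adj r x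
    | some x, some y => G.Adj x y
  symm := ⟨by
    rintro (_ | x) (_ | y) h
    · exact h
    · exact h
    · exact h
    · exact G.adj_symm h⟩
  loopless := ⟨by
    rintro (_ | x) h
    · exact h
    · exact G.irrefl h⟩

/-- Precondition of a D3b reduction with middle vertex `q` and apex `s`: `p`, `q`, `r` have
degree three and induce a path `p q r`, and `s` is adjacent to all three of them. -/
structure CanReduceB (G : SimpleGraph V) (p q r s : V) : Prop where
  deg_p : (G.neighborSet p).ncard = 3
  deg_q : (G.neighborSet q).ncard = 3
  deg_r : (G.neighborSet r).ncard = 3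
  ne_pr : p ≠ r
  adj_pq : G.Adj p q
  adj_qr : G.Adj q r
  not_adj_pr : ¬ G.Adj p r
  adj_ps : G.Adj p s
  adj_qs : G.Adj q s
  adj_rs : G.Adj r s

/-- The result of a D3b reduction: the middle vertex `q` is deleted and the edge `pr` is added
(`p` and `r` are distinct whenever the reduction applies). -/
def reduceB (G : SimpleGraph V) (p q r : V) : SimpleGraph {v : V // v ≠ q} where
  Adj x y := G.Adj x y ∨ ((x : V) ≠ (y : V) ∧ (((x : V) = p ∧ (y : V) = r) ∨ ((x : V) = r ∧ (y : V) = p)))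
  symm := ⟨by
    rintro x y (h | ⟨hne, h⟩)
    · exact Or.inl (G.adj_symm h)
    · exact Or.inr ⟨hne.symm, by tauto⟩⟩
  loopless := ⟨by
    rintro x (h | ⟨hne, -⟩)
    · exact G.irrefl h
    · exact hne rfl⟩

end Reductions

/-- A graph is D3-reducible if some (possibly empty) sequence of D3 reductions takes it to a
graph isomorphic to `K₄`. -/
inductive Reducible : {V : Type u} → SimpleGraph V → Prop
  | completeFour {V : Type u} (G : SimpleGraph V) :
      Nonempty (G ≃g SimpleGraph.completeGraph (Fin 4)) → Reducible G
  | stepA {V : Type u} (G : SimpleGraph V) (p q r : V) :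
      CanReduceA G p q r → Reducible (reduceA G p q r) → Reducible G
  | stepB {V : Type u} (G : SimpleGraph V) (p q r s : V) :
      CanReduceB G p q r s → Reducible (reduceB G p q r) → Reducible G

/-! Embeddings of graphs in closed oriented surfaces, and planar duals. -/

/-- A rotation system: a permutation of the darts (oriented edges) of `G` that cyclically permutes
the darts leaving each vertex, i.e. a cyclic ordering of the edges around each vertex. -/
structure RotationSystem {V : Type u} (G : SimpleGraph V) where
  next : Equiv.Perm G.Dart
  next_fst : ∀ d, (next d).fst = d.fst
  sameCycle : ∀ d d' : G.Dart, d.fst = d'.fst → next.SameCycle d d'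

namespace RotationSystem

variable {V : Type u} {G : SimpleGraph V} (R : RotationSystem G)

/-- The permutation that walks along the faces: after traversing the dart `d`, continue with the
dart that follows the reversal of `d` in the rotation around the endpoint of `d`. -/
def faceNext : Equiv.Perm G.Dart :=
  (SimpleGraph.Dart.symm_involutive (G := G)).toPerm.trans R.next

/-- The faces of the embedding: the orbits of darts under the face-walking permutation. -/
def Face : Type u := Quotient (Equiv.Perm.SameCycle.setoid R.faceNext)

/-- The face on whose boundary walk the dart `d` lies (each edge lies on the boundary of the
faces of its two darts, one on either side). -/
def faceOf (d : G.Dart) : R.Face := Quotient.mk (Equiv.Perm.SameCycle.setoid R.faceNext) d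

/-- The (simple graph underlying the) dual graph: its vertices are the faces, and two distinct
faces are adjacent if some edge has these two faces on its two sides. -/
def dual : SimpleGraph R.Face where
  Adj f g := f ≠ g ∧ ∃ d : G.Dart, R.faceOf d = f ∧ R.faceOf d.symm = g
  symm := ⟨by
    rintro f g ⟨hne, d, hf, hg⟩
    exact ⟨hne.symm, d.symm, hg, by rw [SimpleGraph.Dart.symm_symm, hf]⟩⟩
  loopless := ⟨fun _ h => h.1 rfl⟩

/-- The embedding of the finite connected graph `G` given by a rotation system is planar
(an embedding in the sphere) if it satisfies Euler's formula `|V| - |E| + |F| = 2`,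
i.e. the surface obtained by gluing a disk along each face walk has genus zero. -/
def IsPlanar [Finite V] : Prop :=
  G.Connected ∧
    (Nat.card V : ℤ) - (Nat.card G.edgeSet : ℤ) + (Nat.card R.Face : ℤ) = 2

end RotationSystem

/-! Treewidth. -/

/-- A tree decomposition of `G` indexed by the nodes of a tree: each edge is contained in a bag,
and the nodes whose bags contain a given vertex form a (nonempty) subtree. -/
structure TreeDecomposition {V : Type u} (G : SimpleGraph V) (ι : Type) where
  tree : SimpleGraph ι
  isTree : tree.IsTree
  bag : ι → Finset V
  edge_mem : ∀ x y, G.Adj x y → ∃ i, x ∈ bag i ∧ y ∈ bag i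
  connected : ∀ v, (tree.induce {i | v ∈ bag i}).Connected

/-- `G` has a (finite) tree decomposition of width at most `k`. -/
def HasTreeDecompositionOfWidth {V : Type u} (G : SimpleGraph V) (k : ℕ) : Prop :=
  ∃ (ι : Type) (_ : Finite ι) (D : TreeDecomposition G ι), ∀ i, (D.bag i).card ≤ k + 1

/-- The treewidth of a nonempty graph: the least width of a tree decomposition
(`⊤` if there is none of finite width). -/
noncomputable def treewidth {V : Type u} (G : SimpleGraph V) : ℕ∞ :=
  ⨅ (k : ℕ) (_ : HasTreeDecompositionOfWidth G k), (k : ℕ∞)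

end D3

namespace D3

open Equiv Equiv.Perm

/-! Cycle counts of permutations. -/

section Cycles

variable {D : Type*}

/-! An embedding is a pair of permutations of one finite set of darts: an edge involution α and a
rotation σ, the faces being the cycles of `σ * α`. Removed darts become fixed points instead of
leaving the type; each of them contributes 1 + 1 + 1 - 3 = 0 to `euler`. Parallel edges and loops
are allowed.

In these terms either reduction deletes one edge e = uw of a triangle uwz and smooths out the
resulting vertices of degree two: only u for D3b, both u and w for D3a. Conversely, the graph arises
from the smaller one by cutting off a corner at the vertex z of degree three. Deleting an edge
multiplies the face permutation by a transposition (`mul_delEdge`), so it merges two faces or splits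
one, and the Euler number stays the same or grows by two (`euler_delEdge`); smoothing preserves it
(`euler_smooth`). Hence the bound `euler ≤ 2` passes from the smaller map to the larger one, and in
a planar embedding e has two different faces on its sides and the smaller map is again planar.

The induction carries the invariant `Good`, whose core is tightness: no face visits a vertex twice,
and two faces sharing an edge meet in no vertices other than its ends. Tightness of the smaller map
forces e to cut off a triangular face at z (`Corner.coherent`, `Truncation.coherent`), so every
planar embedding of the larger graph comes from one of the smaller graph in the expected way.
Tightness is inherited (`Corner.tight`, `Truncation.tight`), and the dual gains a single vertex
adjacent only to the three faces around z, so a leaf bag of size four extends the tree decomposition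
(`HasDualDecomposition.extend`). The induction starts from two vertices joined by three parallel
edges (`Dipole.good`), of which K₄ is a truncation.

This gives existence and the upper bound. For the lower bound, tightness provides every face with
three distinct neighbours in the dual (`exists_three_adj_dual`), whereas in any tree decomposition
some vertex shares a single bag with all its neighbours (`TreeDecomposition.exists_forall_adj_mem`).
-/

/-- The number of cycles of a permutation, fixed points included. -/
noncomputable def cyc (π : Perm D) : ℕ := Nat.card (Quotient (SameCycle.setoid π))

theorem sameCycle_of_forall_apply [Finite D] {π : Perm D} {r : D → D → Prop}
    (hr : Equivalence r) (h : ∀ x, r x (π x)) {x y : D} (hxy : π.SameCycle x y) : r x y := by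
  obtain ⟨n, rfl⟩ := hxy.exists_nat_pow_eq
  clear hxy
  induction n with
  | zero => exact hr.refl x
  | succ n ih =>
    rw [pow_succ', Perm.mul_apply]
    exact hr.trans ih (h _)

theorem mem_of_sameCycle [Finite D] {π : Perm D} {S : Set D} (h : ∀ x ∈ S, π x ∈ S)
    {x y : D} (hxy : π.SameCycle x y) (hx : x ∈ S) : y ∈ S := by
  obtain ⟨n, rfl⟩ := hxy.exists_nat_pow_eq
  clear hxy
  induction n with
  | zero => exact hx
  | succ n ih =>
    rw [pow_succ', Perm.mul_apply]
    exact h _ ih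

theorem sameCycle_apply (π : Perm D) (x : D) : π.SameCycle x (π x) :=
  sameCycle_apply_right.2 (SameCycle.refl _ _)

theorem sameCycle_of_apply_eq {π : Perm D} {x y : D} (h : π x = y) : π.SameCycle x y :=
  h ▸ sameCycle_apply π x

/-- Exponents only matter modulo n, so the first n powers already list the whole orbit of a. -/
theorem not_sameCycle_of_first_return {π : Perm D} [Finite D] {a b : D} (hab : a ≠ b) {n : ℕ} (hn : 0 < n)
    (h : ∀ i, 0 < i → i < n → (π ^ i) a ≠ b) (hr : (π ^ n) a = a) : ¬ π.SameCycle a b := by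
  intro hs
  obtain ⟨k, hk⟩ := hs.exists_nat_pow_eq
  have h2 : (π ^ (k % n)) a = b := by
    rw [← hk]
    conv_rhs => rw [← Nat.mod_add_div k n, pow_add, Perm.mul_apply, pow_mul]
    congr 1
    generalize k / n = m
    induction m with
    | zero => simp
    | succ m ih => rw [pow_succ, Perm.mul_apply, hr]; exact ih
  rcases Nat.eq_zero_or_pos (k % n) with h0 | h0
  · rw [h0] at h2; exact hab h2
  · exact h _ h0 (Nat.mod_lt _ hn) h2

theorem cyc_one [Finite D] : cyc (1 : Perm D) = Nat.card D := by
  refine (Nat.card_eq_of_bijective (fun x : D => (Quotient.mk _ x : Quotient (SameCycle.setoid (1 : Perm D)))) ⟨?_, ?_⟩).symm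
  · intro x y hxy
    have : (1 : Perm D).SameCycle x y := Quotient.exact hxy
    simpa using this
  · exact Quotient.exists_rep

theorem sameCycle_of_sq_eq_one [Finite D] {α : Perm D} (hα : ∀ x, α (α x) = x) {x y : D} :
    α.SameCycle x y ↔ y = x ∨ y = α x := by
  constructor
  · intro h
    refine mem_of_sameCycle (S := {y | y = x ∨ y = α x}) ?_ h (Or.inl rfl)
    rintro z (rfl | rfl)
    · exact Or.inr rfl
    · exact Or.inl (hα x)
  · rintro (rfl | rfl)
    · exact SameCycle.refl _ _
    · exact sameCycle_apply _ _

/-- A permutation acting transitively on three points. -/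
theorem three_cycle_cases [Finite D] {π : Perm D} {a b c : D} (hab : a ≠ b) (hac : a ≠ c) (hbc : b ≠ c)
    (ha : π a = a ∨ π a = b ∨ π a = c) (hb : π b = a ∨ π b = b ∨ π b = c)
    (hc : π c = a ∨ π c = b ∨ π c = c) (h1 : π.SameCycle a b) (h2 : π.SameCycle a c) :
    (π a = b ∧ π b = c ∧ π c = a) ∨ (π a = c ∧ π c = b ∧ π b = a) := by
  have n1 : π a ≠ a := fun h => hab (h1.eq_of_left h)
  have n2 : π b ≠ b := fun h => hab (h1.eq_of_right h)
  have n3 : π c ≠ c := fun h => hac (h2.eq_of_right h)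
  have i1 : π a ≠ π b := fun h => hab (π.injective h)
  have i2 : π a ≠ π c := fun h => hac (π.injective h)
  have i3 : π b ≠ π c := fun h => hbc (π.injective h)
  grind

variable [DecidableEq D]

theorem exists_first_hit [Finite D] (π : Perm D) (a b : D) :
    ∃ n, 0 < n ∧ (∀ i, 0 < i → i < n → (π ^ i) a ≠ a ∧ (π ^ i) a ≠ b) ∧
      ((π ^ n) a = a ∨ (π ^ n) a = b) := by
  classical
  have h : ∃ n, 0 < n ∧ ((π ^ n) a = a ∨ (π ^ n) a = b) :=
    ⟨orderOf π, orderOf_pos π, Or.inl (by rw [pow_orderOf_eq_one]; rfl)⟩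
  refine ⟨Nat.find h, (Nat.find_spec h).1, fun i hi hlt => ?_, (Nat.find_spec h).2⟩
  have := Nat.find_min h hlt
  tauto

/-- The transposition is not felt until the orbit of a first hits a or b; at that moment it
exchanges the two. This turns a hit of b into a return to a and vice versa, which is why multiplying
by `swap a b` splits a common cycle and joins separate ones. -/
theorem swap_mul_pow_apply (π : Perm D) {a b : D} {n : ℕ}
    (h : ∀ i, 0 < i → i < n → (π ^ i) a ≠ a ∧ (π ^ i) a ≠ b) :
    (∀ i, i < n → ((swap a b * π) ^ i) a = (π ^ i) a) ∧
      (0 < n → ((swap a b * π) ^ n) a = swap a b ((π ^ n) a)) := by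
  have h1 : ∀ i, i < n → ((swap a b * π) ^ i) a = (π ^ i) a := by
    intro i
    induction i with
    | zero => simp
    | succ i ih =>
      intro hi
      rw [pow_succ', Perm.mul_apply, ih (by omega), Perm.mul_apply, ← Perm.mul_apply π, ← pow_succ']
      exact swap_apply_of_ne_of_ne (h _ (by omega) hi).1 (h _ (by omega) hi).2
  refine ⟨h1, fun hn => ?_⟩
  obtain ⟨m, rfl⟩ : ∃ m, n = m + 1 := ⟨n - 1, by omega⟩
  rw [pow_succ', Perm.mul_apply, h1 m (by omega), Perm.mul_apply, ← Perm.mul_apply π, ← pow_succ']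

theorem not_sameCycle_swap_mul [Finite D] {π : Perm D} {a b : D} (hab : a ≠ b)
    (h : π.SameCycle a b) : ¬ (swap a b * π).SameCycle a b := by
  obtain ⟨n, hn, h1, h2⟩ := exists_first_hit π a b
  obtain ⟨h3, h4⟩ := swap_mul_pow_apply π h1
  rcases h2 with h2 | h2
  · exact absurd h (not_sameCycle_of_first_return hab hn (fun i hi hi' => (h1 i hi hi').2) h2)
  · refine not_sameCycle_of_first_return hab hn (fun i hi hi' => ?_) ?_
    · rw [h3 i hi']; exact (h1 i hi hi').2
    · rw [h4 hn, h2, swap_apply_right]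

theorem sameCycle_swap_mul [Finite D] {π : Perm D} {a b : D}
    (h : ¬ π.SameCycle a b) : (swap a b * π).SameCycle a b := by
  obtain ⟨n, hn, h1, h2⟩ := exists_first_hit π a b
  obtain ⟨h3, h4⟩ := swap_mul_pow_apply π h1
  rcases h2 with h2 | h2
  · have := h4 hn
    rw [h2, swap_apply_left] at this
    exact ⟨n, by simpa using this⟩
  · exact absurd ⟨n, by simpa using h2⟩ h

/-- Multiplying with a transposition of elements in different cycles merges these cycles. -/
theorem sameCycle_swap_mul_iff [Finite D] {π : Perm D} {a b : D} (h : ¬ π.SameCycle a b) {x y : D} :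
    (swap a b * π).SameCycle x y ↔ π.SameCycle x y ∨
      ((π.SameCycle x a ∨ π.SameCycle x b) ∧ (π.SameCycle y a ∨ π.SameCycle y b)) := by
  have hab := sameCycle_swap_mul h
  have key : ∀ x, (swap a b * π).SameCycle x (π x) := by
    intro x
    by_cases h1 : π x = a
    · have : (swap a b * π) x = b := by simp [h1]
      rw [h1]
      exact (sameCycle_of_apply_eq this).trans hab.symm
    by_cases h2 : π x = b
    · have : (swap a b * π) x = a := by simp [h2]
      rw [h2]
      exact (sameCycle_of_apply_eq this).trans hab
    · exact sameCycle_of_apply_eq (by simp [swap_apply_of_ne_of_ne h1 h2])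
  have key2 : ∀ {x y}, π.SameCycle x y → (swap a b * π).SameCycle x y := fun hxy =>
    sameCycle_of_forall_apply (SameCycle.equivalence _) key hxy
  constructor
  · refine fun hxy => sameCycle_of_forall_apply (π := swap a b * π) (r := fun x y => π.SameCycle x y ∨
      ((π.SameCycle x a ∨ π.SameCycle x b) ∧ (π.SameCycle y a ∨ π.SameCycle y b))) ?_ ?_ hxy
    · refine ⟨fun x => Or.inl (SameCycle.refl _ _), ?_, ?_⟩
      · rintro x y (h | h)
        · exact Or.inl h.symm
        · exact Or.inr h.symm
      · rintro x y z (h | h) (h' | h')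
        · exact Or.inl (h.trans h')
        · exact Or.inr ⟨h'.1.imp h.trans h.trans, h'.2⟩
        · exact Or.inr ⟨h.1, h.2.imp h'.symm.trans h'.symm.trans⟩
        · exact Or.inr ⟨h.1, h'.2⟩
    · intro x
      rw [Perm.mul_apply]
      by_cases h1 : π x = a
      · right
        rw [h1, swap_apply_left]
        exact ⟨Or.inl (sameCycle_of_apply_eq h1), Or.inr (SameCycle.refl _ _)⟩
      by_cases h2 : π x = b
      · right
        rw [h2, swap_apply_right]
        exact ⟨Or.inr (sameCycle_of_apply_eq h2), Or.inl (SameCycle.refl _ _)⟩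
      · left
        rw [swap_apply_of_ne_of_ne h1 h2]
        exact sameCycle_apply _ _
  · rintro (hxy | ⟨hx, hy⟩)
    · exact key2 hxy
    · have hx' : (swap a b * π).SameCycle x a :=
        hx.elim key2 fun hx => (key2 hx).trans hab.symm
      have hy' : (swap a b * π).SameCycle y a :=
        hy.elim key2 fun hy => (key2 hy).trans hab.symm
      exact hx'.trans hy'.symm

theorem cyc_swap_mul_of_not_sameCycle [Finite D] {π : Perm D} {a b : D} (h : ¬ π.SameCycle a b) :
    cyc (swap a b * π) + 1 = cyc π := by
  classical
  let Q := Quotient (SameCycle.setoid π)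
  let Q' := Quotient (SameCycle.setoid (swap a b * π))
  let qb : Q := Quotient.mk _ b
  have mkQ : ∀ x y : D, ((Quotient.mk _ x : Q) = Quotient.mk _ y ↔ π.SameCycle x y) :=
    fun x y => Quotient.eq
  have mkQ' : ∀ x y : D, ((Quotient.mk _ x : Q') = Quotient.mk _ y ↔
      (swap a b * π).SameCycle x y) := fun x y => Quotient.eq
  let f : Q → Q' := Quotient.map' id fun x y hxy => (sameCycle_swap_mul_iff h).2 (Or.inl hxy)
  have hf : ∀ x : D, f (Quotient.mk _ x) = Quotient.mk _ x := fun x => rfl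
  -- Only the classes of a and b are identified, so discarding the class of b makes the projection
  -- bijective.
  have hbij : Function.Bijective (fun c : {c : Q // c ≠ qb} => f c.1) := by
    constructor
    · rintro ⟨c, hc⟩ ⟨c', hc'⟩ hcc
      induction c using Quotient.ind with | _ x
      induction c' using Quotient.ind with | _ y
      rw [Subtype.mk.injEq, mkQ]
      simp only [hf, mkQ', sameCycle_swap_mul_iff h] at hcc
      rw [Ne, mkQ] at hc hc'
      rcases hcc with hcc | ⟨h1 | h1, h2 | h2⟩
      · exact hcc
      · exact h1.trans h2.symm
      all_goals contradiction
    · intro c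
      induction c using Quotient.ind with | _ x
      by_cases hx : π.SameCycle x b
      · refine ⟨⟨Quotient.mk _ a, fun hh => h ((mkQ _ _).1 hh)⟩, ?_⟩
        simp only [hf, mkQ', sameCycle_swap_mul_iff h]
        exact Or.inr ⟨Or.inl (SameCycle.refl _ _), Or.inr hx⟩
      · exact ⟨⟨Quotient.mk _ x, fun hh => hx ((mkQ _ _).1 hh)⟩, rfl⟩
  have h1 : Nat.card {c : Q // c ≠ qb} = Nat.card Q' := Nat.card_eq_of_bijective _ hbij
  have h2 : Nat.card Q = Nat.card {c : Q // c ≠ qb} + 1 := by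
    rw [Nat.card_congr (Equiv.optionSubtypeNe qb).symm, Finite.card_option]
  change Nat.card Q' + 1 = Nat.card Q
  omega

theorem cyc_swap_mul_of_sameCycle [Finite D] {π : Perm D} {a b : D} (hab : a ≠ b)
    (h : π.SameCycle a b) : cyc (swap a b * π) = cyc π + 1 := by
  have := cyc_swap_mul_of_not_sameCycle (not_sameCycle_swap_mul hab h)
  rw [← mul_assoc, swap_mul_self, one_mul] at this
  omega

/-- Remove the point `a` from its cycle and make it a fixed point. -/
def del (a : D) (π : Perm D) : Perm D := swap a (π a) * π

theorem del_apply (a : D) (π : Perm D) (x : D) :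
    del a π x = if x = a then a else if π x = a then π a else π x := by
  unfold del
  rw [Perm.mul_apply]
  split_ifs with h1 h2
  · rw [h1, swap_apply_right]
  · rw [h2, swap_apply_left]
  · exact swap_apply_of_ne_of_ne h2 fun h => h1 (π.injective h)

theorem del_self (a : D) (π : Perm D) : del a π a = a := by simp [del_apply]

theorem cyc_del [Finite D] {a : D} {π : Perm D} (h : π a ≠ a) : cyc (del a π) = cyc π + 1 :=
  cyc_swap_mul_of_sameCycle h.symm (sameCycle_apply π a)

/-- Multiplying back by the transposition recovers π from `del a π` by merging the singleton cycle
of a into that of `π a`; away from a nothing is identified. -/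
theorem sameCycle_del [Finite D] {a : D} {π : Perm D} {x y : D} (hx : x ≠ a) (hy : y ≠ a) :
    (del a π).SameCycle x y ↔ π.SameCycle x y := by
  by_cases ha : π a = a
  · have : del a π = π := by rw [del, ha, swap_self]; rfl
    rw [this]
  have hfix : ∀ z, (del a π).SameCycle z a ↔ z = a := fun z =>
    ⟨fun h => h.eq_of_right (del_self a π), fun h => h ▸ SameCycle.refl _ _⟩
  have hn : ¬ (del a π).SameCycle a (π a) := fun h => ha (((hfix _).1 h.symm))
  have h2 : π = swap a (π a) * del a π := by simp [del, ← mul_assoc]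
  conv_rhs => rw [h2]
  rw [sameCycle_swap_mul_iff hn, hfix, hfix]
  constructor
  · exact Or.inl
  · rintro (h | ⟨h1 | h1, h2 | h2⟩)
    · exact h
    · exact absurd h1 hx
    · exact absurd h1 hx
    · exact absurd h2 hy
    · exact h1.trans h2.symm

end Cycles

/-! Combinatorial maps: a rotation `σ` and an edge involution `α` on a set of darts. The fixed
points of `α` are regarded as removed darts. -/

section Maps

variable {D W : Type*}

/-- The number `|V| - |E| + |F|` of the combinatorial map with rotation `σ` and edge involution
`α`, where the fixed points of `α` do not count. -/
noncomputable def euler (α σ : Perm D) : ℤ :=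
  cyc σ + cyc (σ * α) + Nat.card D - 3 * cyc α

/-- `σ` is a rotation for the vertices given by the labelling `ℓ` of the darts. -/
structure IsRot (α : Perm D) (ℓ : D → W) (σ : Perm D) : Prop where
  fix : ∀ x, α x = x → σ x = x
  vert : ∀ x y, α x ≠ x → α y ≠ y → (ℓ x = ℓ y ↔ σ.SameCycle x y)

/-- `a`, `b`, `c` are the darts leaving a vertex of degree three. -/
structure DegThree (α : Perm D) (ℓ : D → W) (a b c : D) : Prop where
  act_a : α a ≠ a
  act_b : α b ≠ b
  act_c : α c ≠ c
  ne_ab : a ≠ b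
  ne_ac : a ≠ c
  ne_bc : b ≠ c
  eq_ab : ℓ b = ℓ a
  eq_ac : ℓ c = ℓ a
  fiber : ∀ x, α x ≠ x → ℓ x = ℓ a → x = a ∨ x = b ∨ x = c

theorem DegThree.swap {α : Perm D} {ℓ : D → W} {a b c : D} (h : DegThree α ℓ a b c) :
    DegThree α ℓ c b a where
  act_a := h.act_c
  act_b := h.act_b
  act_c := h.act_a
  ne_ab := h.ne_bc.symm
  ne_ac := h.ne_ac.symm
  ne_bc := h.ne_ab.symm
  eq_ab := h.eq_ab.trans h.eq_ac.symm
  eq_ac := h.eq_ac.symm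
  fiber x hx hl := by have := h.fiber x hx (hl.trans h.eq_ac); tauto

theorem DegThree.rotate {α : Perm D} {ℓ : D → W} {a b c : D} (h : DegThree α ℓ a b c) :
    DegThree α ℓ b a c where
  act_a := h.act_b
  act_b := h.act_a
  act_c := h.act_c
  ne_ab := h.ne_ab.symm
  ne_ac := h.ne_bc
  ne_bc := h.ne_ac
  eq_ab := h.eq_ab.symm
  eq_ac := h.eq_ac.trans h.eq_ab.symm
  fiber x hx hl := by have := h.fiber x hx (hl.trans h.eq_ab); tauto

theorem IsRot.active {α : Perm D} {ℓ : D → W} {σ : Perm D} (h : IsRot α ℓ σ) {x : D}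
    (hx : α x ≠ x) : α (σ x) ≠ σ x := fun hh => by
  have := σ.injective (h.fix _ hh)
  rw [this] at hh
  exact hx hh

theorem IsRot.label {α : Perm D} {ℓ : D → W} {σ : Perm D} (h : IsRot α ℓ σ) {x : D}
    (hx : α x ≠ x) : ℓ (σ x) = ℓ x :=
  (h.vert _ _ (h.active hx) hx).2 (sameCycle_apply _ _).symm

theorem IsRot.cases [Finite D] {α : Perm D} {ℓ : D → W} {σ : Perm D} (h : IsRot α ℓ σ) {a b c : D}
    (h3 : DegThree α ℓ a b c) : (σ a = b ∧ σ b = c ∧ σ c = a) ∨ (σ a = c ∧ σ c = b ∧ σ b = a) := by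
  refine three_cycle_cases h3.ne_ab h3.ne_ac h3.ne_bc ?_ ?_ ?_ ?_ ?_
  · exact h3.fiber _ (h.active h3.act_a) (h.label h3.act_a)
  · exact h3.fiber _ (h.active h3.act_b) ((h.label h3.act_b).trans h3.eq_ab)
  · exact h3.fiber _ (h.active h3.act_c) ((h.label h3.act_c).trans h3.eq_ac)
  · exact (h.vert _ _ h3.act_a h3.act_b).1 h3.eq_ab.symm
  · exact (h.vert _ _ h3.act_a h3.act_c).1 h3.eq_ac.symm

variable [DecidableEq D]

/-- Edge deletion acts on faces as multiplication by one transposition, up to making both darts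
fixed points. All later comparisons of faces rest on this identity and on `mul_smooth`. -/
theorem mul_delEdge {α σ : Perm D} (hα : ∀ x, α (α x) = x) {e e' : D} (he : α e = e') (hne : e ≠ e') :
    del e (del e' σ) * (swap e e' * α) = del e (del e' (swap e e' * (σ * α))) := by
  have i1 : ∀ x y, σ x = σ y → x = y := fun x y h => σ.injective h
  have i2 : ∀ x y, α x = α y → x = y := fun x y h => α.injective h
  have he' : α e' = e := by rw [← he, hα]
  ext x
  simp only [Perm.mul_apply, del_apply, swap_apply_def]
  grind

theorem cyc_swap_mul_involution [Finite D] {α : Perm D} {e e' : D}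
    (he : α e = e') (hne : e ≠ e') : cyc (swap e e' * α) = cyc α + 1 :=
  cyc_swap_mul_of_sameCycle hne (sameCycle_of_apply_eq he)

/-- Deleting an edge keeps the Euler characteristic if the edge has two different faces on its
sides, and increases it by two otherwise. -/
theorem euler_delEdge [Finite D] {α σ : Perm D} (hα : ∀ x, α (α x) = x) {e e' : D} (he : α e = e')
    (hne : e ≠ e') (h1 : σ e ≠ e) (h2 : σ e' ≠ e') (h3 : σ e' ≠ e) (h4 : σ e ≠ e') :
    (¬ (σ * α).SameCycle e e' → euler (swap e e' * α) (del e (del e' σ)) = euler α σ) ∧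
    ((σ * α).SameCycle e e' → euler (swap e e' * α) (del e (del e' σ)) = euler α σ + 2) := by
  have he' : α e' = e := by rw [← he, hα]
  have c1 : cyc (del e (del e' σ)) = cyc σ + 2 := by
    rw [cyc_del, cyc_del h2]
    rw [del_apply]; grind
  have c2 := cyc_swap_mul_involution he hne
  have c3 : cyc (del e (del e' (swap e e' * (σ * α)))) = cyc (swap e e' * (σ * α)) + 2 := by
    have i1 : σ e ≠ σ e' := fun h => hne (σ.injective h)
    rw [cyc_del, cyc_del]
    · simp only [Perm.mul_apply, swap_apply_def]; grind
    · simp only [Perm.mul_apply, del_apply, swap_apply_def]; grind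
  -- The vertex cycles grow by 2, the edge cycles by 1, and the face cycles by 2 - 1 or 2 + 1, so
  -- the total change is 0 or 2.
  unfold euler
  rw [mul_delEdge hα he hne, c1, c2, c3]
  constructor
  · intro h
    have := cyc_swap_mul_of_not_sameCycle h
    push_cast
    omega
  · intro h
    have := cyc_swap_mul_of_sameCycle hne h
    push_cast
    omega

/-- The edge involution after smoothing out the vertex of degree two with darts `a` and `b`. -/
def smooth (a b : D) (α : Perm D) : Perm D := del a (del b (swap a b * α))

theorem smooth_apply {α : Perm D} (hα : ∀ x, α (α x) = x) {a b : D} (hab : a ≠ b) (ha : α a ≠ a)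
    (hb : α b ≠ b) (h : α a ≠ b) (x : D) : smooth a b α x =
      if x = a ∨ x = b then x else if x = α a then α b else if x = α b then α a else α x := by
  have i2 : ∀ x y, α x = α y → x = y := fun x y h => α.injective h
  unfold smooth
  simp only [Perm.mul_apply, del_apply, swap_apply_def]
  grind

/-- Face walks only lose the darts a and b. In `smooth`, the transposition joins the edges of a and
b into a 4-cycle of darts; removing a and b from it leaves the single edge between their former
partners. Since σ exchanges a and b, `del a σ` fixes both. -/
theorem mul_smooth {α σ : Perm D} (hα : ∀ x, α (α x) = x) {a b : D} (hab : a ≠ b) (ha : α a ≠ a)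
    (hb : α b ≠ b) (h : α a ≠ b) (h1 : σ a = b) (h2 : σ b = a) :
    del a σ * smooth a b α = del a (del b (σ * α)) := by
  have i1 : ∀ x y, σ x = σ y → x = y := fun x y h => σ.injective h
  have i2 : ∀ x y, α x = α y → x = y := fun x y h => α.injective h
  ext x
  simp only [Perm.mul_apply, smooth_apply hα hab ha hb h, del_apply]
  grind

/-- One vertex and one edge disappear. In cycle counts with fixed points, the changes are 1 for σ, 1
for α and 2 for the faces, and 1 + 2 - 3 = 0. -/
theorem euler_smooth [Finite D] {α σ : Perm D} (hα : ∀ x, α (α x) = x) {a b : D} (hab : a ≠ b) (ha : α a ≠ a)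
    (hb : α b ≠ b) (h : α a ≠ b) (h1 : σ a = b) (h2 : σ b = a) :
    euler (smooth a b α) (del a σ) = euler α σ := by
  have c1 : cyc (del a σ) = cyc σ + 1 := cyc_del (by rw [h1]; exact hab.symm)
  have c2 : cyc (smooth a b α) = cyc α + 1 := by
    have hn : ¬ α.SameCycle a b := fun hs => by
      rcases (sameCycle_of_sq_eq_one hα).1 hs with hh | hh
      · exact hab hh.symm
      · exact h hh.symm
    have := cyc_swap_mul_of_not_sameCycle hn
    unfold smooth
    rw [cyc_del, cyc_del]
    · omega
    · simp only [Perm.mul_apply, swap_apply_def]; grind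
    · simp only [Perm.mul_apply, del_apply, swap_apply_def]; grind
  have c3 : cyc (del a (del b (σ * α))) = cyc (σ * α) + 2 := by
    rw [cyc_del, cyc_del]
    · simp only [Perm.mul_apply]
      intro hh
      have := σ.injective (hh.trans h1.symm)
      exact h (by rw [← this, hα])
    · simp only [Perm.mul_apply, del_apply]
      have i1 : ∀ x y, σ x = σ y → x = y := fun x y h => σ.injective h
      grind
  unfold euler
  rw [mul_smooth hα hab ha hb h h1 h2, c1, c2, c3]
  push_cast
  ring

end Maps

/-! ### Cutting off a corner: edge deletion followed by smoothing -/

section Corner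

variable {D W : Type*}

/-- A corner at a vertex `z` of degree three that is cut off by an edge `uw`, where `u` is a vertex
of degree three. The darts are `a = uz`, `a' = zu`, `e = uw`, `e' = wu`, `t = wz`, `t' = zw`, the
third dart `b` at `u` with reversal `b'`, and the third dart `c` at `z`. -/
structure Corner (α : Perm D) (ℓ : D → W) (a b e e' t t' a' b' c : D) : Prop where
  inv : ∀ x, α (α x) = x
  u : DegThree α ℓ a e b
  z : DegThree α ℓ a' t' c
  αa : α a = a'
  αb : α b = b'
  αe : α e = e'
  αt : α t = t'
  eq_w : ℓ t = ℓ e'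
  ne_uz : ℓ a' ≠ ℓ a
  ne_uw : ℓ e' ≠ ℓ a
  ne_zw : ℓ e' ≠ ℓ a'
  ne_ub : ℓ b' ≠ ℓ a
  ne_zb : ℓ b' ≠ ℓ a'
  ne_wb : ℓ b' ≠ ℓ e'

variable [DecidableEq D]

/-- Delete the edge of `e` and smooth out the vertex with the other two darts `a`, `b`. -/
def cutα (a b e e' : D) (α : Perm D) : Perm D := smooth a b (swap e e' * α)

/-- The rotation after deleting `e` and smoothing out the vertex of the other darts `a`, `b`. -/
def cutσ (a e e' : D) (σ : Perm D) : Perm D := del a (del e (del e' σ))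

variable {α σ : Perm D} {ℓ : D → W} {a b e e' t t' a' b' c : D}

namespace Corner

omit [DecidableEq D] in
theorem distinct (h : Corner α ℓ a b e e' t t' a' b' c) :
    [a, b, e, e', t, t', a', b', c].Nodup := by
  obtain ⟨inv, ⟨ua1, ua2, ua3, un1, un2, un3, ue1, ue2, uf⟩, ⟨za1, za2, za3, zn1, zn2, zn3, ze1, ze2, zf⟩,
    αa, αb, αe, αt, eqw, n1, n2, n3, n4, n5, n6⟩ := h
  -- If e' and t coincided, so would their reversals e and t', placing u and z at the same vertex.
  have : e' ≠ t := fun hh => by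
    have h1 : α e' = e := by rw [← αe, inv]
    rw [hh, αt] at h1
    exact n1 (by rw [← ze1, h1, ue1])
  simp only [List.nodup_cons, List.mem_cons, List.not_mem_nil, or_false, not_or, not_false_eq_true, List.nodup_nil, and_true]
  and_intros <;> grind

theorem cutα_apply (h : Corner α ℓ a b e e' t t' a' b' c) (x : D) : cutα a b e e' α x =
    if x = a ∨ x = b ∨ x = e ∨ x = e' then x else if x = a' then b' else if x = b' then a'
    else α x := by
  have hd := h.distinct
  simp only [List.nodup_cons, List.mem_cons, List.not_mem_nil, or_false, not_or] at hd
  have i1 : ∀ x, (swap e e' * α) x = if x = e ∨ x = e' then x else α x := by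
    intro x
    have := h.inv; have := h.αe
    have i2 : ∀ x y, α x = α y → x = y := fun x y h => α.injective h
    simp only [Perm.mul_apply, swap_apply_def]
    grind
  have inv := h.inv
  have αe := h.αe
  have αa := h.αa
  have αb := h.αb
  unfold cutα
  rw [smooth_apply]
  · simp only [i1]; grind
  · simp only [i1]; grind
  all_goals first | (simp only [i1]; grind) | grind

theorem cutα_inv (h : Corner α ℓ a b e e' t t' a' b' c) (x : D) :
    cutα a b e e' α (cutα a b e e' α x) = x := by
  have hd := h.distinct
  simp only [List.nodup_cons, List.mem_cons, List.not_mem_nil, or_false, not_or] at hd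
  have inv := h.inv
  have αe := h.αe
  have αa := h.αa
  have αb := h.αb
  simp only [h.cutα_apply]
  grind

theorem active_iff (h : Corner α ℓ a b e e' t t' a' b' c) {x : D} :
    cutα a b e e' α x ≠ x ↔ α x ≠ x ∧ x ≠ a ∧ x ≠ b ∧ x ≠ e ∧ x ≠ e' := by
  have hd := h.distinct
  simp only [List.nodup_cons, List.mem_cons, List.not_mem_nil, or_false, not_or] at hd
  have inv := h.inv
  have αa := h.αa
  have αb := h.αb
  simp only [h.cutα_apply]
  grind

variable [Finite D]

/-- Once e is gone, u has degree two, which is what smoothing requires. -/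
theorem delEdge_swap (h : Corner α ℓ a b e e' t t' a' b' c) (hσ : IsRot α ℓ σ) :
    del e (del e' σ) a = b ∧ del e (del e' σ) b = a := by
  have hd := h.distinct
  simp only [List.nodup_cons, List.mem_cons, List.not_mem_nil, or_false, not_or] at hd
  have := hσ.cases h.u
  simp only [del_apply]
  grind

theorem isRot (h : Corner α ℓ a b e e' t t' a' b' c) (hσ : IsRot α ℓ σ) :
    IsRot (cutα a b e e' α) ℓ (cutσ a e e' σ) where
  fix x hx := by
    have h1 := h.delEdge_swap hσ
    have h2 := mt h.active_iff.2 (not_not.2 hx)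
    have h3 := hσ.fix x
    have h4 := h.u.act_a
    have h5 := h.u.act_b
    have h6 : α e' ≠ e' := by rw [← h.αe, h.inv]; exact h.u.act_b.symm
    unfold cutσ
    rw [del_apply]
    by_cases ha : x = a
    · simp [ha]
    by_cases hb : x = b
    · rw [if_neg ha, hb, if_pos h1.2, h1.1]
    rw [if_neg ha]
    simp only [del_apply] at h1 ⊢
    grind
  vert x y hx hy := by
    rw [h.active_iff] at hx hy
    rw [cutσ, sameCycle_del hx.2.1 hy.2.1, sameCycle_del hx.2.2.2.1 hy.2.2.2.1,
      sameCycle_del hx.2.2.2.2 hy.2.2.2.2]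
    exact hσ.vert x y hx.1 hy.1

theorem euler_cut (h : Corner α ℓ a b e e' t t' a' b' c) (hσ : IsRot α ℓ σ) :
    (¬ (σ * α).SameCycle e e' → euler (cutα a b e e' α) (cutσ a e e' σ) = euler α σ) ∧
    ((σ * α).SameCycle e e' → euler (cutα a b e e' α) (cutσ a e e' σ) = euler α σ + 2) := by
  have hd := h.distinct
  simp only [List.nodup_cons, List.mem_cons, List.not_mem_nil, or_false, not_or] at hd
  have h1 := h.delEdge_swap hσ
  have i1 : ∀ x, (swap e e' * α) x = if x = e ∨ x = e' then x else α x := by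
    intro x
    have := h.inv; have := h.αe
    have i2 : ∀ x y, α x = α y → x = y := fun x y h => α.injective h
    simp only [Perm.mul_apply, swap_apply_def]
    grind
  have inv := h.inv
  have αe := h.αe
  have αa := h.αa
  have αb := h.αb
  have hu := hσ.cases h.u
  have he' : α e' ≠ e' := by rw [← h.αe, h.inv]; exact h.u.act_b.symm
  have ht : α t ≠ t := by
    rw [h.αt]; rintro rfl; exact h.ne_zw (h.eq_w.symm.trans h.z.eq_ab)
  have l1 : σ e' ≠ e' := fun hh => by
    have := (hσ.vert e' t he' ht).1 h.eq_w.symm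
    exact hd.2.2.2.1.1 (this.eq_of_left hh)
  have l2 := hσ.label he'
  have l3 := h.ne_uw
  have l4 := h.u.eq_ab
  have l5 : σ e' ≠ e := by intro hh; rw [hh] at l2; exact l3 (l2.symm.trans l4)
  have l6 : ∀ x, ℓ x = ℓ a → x ≠ e' := fun x hx hxe => l3 (by rw [← hxe, hx])
  have hb := h.u.eq_ac
  obtain ⟨h2, h3⟩ := euler_delEdge h.inv h.αe (by grind) (σ := σ) (by grind) l1 l5 (by grind)
  have h4 : euler (cutα a b e e' α) (cutσ a e e' σ) = euler (swap e e' * α) (del e (del e' σ)) := by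
    refine euler_smooth ?_ ?_ ?_ ?_ ?_ h1.1 h1.2
    all_goals first | (simp only [i1]; grind) | grind
  rw [h4]
  exact ⟨h2, h3⟩

/-- Among the surviving darts, the transposition at e is the only change to the face cycles: fixing
dead darts does not alter who shares a cycle with whom. -/
theorem sameCycle_cut (h : Corner α ℓ a b e e' t t' a' b' c) (hσ : IsRot α ℓ σ) {x y : D}
    (hx : cutα a b e e' α x ≠ x) (hy : cutα a b e e' α y ≠ y) :
    (cutσ a e e' σ * cutα a b e e' α).SameCycle x y ↔ (swap e e' * (σ * α)).SameCycle x y := by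
  have hd := h.distinct
  simp only [List.nodup_cons, List.mem_cons, List.not_mem_nil, or_false, not_or] at hd
  have h1 := h.delEdge_swap hσ
  rw [h.active_iff] at hx hy
  have i1 : ∀ x, (swap e e' * α) x = if x = e ∨ x = e' then x else α x := by
    intro x
    have := h.inv; have := h.αe
    have i2 : ∀ x y, α x = α y → x = y := fun x y h => α.injective h
    simp only [Perm.mul_apply, swap_apply_def]
    grind
  have inv := h.inv
  have αe := h.αe
  have αa := h.αa
  have αb := h.αb
  unfold cutα cutσ
  rw [mul_smooth ?_ ?_ ?_ ?_ ?_ h1.1 h1.2, sameCycle_del hx.2.1 hy.2.1,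
    sameCycle_del hx.2.2.1 hy.2.2.1, mul_delEdge h.inv h.αe (by grind), sameCycle_del hx.2.2.2.1 hy.2.2.2.1,
      sameCycle_del hx.2.2.2.2 hy.2.2.2.2]
  all_goals first | (simp only [i1]; grind) | grind

end Corner

end Corner


/-! ### Attaching leaves to trees, and a lower bound for the width of tree decompositions -/

section Trees

/-- Attach a new leaf `none` to the node `i₀` of a graph. -/
def addLeaf {ι : Type*} (T : SimpleGraph ι) (i₀ : ι) : SimpleGraph (Option ι) where
  Adj
    | none, none => False
    | none, some j => j = i₀
    | some i, none => i = i₀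
    | some i, some j => T.Adj i j
  symm := ⟨by
    rintro (_ | x) (_ | y) h
    · exact h
    · exact h
    · exact h
    · exact T.adj_symm h⟩
  loopless := ⟨by
    rintro (_ | x) h
    · exact h
    · exact T.irrefl h⟩

variable {ι : Type*} {T : SimpleGraph ι} {i₀ : ι}

theorem connected_induce_addLeaf {S : Set ι} (hS : (T.induce S).Connected) :
    ((addLeaf T i₀).induce (some '' S)).Connected := by
  refine hS.map ⟨fun x => ⟨some x.1, x.1, x.2, rfl⟩, fun {x y} h => h⟩ ?_
  rintro ⟨_, x, hx, rfl⟩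
  exact ⟨⟨x, hx⟩, rfl⟩

theorem connected_induce_none : ((addLeaf T i₀).induce {none}).Connected := by
  have : Nonempty ({none} : Set (Option ι)) := ⟨⟨none, rfl⟩⟩
  exact ⟨fun x y => by rw [Subsingleton.elim x y]⟩

theorem connected_induce_insert_none {S : Set ι} (hS : (T.induce S).Connected) (h : i₀ ∈ S) :
    ((addLeaf T i₀).induce (some '' S ∪ {none})).Connected :=
  SimpleGraph.connected_induce_union (v := some i₀) (w := none) (connected_induce_addLeaf hS).1
    connected_induce_none.1 ⟨i₀, h, rfl⟩ rfl rfl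

theorem edgeSet_addLeaf :
    (addLeaf T i₀).edgeSet = insert s(none, some i₀) (Sym2.map some '' T.edgeSet) := by
  ext e
  induction e with | _ x y
  rw [SimpleGraph.mem_edgeSet, Set.mem_insert_iff, Set.mem_image]
  constructor
  · intro h
    rcases x with _ | x <;> rcases y with _ | y
    · exact h.elim
    · left; rw [show y = i₀ from h]
    · left; rw [show x = i₀ from h]; exact Sym2.eq_swap
    · exact Or.inr ⟨s(x, y), h, rfl⟩
  · rintro (h | ⟨e, he, h⟩)
    · rcases Sym2.eq_iff.1 h with ⟨rfl, rfl⟩ | ⟨rfl, rfl⟩ <;> rfl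
    · induction e with | _ x' y'
      rw [Sym2.map_mk] at h
      rcases Sym2.eq_iff.1 h with ⟨rfl, rfl⟩ | ⟨rfl, rfl⟩
      · exact he
      · exact T.adj_symm he

/-- Connectedness is preserved, and exactly one vertex and one edge are added. -/
theorem isTree_addLeaf [Finite ι] (hT : T.IsTree) : (addLeaf T i₀).IsTree := by
  rw [SimpleGraph.isTree_iff_connected_and_card] at hT ⊢
  constructor
  · have h1 : (T.induce Set.univ).Connected := (SimpleGraph.induceUnivIso T).connected_iff.2 hT.1
    have h2 := connected_induce_insert_none (i₀ := i₀) h1 (Set.mem_univ _)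
    refine h2.map ⟨Subtype.val, fun {x y} h => h⟩ ?_
    rintro (_ | x)
    · exact ⟨⟨none, Or.inr rfl⟩, rfl⟩
    · exact ⟨⟨some x, Or.inl ⟨x, trivial, rfl⟩⟩, rfl⟩
  · rw [Finite.card_option, ← hT.2, Nat.card_coe_set_eq, edgeSet_addLeaf, Set.ncard_insert_of_notMem,
      Set.ncard_image_of_injective _ (Sym2.map.injective (Option.some_injective _)), Nat.card_coe_set_eq]
    rintro ⟨e, -, he⟩
    induction e with | _ x y
    rw [Sym2.map_mk] at he
    rcases Sym2.eq_iff.1 he with ⟨h, -⟩ | ⟨-, h⟩ <;> simp at h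

/-- In a tree with root `r`, the nodes below `t` can only be left from `t` to its parent. -/
theorem eq_of_adj_of_not_below (hT : T.IsTree) {r t x y : ι}
    (hx : T.dist r x = T.dist r t + T.dist t x) (hxy : T.Adj x y)
    (hy : T.dist r y ≠ T.dist r t + T.dist t y) : x = t ∧ T.dist r y < T.dist r t := by
  have hc := hT.connected
  have d1 := hT.dist_eq_dist_add_one_of_adj r hxy
  have d2 := hT.dist_eq_dist_add_one_of_adj t hxy
  have d3 := hc.dist_triangle (u := r) (v := t) (w := y)
  -- Uniqueness of parents: geodesics from r extended by the last edge are paths to x, and a tree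
  -- has only one such path.
  have parent : ∀ {r x y y' : ι}, T.Adj y x → T.Adj y' x → T.dist r x = T.dist r y + 1 →
      T.dist r x = T.dist r y' + 1 → y = y' := by
    intro r x y y' h h' e e'
    obtain ⟨p, hp⟩ := hc.exists_walk_length_eq_dist r y
    obtain ⟨p', hp'⟩ := hc.exists_walk_length_eq_dist r y'
    have q1 : (p.concat h).IsPath := SimpleGraph.Walk.isPath_of_length_eq_dist _ (by
      rw [SimpleGraph.Walk.length_concat, hp, e])
    have q2 : (p'.concat h').IsPath := SimpleGraph.Walk.isPath_of_length_eq_dist _ (by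
      rw [SimpleGraph.Walk.length_concat, hp', e'])
    have := (hT.isAcyclic.subsingleton_path _ _).elim ⟨_, q1⟩ ⟨_, q2⟩
    have h3 : (p.concat h).penultimate = (p'.concat h').penultimate := by
      rw [Subtype.mk.injEq] at this
      rw [this]
    simpa using h3
  by_cases hxt : x = t
  · subst hxt
    have : T.dist x y = 1 := SimpleGraph.dist_eq_one_iff_adj.2 hxy
    refine ⟨rfl, ?_⟩
    omega
  exfalso
  have hpos : 0 < T.dist t x := (hc.pos_dist_of_ne (Ne.symm hxt))
  -- The next node on the geodesic from x to t is the parent of x and is still below t. So y is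
  -- either that parent or a child of x, and in both cases it lies below t.
  obtain ⟨p, hp⟩ := hc.exists_walk_length_eq_dist x t
  have hnil : ¬ p.Nil := SimpleGraph.Walk.not_nil_of_ne hxt
  have hadj := p.adj_snd hnil
  have hl : T.dist p.snd t + 1 ≤ T.dist x t := by
    have := SimpleGraph.dist_le p.tail
    have h2 := SimpleGraph.Walk.length_tail_add_one hnil
    omega
  rw [SimpleGraph.dist_comm (u := p.snd), SimpleGraph.dist_comm (u := x)] at hl
  have d4 := hc.dist_triangle (u := r) (v := t) (w := p.snd)
  have d5 := hT.dist_eq_dist_add_one_of_adj r hadj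
  have d6 := hT.dist_eq_dist_add_one_of_adj t hadj
  rcases d1 with d1 | d1
  · have := parent hxy.symm hadj.symm d1 (by omega)
    subst this
    omega
  · omega

theorem subset_of_induce_connected {G : SimpleGraph ι} {S B : Set ι} (hS : (G.induce S).Connected)
    (h : ∀ x ∈ S, ∀ y ∈ S, x ∈ B → G.Adj x y → y ∈ B) {i : ι} (hi : i ∈ S) (hiB : i ∈ B) : S ⊆ B := by
  intro j hj
  obtain ⟨p⟩ := hS.1 ⟨i, hi⟩ ⟨j, hj⟩
  have : ∀ {u v : S}, (G.induce S).Walk u v → (u : ι) ∈ B → (v : ι) ∈ B := by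
    intro u v p
    induction p with
    | nil => exact id
    | cons hadj _ ih => exact fun hu => ih (h _ (Subtype.prop _) _ (Subtype.prop _) hu hadj)
  exact this p hiB

/-- Some vertex has all its neighbours in a single bag. -/
theorem TreeDecomposition.exists_forall_adj_mem {V : Type u} [Finite V] [Nonempty V]
    {G : SimpleGraph V} {ι : Type} [Finite ι] (D : TreeDecomposition G ι) :
    ∃ v i, v ∈ D.bag i ∧ ∀ w, G.Adj v w → w ∈ D.bag i := by
  obtain ⟨r⟩ := D.isTree.connected.nonempty
  have htop : ∀ v, ∃ t, v ∈ D.bag t ∧ ∀ i, v ∈ D.bag i → D.tree.dist r t ≤ D.tree.dist r i := by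
    intro v
    obtain ⟨⟨i, hi⟩⟩ := (D.connected v).nonempty
    exact Set.exists_min_image {i | v ∈ D.bag i} (D.tree.dist r) (Set.toFinite _) ⟨i, hi⟩
  choose top htop hmin using htop
  -- Choose v so that the topmost node of its subtree is as far from the root as possible.
  obtain ⟨v, hv⟩ := Finite.exists_max fun v => D.tree.dist r (top v)
  refine ⟨v, top v, htop v, fun w hvw => ?_⟩
  obtain ⟨i, hvi, hwi⟩ := D.edge_mem v w hvw
  by_contra hw
  let B : Set ι := {x | D.tree.dist r x = D.tree.dist r (top v) + D.tree.dist (top v) x}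
  -- Leaving the part below `top v` would lead to a node of v nearer to the root than `top v`.
  have h1 : {i | v ∈ D.bag i} ⊆ B := by
    refine subset_of_induce_connected (D.connected v) (fun x hx y hy hxB hxy => ?_) (htop v) ?_
    · by_contra hyB
      have := (eq_of_adj_of_not_below D.isTree hxB hxy hyB).2
      exact absurd (hmin v y hy) (by omega)
    · simp [B]
  -- The only exit from below `top v` is `top v` itself, which the subtree of w avoids by
  -- assumption. So `top w` lies below `top v`, and the choice of v makes the two equal.
  have h2 : {i | w ∈ D.bag i} ⊆ B := by
    refine subset_of_induce_connected (D.connected w) (fun x hx y hy hxB hxy => ?_) hwi (h1 hvi)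
    by_contra hyB
    have := (eq_of_adj_of_not_below D.isTree hxB hxy hyB).1
    subst this
    exact hw hx
  have h3 : D.tree.dist r (top w) = D.tree.dist r (top v) + D.tree.dist (top v) (top w) :=
    h2 (htop w)
  have h4 := hv w
  have h5 : D.tree.dist (top v) (top w) = 0 := by omega
  have h6 := (D.isTree.connected.dist_eq_zero_iff).1 h5
  exact hw (h6 ▸ htop w)

/-- The width of a tree decomposition is at least the minimum degree. -/
theorem le_of_hasTreeDecompositionOfWidth {V : Type u} [Finite V] [Nonempty V]
    {G : SimpleGraph V} {k : ℕ} (h : HasTreeDecompositionOfWidth G k)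
    (hdeg : ∀ v, ∃ x y z, G.Adj v x ∧ G.Adj v y ∧ G.Adj v z ∧ x ≠ y ∧ x ≠ z ∧ y ≠ z) : 3 ≤ k := by
  classical
  obtain ⟨ι, _, D, hD⟩ := h
  obtain ⟨v, i, hvi, hw⟩ := D.exists_forall_adj_mem
  obtain ⟨x, y, z, hx, hy, hz, h1, h2, h3⟩ := hdeg v
  have hsub : ({v, x, y, z} : Finset V) ⊆ D.bag i := by
    intro w hw'
    simp only [Finset.mem_insert, Finset.mem_singleton] at hw'
    rcases hw' with rfl | rfl | rfl | rfl
    · exact hvi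
    · exact hw _ hx
    · exact hw _ hy
    · exact hw _ hz
  have hcard : ({v, x, y, z} : Finset V).card = 4 := by
    have := hx.ne; have := hy.ne; have := hz.ne
    rw [Finset.card_insert_of_notMem, Finset.card_insert_of_notMem, Finset.card_pair h3] <;> simp_all
  have := Finset.card_le_card hsub
  have := hD i
  omega

end Trees

/-! ### Tightness is inherited when a corner is cut off and w keeps its vertex -/

section Tight

variable {D W : Type*}

/-- `κ` labels the faces of the map, given by the rotation `σ` and the edge involution `α`. -/
def IsFaceLabel (α σ : Perm D) (κ : D → ℕ) : Prop :=
  ∀ x y, α x ≠ x → α y ≠ y → (κ x = κ y ↔ (σ * α).SameCycle x y)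

/-- Every vertex occurs at most once on each face, and two faces that share an edge share no
further vertices. Here `ℓ` labels the vertices and `κ` the faces. -/
structure Tight (α : Perm D) (ℓ : D → W) (κ : D → ℕ) : Prop where
  inj : ∀ x y, α x ≠ x → α y ≠ y → ℓ x = ℓ y → κ x = κ y → x = y
  edge : ∀ d x y, α d ≠ d → α x ≠ x → α y ≠ y → κ d = κ x → κ (α d) = κ y → ℓ x = ℓ y →
    ℓ x = ℓ d ∨ ℓ x = ℓ (α d)

/-- The face labels `k` after cutting off a corner, in terms of the old ones `kH`, where `β` is
the old edge involution, and the new triangular face is labelled `N`. -/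
structure CutFaces (β : Perm D) (k kH : D → ℕ) (N : ℕ) (a b e e' t t' a' b' c c' : D) : Prop where
  fresh : ∀ x, β x ≠ x → kH x ≠ N
  old : ∀ x, β x ≠ x → x ≠ a' → x ≠ t → k x = kH x
  k_a' : k a' = N
  k_e : k e = N
  k_t : k t = N
  k_e' : k e' = kH a'
  k_b : k b = kH a'
  k_a : k a = kH c
  kH_b' : kH b' = kH c
  kH_c' : kH c' = kH t'

variable [DecidableEq D]
variable {α σ : Perm D} {ℓ : D → W} {a b e e' t t' a' b' c c' : D} {k kH : D → ℕ} {N : ℕ}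

-- The new triangle N meets only u, z and w. Around u the faces are `kH c`, N and `kH a'`; around z
-- they are N, `kH c` and `kH t'`, because the triangle replaces `kH a'` there. Every other
-- incidence can be transferred to H, the map after the cut, where tightness is known.
set_option maxHeartbeats 2000000 in
theorem Corner.tight (h : Corner α ℓ a b e e' t t' a' b' c)
    (T : Tight (cutα a b e e' α) ℓ kH) (hk : CutFaces (cutα a b e e' α) k kH N a b e e' t t' a' b' c c')
    (hc : α c = c') (hct : c' ≠ t) (hcw : c' ≠ e') (hcu : ℓ c' ≠ ℓ a) (htf : kH t = kH a') : Tight α ℓ k := by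
  have hd := h.distinct
  simp only [List.nodup_cons, List.mem_cons, List.not_mem_nil, or_false, not_or] at hd
  obtain ⟨inv, ⟨ua1, ua2, ua3, un1, un2, un3, ue1, ue2, uf⟩, ⟨za1, za2, za3, zn1, zn2, zn3, ze1, ze2, zf⟩,
    αa, αb, αe, αt, eqw, n1, n2, n3, n4, n5, n6⟩ := id h
  obtain ⟨fresh, old, k1, k2, k3, k4, k5, k6, k7, k8⟩ := hk
  set β := cutα a b e e' α with hβ
  have act : ∀ x, β x ≠ x ↔ α x ≠ x ∧ x ≠ a ∧ x ≠ b ∧ x ≠ e ∧ x ≠ e' := fun x => h.active_iff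
  have val : ∀ x, β x = if x = a ∨ x = b ∨ x = e ∨ x = e' then x else if x = a' then b' else
    if x = b' then a' else α x := h.cutα_apply
  clear_value β
  have Ba' : β a' ≠ a' := by rw [act]; grind
  have Bt' : β t' ≠ t' := by rw [act]; grind
  have Bt : β t ≠ t := by rw [act]; grind
  have Bc : β c ≠ c := by rw [act]; grind
  have Bc' : β c' ≠ c' := by rw [act]; grind
  have Bb' : β b' ≠ b' := by rw [act]; grind
  have f1 : kH a' ≠ kH t' := fun hh => zn1 (T.inj _ _ Ba' Bt' ze1.symm hh)
  have f2 : kH a' ≠ kH c := fun hh => zn2 (T.inj _ _ Ba' Bc ze2.symm hh)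
  have f3 : kH t' ≠ kH c := fun hh => zn3 (T.inj _ _ Bt' Bc (ze1.trans ze2.symm) hh)
  have F1 := fresh _ Ba'
  have F2 := fresh _ Bt'
  have F3 := fresh _ Bc
  have kc : k c = kH c := old _ Bc (by grind) (by grind)
  have kt' : k t' = kH t' := old _ Bt' (by grind) (by grind)
  have kc' : k c' = kH t' := (old _ Bc' (by grind) (by grind)).trans k8
  have kb' : k b' = kH c := (old _ Bb' (by grind) (by grind)).trans k7
  have cls : ∀ x, α x ≠ x → x = a ∨ x = b ∨ x = e ∨ x = e' ∨ x = a' ∨ x = t ∨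
      (β x ≠ x ∧ k x = kH x ∧ k x ≠ N ∧ x ≠ a' ∧ x ≠ t ∧ ℓ x ≠ ℓ a) := by
    intro x hx
    have := uf x hx
    have := act x
    have := old x
    have := fresh x
    grind
  have hinj : ∀ x y, α x ≠ x → α y ≠ y → ℓ x = ℓ y → k x = k y → x = y := by
    have hw : ∀ x, β x ≠ x → x ≠ t → k x = kH x → ℓ x = ℓ t → kH x ≠ kH a' := fun x h1 h2 h3 h4 h5 =>
      h2 (T.inj x t h1 Bt h4 (by rw [h5, htf]))
    have hz : ∀ x, β x ≠ x → ℓ x = ℓ a' → x = a' ∨ x = t' ∨ x = c := fun x hx =>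
      zf x ((act x).1 hx).1
    intro x y hx hy hl hkk
    have h1 := cls x hx
    have h2 := cls y hy
    have := T.inj x y
    have := hw x; have := hw y; have := hz x; have := hz y
    clear cls uf zf old fresh act val hw hz T inv
    rcases h1 with rfl | rfl | rfl | rfl | rfl | rfl | h1 <;> grind (splits := 20)
  refine ⟨hinj, ?_⟩
  -- Incidences away from u and N are transferred to H. The deleted dart e' is replaced by t, which
  -- has the same vertex and, by `htf`, carries in H the face that e' now borders.
  have rep : ∀ x, α x ≠ x → ℓ x ≠ ℓ a → k x ≠ N → ∃ x', β x' ≠ x' ∧ ℓ x' = ℓ x ∧ kH x' = k x := by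
    intro x hx hl hn
    rcases cls x hx with hh | hh | hh | hh | hh | hh | hh
    · exact absurd (by rw [hh]) hl
    · exact absurd (by rw [hh, ue2]) hl
    · exact absurd (by rw [hh, ue1]) hl
    · exact ⟨t, Bt, by rw [hh, eqw], by rw [hh, htf, k4]⟩
    · exact absurd (by rw [hh, k1]) hn
    · exact absurd (by rw [hh, k3]) hn
    · exact ⟨x, hh.1, rfl, hh.2.1.symm⟩
  have hN : ∀ x, α x ≠ x → k x = N → x = a' ∨ x = e ∨ x = t := by
    intro x hx hn
    have := cls x hx
    grind
  -- The claim is symmetric under reversing d, so one dart of each edge suffices: the three sides of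
  -- the triangle, the edge at b, and the edges that H has unchanged.
  have main : ∀ d, (d = a ∨ d = e ∨ d = t ∨ d = b ∨
      (β d ≠ d ∧ β d = α d ∧ d ≠ t' ∧ d ≠ t ∧ d ≠ a' ∧ α d ≠ t ∧ α d ≠ a')) → ∀ x y, α x ≠ x →
      α y ≠ y → k d = k x → k (α d) = k y → ℓ x = ℓ y → ℓ x = ℓ d ∨ ℓ x = ℓ (α d) := by
    intro d hdd x y hx hy hkx hky hl
    rcases hdd with rfl | rfl | rfl | rfl | ⟨g1, g2, g3, g4, g5, g6, g7⟩
    · rw [αa] at hky ⊢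
      rcases hN y hy (by grind) with h1 | h1 | h1
      · right; rw [hl, h1]
      · left; rw [hl, h1, ue1]
      -- The third corner w of the triangle cannot lie on `kH c`: in H it would be common to both
      -- sides of the edge of a' without being one of its ends.
      · exfalso
        obtain ⟨x', hx1, hx2, hx3⟩ := rep x hx (by grind) (by grind)
        have := T.edge a' t x' Ba' Bt hx1 htf.symm
        have := val a'
        grind
    · rw [αe] at hky ⊢
      rcases hN x hx (by grind) with rfl | rfl | rfl
      · have := cls y hy
        have := zf y hy
        grind
      · exact Or.inl rfl
      · exact Or.inr eqw
    · rw [αt] at hky ⊢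
      rcases hN x hx (by grind) with rfl | rfl | rfl
      · exact Or.inr ze1.symm
      · have := uf y hy
        grind
      · exact Or.inl rfl
    · rw [αb] at hky ⊢
      by_cases hlu : ℓ x = ℓ a
      · left; rw [hlu, ue2]
      -- The faces beside b are those beside the edge of a' in H, so a common vertex other than u is
      -- z or the end of b'; but z no longer meets `kH a'`.
      obtain ⟨x', hx1, hx2, hx3⟩ := rep x hx (by grind) (by grind)
      obtain ⟨y', hy1, hy2, hy3⟩ := rep y hy (by grind) (by grind)
      have := T.edge a' x' y' Ba' hx1 hy1 (by grind) (by have := val a'; grind) (by grind)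
      have : β a' = b' := by have := val a'; grind
      have := zf x hx
      grind
    · have A1 := (act d).1 g1
      have g8 : β (α d) ≠ α d := by rw [act]; grind
      have K1 : k d = kH d := old _ g1 g5 g4
      have K2 : k (α d) = kH (α d) := old _ g8 g7 g6
      have N1 := fresh _ g1
      have N2 := fresh _ g8
      by_cases hlu : ℓ x = ℓ a
      · exfalso
        have u1 := uf x hx hlu
        have u2 := uf y hy (hl.symm.trans hlu)
        -- If u were common to both sides of d, these sides would be among `kH c` and `kH a'`, both
        -- of which meet z in H. Tightness of H then makes z an end of d, leaving only the edge of
        -- c; but one of its sides is `kH t'`.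
        have e1 := T.edge d c c g1 Bc Bc
        have e2 := T.edge d a' a' g1 Ba' Ba'
        have e3 := T.edge d a' c g1 Ba' Bc
        have e4 := T.edge d c a' g1 Bc Ba'
        have z1 := zf d A1.1
        have z2 := zf (α d) (by grind)
        have p1 : kH d = kH c ∨ kH d = kH a' := by
          clear z1 z2 e1 e2 e3 e4 rep hN cls uf zf old fresh act val T inv
          grind
        have p2 : kH (α d) = kH c ∨ kH (α d) = kH a' := by
          clear z1 z2 e1 e2 e3 e4 rep hN cls uf zf old fresh act val T inv
          grind
        have p3 : ℓ a' = ℓ d ∨ ℓ a' = ℓ (α d) := by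
          rw [g2] at e1 e2 e3 e4
          rcases p1 with p1 | p1 <;> rcases p2 with p2 | p2
          · rw [← ze2]; exact e1 p1 p2 rfl
          · rw [← ze2]; exact e4 p1 p2 ze2
          · exact e3 p1 p2 ze2.symm
          · exact e2 p1 p2 rfl
        clear e1 e2 e3 e4 rep hN cls uf zf old fresh act val T
        grind
      · obtain ⟨x', hx1, hx2, hx3⟩ := rep x hx (by grind) (by grind)
        obtain ⟨y', hy1, hy2, hy3⟩ := rep y hy (by grind) (by grind)
        have := T.edge d x' y' g1 hx1 hy1 (by grind) (by grind) (by grind)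
        grind
  intro d x y hdd hx hy hkx hky hl
  have hcase : (d = a ∨ d = e ∨ d = t ∨ d = b ∨
      (β d ≠ d ∧ β d = α d ∧ d ≠ t' ∧ d ≠ t ∧ d ≠ a' ∧ α d ≠ t ∧ α d ≠ a')) ∨
      (α d = a ∨ α d = e ∨ α d = t ∨ α d = b) := by
    have := act d; have := val d; have := inv d
    grind
  rcases hcase with hcase | hcase
  · exact main d hcase x y hx hy hkx hky hl
  · have := main (α d) (by tauto) y x hy hx hky (by rw [inv]; exact hkx) hl.symm
    rw [inv, ← hl] at this
    exact this.symm

end Tight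

/-! ### Truncations, where w is smoothed out as well, and their tightness -/

section Truncation

variable {D W : Type*}

/-- A corner at `z` that is cut off by an edge `uw`, where also `w` is a vertex of degree three. The
third dart at `w` is `s`, with reversal `s'`. -/
structure Truncation (α : Perm D) (ℓ : D → W) (a b e e' t t' a' b' c s s' : D) : Prop where
  corner : Corner α ℓ a b e e' t t' a' b' c
  w : DegThree α ℓ e' t s
  αs : α s = s'
  ne_us : ℓ s' ≠ ℓ a
  ne_zs : ℓ s' ≠ ℓ a'
  ne_ws : ℓ s' ≠ ℓ e'

theorem Truncation.swap {α : Perm D} {ℓ : D → W} {a b e e' t t' a' b' c s s' : D}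
    (h : Truncation α ℓ a b e e' t t' a' b' c s s') : Truncation α ℓ t s e' e a a' t' s' c b b' where
  corner :=
    { inv := h.corner.inv
      u := h.w.rotate
      z := h.corner.z.rotate
      αa := h.corner.αt
      αb := h.αs
      αe := by rw [← h.corner.αe, h.corner.inv]
      αt := h.corner.αa
      eq_w := h.corner.u.eq_ab.symm
      ne_uz := by rw [h.corner.z.eq_ab, h.w.eq_ab]; exact h.corner.ne_zw.symm
      ne_uw := by rw [h.corner.u.eq_ab, h.w.eq_ab]; exact h.corner.ne_uw.symm
      ne_zw := by rw [h.corner.u.eq_ab, h.corner.z.eq_ab]; exact h.corner.ne_uz.symm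
      ne_ub := by rw [h.w.eq_ab]; exact h.ne_ws
      ne_zb := by rw [h.corner.z.eq_ab]; exact h.ne_zs
      ne_wb := by rw [h.corner.u.eq_ab]; exact h.ne_us }
  w := h.corner.u.rotate
  αs := h.corner.αb
  ne_us := by rw [h.w.eq_ab]; exact h.corner.ne_wb
  ne_zs := by rw [h.corner.z.eq_ab]; exact h.corner.ne_zb
  ne_ws := by rw [h.corner.u.eq_ab]; exact h.corner.ne_ub

variable [DecidableEq D]
variable {α σ : Perm D} {ℓ : D → W} {a b e e' t t' a' b' c c' s s' : D} {k kH : D → ℕ} {N : ℕ}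

namespace Truncation

omit [DecidableEq D] in
theorem distinct (h : Truncation α ℓ a b e e' t t' a' b' c s s') :
    [a, b, e, e', t, t', a', b', c].Nodup ∧ s ≠ a ∧ s ≠ b ∧ s ≠ e ∧ s ≠ e' ∧ s ≠ t ∧ s ≠ t' ∧
    s ≠ a' ∧ s ≠ b' ∧ s ≠ c ∧ s' ≠ a ∧ s' ≠ b ∧ s' ≠ e ∧ s' ≠ e' ∧ s' ≠ t ∧ s' ≠ t' ∧
    s' ≠ a' ∧ s' ≠ b' ∧ s' ≠ c ∧ s' ≠ s := by
  refine ⟨h.corner.distinct, ?_⟩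
  have hd := h.corner.distinct
  simp only [List.nodup_cons, List.mem_cons, List.not_mem_nil, or_false, not_or] at hd
  obtain ⟨⟨inv, ⟨ua1, ua2, ua3, un1, un2, un3, ue1, ue2, uf⟩, ⟨za1, za2, za3, zn1, zn2, zn3, ze1, ze2, zf⟩,
    αa, αb, αe, αt, eqw, n1, n2, n3, n4, n5, n6⟩, ⟨wa1, wa2, wa3, wn1, wn2, wn3, we1, we2, wf⟩, αs,
      m1, m2, m3⟩ := h
  clear uf zf wf
  and_intros <;> grind

theorem cut_apply (h : Truncation α ℓ a b e e' t t' a' b' c s s') (x : D) :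
    smooth t s (cutα a b e e' α) x =
    if x = a ∨ x = b ∨ x = e ∨ x = e' ∨ x = t ∨ x = s then x else if x = a' then b' else
      if x = b' then a' else if x = t' then s' else if x = s' then t' else α x := by
  have hd := h.distinct
  simp only [List.nodup_cons, List.mem_cons, List.not_mem_nil, or_false, not_or] at hd
  have inv := h.corner.inv
  have αt := h.corner.αt
  have αs := h.αs
  have val := h.corner.cutα_apply
  have := val t; have := val s; have := val x
  have := inv t; have := inv s
  rw [smooth_apply h.corner.cutα_inv] <;> clear val <;> grind

theorem active_iff (h : Truncation α ℓ a b e e' t t' a' b' c s s') {x : D} :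
    smooth t s (cutα a b e e' α) x ≠ x ↔
      α x ≠ x ∧ x ≠ a ∧ x ≠ b ∧ x ≠ e ∧ x ≠ e' ∧ x ≠ t ∧ x ≠ s := by
  have hd := h.distinct
  simp only [List.nodup_cons, List.mem_cons, List.not_mem_nil, or_false, not_or] at hd
  have inv := h.corner.inv
  have αa := h.corner.αa
  have αb := h.corner.αb
  have αt := h.corner.αt
  have αs := h.αs
  rw [h.cut_apply]
  have := inv a; have := inv b; have := inv t; have := inv s
  clear inv
  grind

-- Both u and w are new here. The faces around w are `kH a'`, N and `kH t'`, mirroring those around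
-- u, so each argument about u has a counterpart for w. All other incidences pass to H with the same
-- dart.
set_option maxHeartbeats 2000000 in
theorem tight (h : Truncation α ℓ a b e e' t t' a' b' c s s')
    (T : Tight (smooth t s (cutα a b e e' α)) ℓ kH)
    (hk : CutFaces (smooth t s (cutα a b e e' α)) k kH N a b e e' t t' a' b' c c')
    (hc : α c = c') (hcu : ℓ c' ≠ ℓ a) (hcw : ℓ c' ≠ ℓ e') (hs : k s = kH t') (hs' : kH s' = kH a') :
    Tight α ℓ k := by
  have hd := h.distinct
  simp only [List.nodup_cons, List.mem_cons, List.not_mem_nil, or_false, not_or] at hd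
  obtain ⟨⟨inv, ⟨ua1, ua2, ua3, un1, un2, un3, ue1, ue2, uf⟩, ⟨za1, za2, za3, zn1, zn2, zn3, ze1, ze2, zf⟩,
    αa, αb, αe, αt, eqw, n1, n2, n3, n4, n5, n6⟩, ⟨wa1, wa2, wa3, wn1, wn2, wn3, we1, we2, wf⟩, αs,
      m1, m2, m3⟩ := id h
  obtain ⟨fresh, old, k1, k2, k3, k4, k5, k6, k7, k8⟩ := hk
  set β := smooth t s (cutα a b e e' α) with hβ
  have act : ∀ x, β x ≠ x ↔ α x ≠ x ∧ x ≠ a ∧ x ≠ b ∧ x ≠ e ∧ x ≠ e' ∧ x ≠ t ∧ x ≠ s :=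
    fun x => h.active_iff
  have val : ∀ x, β x = if x = a ∨ x = b ∨ x = e ∨ x = e' ∨ x = t ∨ x = s then x else
      if x = a' then b' else if x = b' then a' else if x = t' then s' else if x = s' then t' else α x :=
    h.cut_apply
  clear_value β
  have αs' : α s' = s := by rw [← αs, inv]
  have Ba' : β a' ≠ a' := by rw [act]; grind
  have Bt' : β t' ≠ t' := by rw [act]; grind
  have Bc : β c ≠ c := by rw [act]; grind
  have Bc' : β c' ≠ c' := by rw [act]; clear uf zf wf act val old; grind
  have Bb' : β b' ≠ b' := by rw [act]; grind
  have Bs' : β s' ≠ s' := by rw [act]; grind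
  have va' : β a' = b' := by have := val a'; grind
  have vt' : β t' = s' := by have := val t'; grind
  have f1 : kH a' ≠ kH t' := fun hh => zn1 (T.inj _ _ Ba' Bt' ze1.symm hh)
  have f2 : kH a' ≠ kH c := fun hh => zn2 (T.inj _ _ Ba' Bc ze2.symm hh)
  have f3 : kH t' ≠ kH c := fun hh => zn3 (T.inj _ _ Bt' Bc (ze1.trans ze2.symm) hh)
  have F1 := fresh _ Ba'
  have F2 := fresh _ Bt'
  have F3 := fresh _ Bc
  have kc : k c = kH c := old _ Bc (by grind) (by grind)
  have kt' : k t' = kH t' := old _ Bt' (by grind) (by grind)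
  have kc' : k c' = kH t' := (old _ Bc' (by grind) (by grind)).trans k8
  have kb' : k b' = kH c := (old _ Bb' (by grind) (by grind)).trans k7
  have ks' : k s' = kH a' := (old _ Bs' (by grind) (by grind)).trans hs'
  have cls : ∀ x, α x ≠ x → x = a ∨ x = b ∨ x = e ∨ x = e' ∨ x = t ∨ x = s ∨ x = a' ∨
      (β x ≠ x ∧ k x = kH x ∧ k x ≠ N ∧ x ≠ a' ∧ ℓ x ≠ ℓ a ∧ ℓ x ≠ ℓ e') := by
    intro x hx
    have := uf x hx
    have := wf x hx
    have := act x
    have := old x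
    have := fresh x
    clear uf zf wf val inv
    grind
  have hinj : ∀ x y, α x ≠ x → α y ≠ y → ℓ x = ℓ y → k x = k y → x = y := by
    intro x y hx hy hl hkk
    have h1 := cls x hx
    have h2 := cls y hy
    have := T.inj x y
    have := zf x hx; have := zf y hy
    clear cls uf zf wf old fresh act val T inv
    rcases h1 with rfl | rfl | rfl | rfl | rfl | rfl | rfl | h1 <;> grind (splits := 20)
  refine ⟨hinj, ?_⟩
  have rep : ∀ x, α x ≠ x → ℓ x ≠ ℓ a → ℓ x ≠ ℓ e' → k x ≠ N → β x ≠ x ∧ kH x = k x := by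
    intro x hx hl hl' hn
    have := cls x hx
    clear cls uf zf wf old fresh act val T inv
    grind
  have hN : ∀ x, α x ≠ x → k x = N → x = a' ∨ x = e ∨ x = t := by
    intro x hx hn
    have := cls x hx
    clear cls uf zf wf old fresh act val T inv
    grind
  have main : ∀ d, (d = a ∨ d = e ∨ d = t ∨ d = b ∨ d = s ∨
      (β d ≠ d ∧ β d = α d ∧ d ≠ t' ∧ d ≠ a' ∧ α d ≠ t' ∧ α d ≠ a')) → ∀ x y, α x ≠ x →
      α y ≠ y → k d = k x → k (α d) = k y → ℓ x = ℓ y → ℓ x = ℓ d ∨ ℓ x = ℓ (α d) := by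
    intro d hdd x y hx hy hkx hky hl
    rcases hdd with rfl | rfl | rfl | rfl | rfl | ⟨g1, g2, g3, g4, g6, g7⟩
    · rw [αa] at hky ⊢
      rcases hN y hy (by grind) with h1 | h1 | h1
      · right; rw [hl, h1]
      · left; rw [hl, h1, ue1]
      · exfalso
        have := wf x hx
        clear cls uf zf wf old fresh act val T inv
        grind
    · rw [αe] at hky ⊢
      rcases hN x hx (by grind) with h1 | h1 | h1
      · have := zf y hy
        clear cls uf zf wf old fresh act val T inv
        grind
      · exact Or.inl (by rw [h1])
      · exact Or.inr (by rw [h1, eqw])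
    · rw [αt] at hky ⊢
      rcases hN x hx (by grind) with h1 | h1 | h1
      · exact Or.inr (by rw [h1, ze1])
      · have := uf y hy
        clear cls uf zf wf old fresh act val T inv
        grind
      · exact Or.inl (by rw [h1])
    · rw [αb] at hky ⊢
      by_cases hlu : ℓ x = ℓ a
      · left; rw [hlu, ue2]
      by_cases hlw : ℓ x = ℓ e'
      · have := wf y hy
        clear cls uf zf wf old fresh act val T inv
        grind
      obtain ⟨hx1, hx3⟩ := rep x hx hlu hlw (by grind)
      obtain ⟨hy1, hy3⟩ := rep y hy (by grind) (by grind) (by grind)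
      have := T.edge a' x y Ba' hx1 hy1 (by grind) (by grind) hl
      have := zf x hx
      clear cls uf zf wf old fresh act val T inv
      grind
    · rw [αs] at hky ⊢
      by_cases hlw : ℓ x = ℓ e'
      · left; rw [hlw, we2]
      by_cases hlu : ℓ x = ℓ a
      · have := uf x hx
        clear cls uf zf wf old fresh act val T inv
        grind
      obtain ⟨hx1, hx3⟩ := rep x hx hlu hlw (by grind)
      obtain ⟨hy1, hy3⟩ := rep y hy (by grind) (by grind) (by grind)
      have := T.edge t' x y Bt' hx1 hy1 (by grind) (by grind) hl
      have := zf y hy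
      clear cls uf zf wf old fresh act val T inv
      grind
    · have A1 := (act d).1 g1
      have g8 : β (α d) ≠ α d := by
        rw [act]
        clear cls uf zf wf old fresh act T
        grind
      have K1 : k d = kH d := by
        have := cls d A1.1
        clear cls uf zf wf old fresh act T
        grind
      have A2 := (act _).1 g8
      have K2 : k (α d) = kH (α d) := by
        have := cls _ A2.1
        clear cls uf zf wf old fresh act T
        grind
      have N1 := fresh _ g1
      have N2 := fresh _ g8
      have z1 := zf d A1.1
      have z2 := zf (α d) A2.1
      -- When both sides of d meet z in H, tightness of H makes z an end of d. This refutes a common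
      -- vertex u or w, since z lies on all the faces concerned.
      have via : ∀ p q, β p ≠ p → β q ≠ q → kH d = kH p → kH (α d) = kH q → ℓ p = ℓ a' → ℓ q = ℓ a' →
          ℓ a' = ℓ d ∨ ℓ a' = ℓ (α d) := by
        intro p q hp hq e1 e2 l1 l2
        rw [← l1, ← g2]
        exact T.edge d p q g1 hp hq e1 (by rw [g2, e2]) (l1.trans l2.symm)
      by_cases hlu : ℓ x = ℓ a
      · exfalso
        have u1 := uf x hx hlu
        have u2 := uf y hy (hl.symm.trans hlu)
        have e1 := via c c Bc Bc
        have e2 := via a' a' Ba' Ba'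
        have e3 := via a' c Ba' Bc
        have e4 := via c a' Bc Ba'
        clear via rep hN cls uf zf wf old fresh act val T
        have p1 : kH d = kH c ∨ kH d = kH a' := by grind
        have p2 : kH (α d) = kH c ∨ kH (α d) = kH a' := by grind
        clear u1 u2
        have p3 : ℓ a' = ℓ d ∨ ℓ a' = ℓ (α d) := by
          rcases p1 with p1 | p1 <;> rcases p2 with p2 | p2
          · exact e1 p1 p2 ze2 ze2
          · exact e4 p1 p2 ze2 rfl
          · exact e3 p1 p2 rfl ze2
          · exact e2 p1 p2 rfl rfl
        clear e1 e2 e3 e4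
        grind
      by_cases hlw : ℓ x = ℓ e'
      · exfalso
        have u1 := wf x hx hlw
        have u2 := wf y hy (hl.symm.trans hlw)
        have e1 := via t' t' Bt' Bt'
        have e2 := via a' a' Ba' Ba'
        have e3 := via a' t' Ba' Bt'
        have e4 := via t' a' Bt' Ba'
        clear via rep hN cls uf zf wf old fresh act val T
        have p1 : kH d = kH t' ∨ kH d = kH a' := by grind
        have p2 : kH (α d) = kH t' ∨ kH (α d) = kH a' := by grind
        clear u1 u2
        have p3 : ℓ a' = ℓ d ∨ ℓ a' = ℓ (α d) := by
          rcases p1 with p1 | p1 <;> rcases p2 with p2 | p2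
          · exact e1 p1 p2 ze1 ze1
          · exact e4 p1 p2 ze1 rfl
          · exact e3 p1 p2 rfl ze1
          · exact e2 p1 p2 rfl rfl
        clear e1 e2 e3 e4
        grind
      · obtain ⟨hx1, hx3⟩ := rep x hx hlu hlw (by grind)
        obtain ⟨hy1, hy3⟩ := rep y hy (by grind) (by grind) (by grind)
        have := T.edge d x y g1 hx1 hy1 (by grind) (by grind) hl
        rwa [g2] at this
  intro d x y hdd hx hy hkx hky hl
  have hcase : (d = a ∨ d = e ∨ d = t ∨ d = b ∨ d = s ∨
      (β d ≠ d ∧ β d = α d ∧ d ≠ t' ∧ d ≠ a' ∧ α d ≠ t' ∧ α d ≠ a')) ∨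
      (α d = a ∨ α d = e ∨ α d = t ∨ α d = b ∨ α d = s) := by
    have := act d; have := val d; have := inv d
    have := inv a; have := inv t; have := inv e; have := inv b
    clear main hN rep hinj cls uf zf wf old fresh act val T inv
    by_cases d = a; · tauto
    by_cases d = b; · tauto
    by_cases d = e; · tauto
    by_cases d = t; · tauto
    by_cases d = s; · tauto
    by_cases d = a'; · right; left; grind
    by_cases d = t'; · grind
    by_cases d = e'; · grind
    by_cases d = b'; · grind
    by_cases d = s'; · grind
    grind
  rcases hcase with hcase | hcase
  · exact main d hcase x y hx hy hkx hky hl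
  · have := main (α d) (by tauto) y x hy hx hky (by rw [inv]; exact hkx) hl.symm
    rw [inv, ← hl] at this
    exact this.symm

end Truncation

end Truncation

/-! ### Face labels and the tree decomposition of the dual after a cut -/

section Decomposition

variable {D W : Type*}

/-- The dual has a tree decomposition of width at most three in which the faces around each vertex
of degree three have a common bag. -/
def HasDualDecomposition (α σ : Perm D) (κ : D → ℕ) : Prop :=
  ∃ (ι : Type) (_ : Finite ι) (T : SimpleGraph ι) (bag : ι → Finset ℕ), T.IsTree ∧
    (∀ i, (bag i).card ≤ 4) ∧
    (∀ d, α d ≠ d → ∃ i, κ d ∈ bag i ∧ κ (α d) ∈ bag i) ∧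
    (∀ d, α d ≠ d → σ (σ (σ d)) = d → ∃ i, κ d ∈ bag i ∧ κ (σ d) ∈ bag i ∧ κ (σ (σ d)) ∈ bag i) ∧
    ∀ d, α d ≠ d → (T.induce {i | κ d ∈ bag i}).Connected

/-- The new face N meets only faces around z, and these have a common bag because z has period
three. A leaf carrying N and these faces is attached to that bag; it covers the altered edges and
the faces around the new vertices, so that vertices of degree three again have common bags. -/
theorem HasDualDecomposition.extend {β τ : Perm D} {κ : D → ℕ} (h : HasDualDecomposition β τ κ)
    {z : D} (hz : β z ≠ z) (hz3 : τ (τ (τ z)) = z) :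
    ∃ N, (∀ x, β x ≠ x → κ x ≠ N) ∧ ∀ (α σ : Perm D) (k : D → ℕ),
      (∀ d, α d ≠ d → (k d ∈ ({N, κ z, κ (τ z), κ (τ (τ z))} : Finset ℕ) ∧
        k (α d) ∈ ({N, κ z, κ (τ z), κ (τ (τ z))} : Finset ℕ)) ∨
        ∃ d', β d' ≠ d' ∧ k d = κ d' ∧ k (α d) = κ (β d')) →
      (∀ d, α d ≠ d → σ (σ (σ d)) = d → (k d ∈ ({N, κ z, κ (τ z), κ (τ (τ z))} : Finset ℕ) ∧
        k (σ d) ∈ ({N, κ z, κ (τ z), κ (τ (τ z))} : Finset ℕ) ∧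
        k (σ (σ d)) ∈ ({N, κ z, κ (τ z), κ (τ (τ z))} : Finset ℕ)) ∨
        ∃ d', β d' ≠ d' ∧ τ (τ (τ d')) = d' ∧ k d = κ d' ∧ k (σ d) = κ (τ d') ∧
          k (σ (σ d)) = κ (τ (τ d'))) →
      (∀ d, α d ≠ d → k d = N ∨ ∃ d', β d' ≠ d' ∧ k d = κ d') →
      HasDualDecomposition α σ k := by
  classical
  obtain ⟨ι, hι, T, bag, hT, hcard, hedge, h3, hconn⟩ := h
  obtain ⟨i₀, hi1, hi2, hi3⟩ := h3 z hz hz3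
  have := Fintype.ofFinite ι
  -- Avoiding all bags means avoiding all labels in use, and it confines N to the new leaf.
  obtain ⟨N, hN⟩ := Infinite.exists_notMem_finset (Finset.univ.biUnion bag)
  have hN' : ∀ i, N ∉ bag i := fun i hi => hN (Finset.mem_biUnion.2 ⟨i, Finset.mem_univ _, hi⟩)
  have hfresh : ∀ x, β x ≠ x → κ x ≠ N := by
    rintro x hx rfl
    obtain ⟨i, hi, -⟩ := hedge x hx
    exact hN' i hi
  refine ⟨N, hfresh, fun α σ k hE h3' hL => ?_⟩
  set S : Finset ℕ := {N, κ z, κ (τ z), κ (τ (τ z))} with hS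
  have hSi : ∀ n ∈ S, n ≠ N → n ∈ bag i₀ := by
    intro n hn hne
    simp only [hS, Finset.mem_insert, Finset.mem_singleton] at hn
    rcases hn with rfl | rfl | rfl | rfl
    · exact absurd rfl hne
    all_goals assumption
  let bag' : Option ι → Finset ℕ := fun o => o.elim S bag
  refine ⟨Option ι, inferInstance, addLeaf T i₀, bag', isTree_addLeaf hT, ?_, ?_, ?_, ?_⟩
  · rintro (_ | i)
    · exact Finset.card_le_four
    · exact hcard i
  · intro d hd
    rcases hE d hd with ⟨h1, h2⟩ | ⟨d', hd', h1, h2⟩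
    · exact ⟨none, h1, h2⟩
    · obtain ⟨i, hi, hi'⟩ := hedge d' hd'
      refine ⟨some i, ?_, ?_⟩
      · rw [h1]; exact hi
      · rw [h2]; exact hi'
  · intro d hd hd3
    rcases h3' d hd hd3 with ⟨h1, h2, h4⟩ | ⟨d', hd', hd3', h1, h2, h4⟩
    · exact ⟨none, h1, h2, h4⟩
    · obtain ⟨i, hi, hi', hi''⟩ := h3 d' hd' hd3'
      refine ⟨some i, ?_, ?_, ?_⟩
      · rw [h1]; exact hi
      · rw [h2]; exact hi'
      · rw [h4]; exact hi''
  · intro d hd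
    by_cases hdN : k d = N
    · have : {o | k d ∈ bag' o} = {none} := by
        ext (_ | i)
        · simp [bag', hdN, hS]
        · simp [bag', hdN, hN']
      rw [this]
      exact connected_induce_none
    obtain ⟨d', hd', hk⟩ := (hL d hd).resolve_left hdN
    have hc := hconn d' hd'
    by_cases hdS : k d ∈ S
    · have : {o | k d ∈ bag' o} = some '' {i | κ d' ∈ bag i} ∪ {none} := by
        ext (_ | i)
        · simp [bag', hdS]
        · simp [bag', hk]
      rw [this]
      exact connected_induce_insert_none hc (hk ▸ hSi _ hdS hdN)
    · have : {o | k d ∈ bag' o} = some '' {i | κ d' ∈ bag i} := by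
        ext (_ | i)
        · simp [bag', hdS]
        · simp [bag', hk]
      rw [this]
      exact connected_induce_addLeaf hc

variable [DecidableEq D]

/-- The faces of the cut map are the old ones with the two sides of e fused. Representatives off the
face of e undo this: for them the fused relation coincides with the original one, and the face of e
gets the fresh label N. -/
theorem isFaceLabel_of_representatives [Finite D] {α σ β τ : Perm D} {e e' : D} {k kH : D → ℕ} {N : ℕ}
    (hH : IsFaceLabel β τ kH)
    (hm : ∀ x y, β x ≠ x → β y ≠ y →
      ((τ * β).SameCycle x y ↔ (swap e e' * (σ * α)).SameCycle x y))
    (hne : ¬ (σ * α).SameCycle e e') (hN : ∀ x, β x ≠ x → kH x ≠ N)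
    (hrep : ∀ x, α x ≠ x → (k x = N ∧ (σ * α).SameCycle x e) ∨
      ∃ y, β y ≠ y ∧ (σ * α).SameCycle x y ∧ k x = kH y ∧ ¬ (σ * α).SameCycle y e) :
    IsFaceLabel α σ k := by
  intro x y hx hy
  rcases hrep x hx with ⟨hx1, hx2⟩ | ⟨x', hx1, hx2, hx3, hx4⟩ <;>
    rcases hrep y hy with ⟨hy1, hy2⟩ | ⟨y', hy1, hy2, hy3, hy4⟩
  · rw [hx1, hy1]
    exact iff_of_true rfl (hx2.trans hy2.symm)
  · refine iff_of_false ?_ fun hh => hy4 (hy2.symm.trans (hh.symm.trans hx2))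
    rw [hx1, hy3]
    exact (hN _ hy1).symm
  · refine iff_of_false ?_ fun hh => hx4 (hx2.symm.trans (hh.trans hy2))
    rw [hy1, hx3]
    exact hN _ hx1
  · rw [hx3, hy3, hH _ _ hx1 hy1, hm _ _ hx1 hy1, sameCycle_swap_mul_iff hne]
    constructor
    · rintro (hh | ⟨h1 | h1, h2 | h2⟩)
      · exact hx2.trans (hh.trans hy2.symm)
      · exact absurd h1 hx4
      · exact absurd h1 hx4
      · exact absurd h2 hy4
      · exact hx2.trans (h1.trans (h2.symm.trans hy2.symm))
    · exact fun hh => Or.inl (hx2.symm.trans (hh.trans hy2))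

omit [DecidableEq D] in
/-- The face of the triangle that is cut off. -/
theorem Corner.mem_of_sameCycle [Finite D] {α σ : Perm D} {ℓ : D → W} {a b e e' t t' a' b' c : D}
    (h : Corner α ℓ a b e e' t t' a' b' c) (h1 : σ a = e) (h2 : σ e' = t) (h3 : σ t' = a') {x : D}
    (hx : (σ * α).SameCycle e x) : x = a' ∨ x = e ∨ x = t := by
  have αa' : α a' = a := by rw [← h.αa, h.inv]
  refine D3.mem_of_sameCycle (S := {x | x = a' ∨ x = e ∨ x = t}) ?_ hx (Or.inr (Or.inl rfl))
  rintro x (rfl | rfl | rfl)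
  · right; left; rw [Perm.mul_apply, αa', h1]
  · right; right; rw [Perm.mul_apply, h.αe, h2]
  · left; rw [Perm.mul_apply, h.αt, h3]

/-- The values needed around a cut corner do not conflict. For s = t there is no third dart to
relabel and the value g is not imposed. -/
theorem exists_label {a b e e' t a' s : D} (h1 : a' ≠ e') (h2 : a' ≠ b) (h3 : a' ≠ a)
    (h4 : e ≠ e') (h5 : e ≠ b) (h6 : e ≠ a) (h7 : t ≠ e') (h8 : t ≠ b) (h9 : t ≠ a) (h10 : e' ≠ a)
    (h11 : b ≠ a) (hs : s ≠ t → s ≠ a' ∧ s ≠ e ∧ s ≠ e' ∧ s ≠ b ∧ s ≠ a) (N f g h : ℕ) (k' : D → ℕ) :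
    ∃ k : D → ℕ, k a' = N ∧ k e = N ∧ k t = N ∧ k e' = f ∧ k b = f ∧ k a = h ∧ (s ≠ t → k s = g) ∧
      ∀ x, x ≠ a → x ≠ b → x ≠ e → x ≠ e' → x ≠ t → x ≠ s → x ≠ a' → k x = k' x := by
  refine ⟨fun x => if x = a' ∨ x = e ∨ x = t then N else if x = e' ∨ x = b then f else
    if x = a then h else if x = s then g else k' x, ?_, ?_, ?_, ?_, ?_, ?_, ?_, ?_⟩
  · simp
  · simp
  · simp
  · simp [h1.symm, h4.symm, h7.symm]
  · simp [h2.symm, h5.symm, h8.symm]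
  · simp [h3.symm, h6.symm, h9.symm, h10.symm, h11.symm]
  · intro hst
    obtain ⟨s1, s2, s3, s4, s5⟩ := hs hst
    simp [s1, s2, s3, s4, s5, hst]
  · intro x x1 x2 x3 x4 x5 x6 x7
    simp [x1, x2, x3, x4, x5, x6, x7]

set_option maxHeartbeats 2000000 in
/-- Face labels and the tree decomposition of the dual after cutting off a corner. In the case
`s = t` the vertex `w` is kept by the inverse operation, and otherwise it is smoothed out. -/
theorem Corner.exists_faces [Finite D] {α σ β τ : Perm D} {ℓ : D → W}
    {a b e e' t t' a' b' c c' s s' : D} {kH : D → ℕ}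
    (h : Corner α ℓ a b e e' t t' a' b' c) (hσ : IsRot α ℓ σ)
    (h1 : σ a = e) (h2 : σ e' = t) (h3 : σ t' = a') (hc : α c = c')
    (hβ : ∀ x, β x ≠ x → α x ≠ x ∧ x ≠ a ∧ x ≠ b ∧ x ≠ e ∧ x ≠ e' ∧ (s ≠ t → x ≠ s))
    (hact : ∀ x, α x ≠ x → x ≠ a → x ≠ b → x ≠ e → x ≠ e' → x ≠ t → x ≠ s → β x ≠ x)
    (hgen : ∀ x, α x ≠ x → x ≠ a → x ≠ b → x ≠ e → x ≠ e' → x ≠ t → x ≠ s → x ≠ a' → x ≠ b' →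
      x ≠ t' → (s ≠ t → x ≠ s') → β x = α x)
    (vb' : β b' = a')
    (hτ : ∀ x, α x ≠ x → ℓ x ≠ ℓ a → ℓ x ≠ ℓ e' → τ x = σ x)
    (hm : ∀ x y, β x ≠ x → β y ≠ y →
      ((τ * β).SameCycle x y ↔ (swap e e' * (σ * α)).SameCycle x y))
    (hs : s ≠ t → α s = s' ∧ σ t = s ∧ kH s' = kH a' ∧ s' ≠ a' ∧ s' ≠ t ∧ s' ≠ b ∧ s' ≠ a ∧ s' ≠ s ∧
      s ≠ c ∧ s ≠ t' ∧ s ≠ b' ∧ s ≠ a' ∧ s' ≠ c ∧ s ≠ e' ∧ ℓ s = ℓ e')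
    (hH : IsFaceLabel β τ kH) (hdec : HasDualDecomposition β τ kH) :
    ∃ k N, CutFaces β k kH N a b e e' t t' a' b' c c' ∧ (s ≠ t → k s = kH t') ∧
      IsFaceLabel α σ k ∧ HasDualDecomposition α σ k := by
  classical
  have hd := h.distinct
  simp only [List.nodup_cons, List.mem_cons, List.not_mem_nil, or_false, not_or] at hd
  obtain ⟨inv, ⟨ua1, ua2, ua3, un1, un2, un3, ue1, ue2, uf⟩, ⟨za1, za2, za3, zn1, zn2, zn3, ze1, ze2, zf⟩,
    αa, αb, αe, αt, eqw, n1, n2, n3, n4, n5, n6⟩ := id h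
  have αa' : α a' = a := by rw [← αa, inv]
  have αb' : α b' = b := by rw [← αb, inv]
  have αe' : α e' = e := by rw [← αe, inv]
  have αt' : α t' = t := by rw [← αt, inv]
  have αc' : α c' = c := by rw [← hc, inv]
  have hu := hσ.cases h.u
  have hz := hσ.cases h.z
  have σe : σ e = b := by clear uf zf hβ hact hgen hτ hm hs; grind
  have σb : σ b = a := by clear uf zf hβ hact hgen hτ hm hs; grind
  have σa' : σ a' = c := by clear uf zf hβ hact hgen hτ hm hs; grind
  have σc : σ c = t' := by clear uf zf hβ hact hgen hτ hm hs; grind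
  have sl : s ≠ t → ℓ s = ℓ e' := fun hh => (hs hh).2.2.2.2.2.2.2.2.2.2.2.2.2.2
  have Ba' : β a' ≠ a' := by
    refine hact _ za1 ?_ ?_ ?_ ?_ ?_ ?_ <;> clear uf zf hβ hact hgen hτ hm hs <;> grind
  have Bt' : β t' ≠ t' := by
    refine hact _ za2 ?_ ?_ ?_ ?_ ?_ ?_ <;> clear uf zf hβ hact hgen hτ hm hs <;> grind
  have Bc : β c ≠ c := by
    refine hact _ za3 ?_ ?_ ?_ ?_ ?_ ?_ <;> clear uf zf hβ hact hgen hτ hm hs <;> grind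
  have Ab' : α b' ≠ b' := by rw [αb']; grind
  have Bb' : β b' ≠ b' := by
    refine hact _ Ab' ?_ ?_ ?_ ?_ ?_ ?_ <;> clear uf zf hβ hact hgen hτ hm hs <;> grind
  have Ac' : α c' ≠ c' := by rw [αc', ← hc]; exact za3.symm
  have c's : s ≠ t → c' ≠ s := fun hh hcs => by
    obtain ⟨q1, -, -, -, -, -, -, -, -, -, -, -, q2, -⟩ := hs hh
    rw [← hcs, αc'] at q1
    exact q2 q1.symm
  have c't : c' ≠ t := by clear uf zf hβ hact hgen hτ hm hs; grind
  have Bc' : β c' ≠ c' := by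
    have : c' ≠ s := by by_cases hh : s = t; · rw [hh]; exact c't
                        · exact c's hh
    refine hact _ Ac' ?_ ?_ ?_ ?_ c't this <;> clear uf zf hβ hact hgen hτ hm hs <;> grind
  have τa' : τ a' = c := by rw [hτ _ za1 n1 (Ne.symm n3), σa']
  have τc : τ c = t' := by rw [hτ _ za3 (by rw [ze2]; exact n1) (by rw [ze2]; exact n3.symm), σc]
  have τt' : τ t' = a' := by rw [hτ _ za2 (by rw [ze1]; exact n1) (by rw [ze1]; exact n3.symm), h3]
  -- The cut leaves z with degree three, so in H its three faces share a bag.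
  obtain ⟨N, hN, hext⟩ := hdec.extend Ba' (by rw [τa', τc, τt'])
  have φa : (σ * α) a = c := by rw [Perm.mul_apply, αa, σa']
  have φe' : (σ * α) e' = b := by rw [Perm.mul_apply, αe', σe]
  have φb : (σ * α) b = σ b' := by rw [Perm.mul_apply, αb]
  have φa' : (σ * α) a' = e := by rw [Perm.mul_apply, αa', h1]
  have φe : (σ * α) e = t := by rw [Perm.mul_apply, αe, h2]
  have φb' : (σ * α) b' = a := by rw [Perm.mul_apply, αb', σb]
  have φc' : (σ * α) c' = t' := by rw [Perm.mul_apply, αc', σc]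
  have tri : ∀ x, (σ * α).SameCycle x e → x = a' ∨ x = e ∨ x = t := fun x hx =>
    h.mem_of_sameCycle h1 h2 h3 hx.symm
  have hne : ¬ (σ * α).SameCycle e e' := fun hh => by
    have := tri _ hh.symm
    clear uf zf hβ hact hgen hτ hm hs
    grind
  have face : ∀ x y, β x ≠ x → β y ≠ y → (σ * α).SameCycle x y → kH x = kH y := fun x y hx hy hxy =>
    (hH x y hx hy).2 ((hm x y hx hy).2 ((sameCycle_swap_mul_iff hne).2 (Or.inl hxy)))
  have kb' : kH b' = kH c := face _ _ Bb' Bc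
    ((sameCycle_of_apply_eq φb').trans (sameCycle_of_apply_eq φa))
  have kc' : kH c' = kH t' := face _ _ Bc' Bt' (sameCycle_of_apply_eq φc')
  have lσb' : ℓ (σ b') = ℓ b' := hσ.label Ab'
  have Aσb' : α (σ b') ≠ σ b' := hσ.active Ab'
  have Bσb' : β (σ b') ≠ σ b' := by
    refine hact _ Aσb' ?_ ?_ ?_ ?_ ?_ ?_ <;> clear uf zf hβ hact hgen hτ hm hs <;> grind
  -- The label `kH a'` belongs in H to the fusion of the triangle with the face beyond e. The walk
  -- e', b, `σ b'` runs along the latter, so `σ b'` represents it by a dart alive in H.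
  have kσb' : kH (σ b') = kH a' := by
    rw [hH _ _ Bσb' Ba', hm _ _ Bσb' Ba', sameCycle_swap_mul_iff hne]
    exact Or.inr ⟨Or.inr ((sameCycle_of_apply_eq φe').trans (sameCycle_of_apply_eq φb)).symm,
      Or.inl (sameCycle_of_apply_eq φa')⟩
  obtain ⟨⟨d1, d2, d3, d4, d5, d6, d7, d8⟩, ⟨d9, d10, d11, d12, d13, d14, d15⟩,
    ⟨d16, d17, d18, d19, d20, d21⟩, ⟨d22, d23, d24, d25, d26⟩, ⟨d27, d28, d29, d30⟩, ⟨d31, d32, d33⟩,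
    ⟨d34, d35⟩, d36, -⟩ := hd
  have sne : s ≠ t → s ≠ a' ∧ s ≠ e ∧ s ≠ e' ∧ s ≠ b ∧ s ≠ a := by
    intro hst
    obtain ⟨q1, q2, q3, q4, q5, q6, q7, q8, q9, q10, q11, q12, q14, q15, q13⟩ := hs hst
    refine ⟨q12, ?_, ?_, ?_, ?_⟩
    · rintro rfl; exact n2 (q13.symm.trans ue1)
    · exact q15
    · rintro rfl; exact n2 (q13.symm.trans ue2)
    · rintro rfl; exact n2 q13.symm
  obtain ⟨k, ka', ke, kt, ke', kb, ka, ks, kold⟩ := exists_label (Ne.symm d24) (Ne.symm d13)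
    (Ne.symm d6) d16 (Ne.symm d9) (Ne.symm d2) (Ne.symm d22) (Ne.symm d11) (Ne.symm d4) (Ne.symm d3) (Ne.symm d1) sne
    N (kH a') (kH t') (kH c) kH
  have old : ∀ x, β x ≠ x → x ≠ a' → x ≠ t → k x = kH x := by
    intro x hx1 hx2 hx3
    obtain ⟨-, x1, x2, x3, x4, x5⟩ := hβ x hx1
    exact kold x x1 x2 x3 x4 hx3 (if hst : s = t then hst ▸ hx3 else x5 hst) hx2
  have cf : CutFaces β k kH N a b e e' t t' a' b' c c' :=
    ⟨hN, old, ka', ke, kt, ke', kb, ka, kb', kc'⟩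
  have hlab : IsFaceLabel α σ k := by
    refine isFaceLabel_of_representatives hH hm hne hN ?_
    intro x hx
    have rep : ∀ y, β y ≠ y → y ≠ a' → y ≠ t → ¬ (σ * α).SameCycle y e := by
      intro y hy1 hy2 hy3 hy4
      rcases tri y hy4 with hy | hy | hy
      · exact hy2 hy
      · exact (hβ y hy1).2.2.2.1 hy
      · exact hy3 hy
    by_cases x1 : x = a'
    · left; rw [x1]; exact ⟨cf.k_a', sameCycle_of_apply_eq φa'⟩
    by_cases x2 : x = e
    · left; rw [x2]; exact ⟨cf.k_e, SameCycle.refl _ _⟩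
    by_cases x3 : x = t
    · left; rw [x3]; exact ⟨cf.k_t, (sameCycle_of_apply_eq φe).symm⟩
    right
    have rσ : ¬ (σ * α).SameCycle (σ b') e := by
      refine rep _ Bσb' (fun hh => ?_) fun hh => ?_
      · exact n5 (by rw [← lσb', hh])
      · exact n6 (by rw [← lσb', hh, eqw])
    by_cases x4 : x = e'
    · rw [x4]
      exact ⟨σ b', Bσb', (sameCycle_of_apply_eq φe').trans (sameCycle_of_apply_eq φb),
        cf.k_e'.trans kσb'.symm, rσ⟩
    by_cases x5 : x = b
    · rw [x5]
      exact ⟨σ b', Bσb', sameCycle_of_apply_eq φb, cf.k_b.trans kσb'.symm, rσ⟩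
    by_cases x6 : x = a
    · rw [x6]
      exact ⟨c, Bc, sameCycle_of_apply_eq φa, cf.k_a, rep _ Bc (Ne.symm d35) (Ne.symm d30)⟩
    by_cases x7 : x = s
    · have hst : s ≠ t := by rw [← x7]; exact x3
      have φt' : (σ * α) t' = s := by rw [Perm.mul_apply, αt', (hs hst).2.1]
      rw [x7]
      exact ⟨t', Bt', (sameCycle_of_apply_eq φt').symm, ks hst, rep _ Bt' d31 (Ne.symm d27)⟩
    · have hx' := hact x hx x6 x5 x2 x4 x3 x7
      exact ⟨x, hx', SameCycle.refl _ _, old x hx' x1 x3, rep x hx' x1 x3⟩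
  have kc : k c = kH c := old _ Bc (Ne.symm d35) (Ne.symm d30)
  have kt' : k t' = kH t' := old _ Bt' d31 (Ne.symm d27)
  have kb'' : k b' = kH c := (old _ Bb' (Ne.symm d34) (Ne.symm d29)).trans kb'
  refine ⟨k, N, cf, ks, hlab, hext α σ k ?_ ?_ ?_⟩
  · rw [τa', τc]
    set S : Finset ℕ := {N, kH a', kH c, kH t'} with hS
    have mN : N ∈ S := by simp [hS]
    have mf : kH a' ∈ S := by simp [hS]
    have mh : kH c ∈ S := by simp [hS]
    have mg : kH t' ∈ S := by simp [hS]
    clear_value S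
    intro d hd'
    -- Every edge touched by the cut has both sides among N and the three faces around z; all others
    -- keep their labels from H.
    have main : ∀ d, (d = a ∨ d = e ∨ d = t ∨ d = b ∨ (s ≠ t ∧ d = s)) → k d ∈ S ∧ k (α d) ∈ S := by
      rintro d (rfl | rfl | rfl | rfl | ⟨hst, rfl⟩)
      · rw [αa, cf.k_a, cf.k_a']; exact ⟨mh, mN⟩
      · rw [αe, cf.k_e, cf.k_e']; exact ⟨mN, mf⟩
      · rw [αt, cf.k_t, kt']; exact ⟨mN, mg⟩
      · rw [αb, cf.k_b, kb'']; exact ⟨mf, mh⟩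
      · obtain ⟨q1, q2, q3, q4, q5, q6, q7, q8, q9, q10, q11, q12, q14, q15, q13⟩ := hs hst
        have As' : α s' ≠ s' := by rw [← q1, inv]; rw [q1]; exact q8.symm
        have αs' : α s' = d := by rw [← q1, inv]
        have Bs' : β s' ≠ s' := by
          refine hact _ As' q7 q6 (fun hh => ?_) (fun hh => ?_) q5 q8
          · exact q15 (by rw [← αs', hh, αe])
          · exact (sne hst).2.1 (by rw [← αs', hh, αe'])
        rw [q1, ks hst, old _ Bs' q4 q5, q3]; exact ⟨mg, mf⟩
    by_cases c1 : d = a ∨ d = e ∨ d = t ∨ d = b ∨ (s ≠ t ∧ d = s)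
    · exact Or.inl (main d c1)
    by_cases c2 : α d = a ∨ α d = e ∨ α d = t ∨ α d = b ∨ (s ≠ t ∧ α d = s)
    · have := main _ c2
      rw [inv] at this
      exact Or.inl this.symm
    right
    have y1 : d ≠ a := fun hh => c1 (Or.inl hh)
    have y2 : d ≠ b := fun hh => c1 (Or.inr (Or.inr (Or.inr (Or.inl hh))))
    have y3 : d ≠ e := fun hh => c1 (Or.inr (Or.inl hh))
    have y4 : d ≠ e' := fun hh => c2 (Or.inr (Or.inl (by rw [hh, αe'])))
    have y5 : d ≠ t := fun hh => c1 (Or.inr (Or.inr (Or.inl hh)))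
    have y6 : d ≠ s := fun hh => by
      by_cases hst : s = t
      · exact y5 (hh.trans hst)
      · exact c1 (Or.inr (Or.inr (Or.inr (Or.inr ⟨hst, hh⟩))))
    have y7 : d ≠ a' := fun hh => c2 (Or.inl (by rw [hh, αa']))
    have y8 : d ≠ b' := fun hh => c2 (Or.inr (Or.inr (Or.inr (Or.inl (by rw [hh, αb'])))))
    have y9 : d ≠ t' := fun hh => c2 (Or.inr (Or.inr (Or.inl (by rw [hh, αt']))))
    have y10 : s ≠ t → d ≠ s' := fun hst hh =>
      c2 (Or.inr (Or.inr (Or.inr (Or.inr ⟨hst, by rw [hh, ← (hs hst).1, inv]⟩))))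
    have Bd := hact d hd' y1 y2 y3 y4 y5 y6
    have hv := hgen d hd' y1 y2 y3 y4 y5 y6 y7 y8 y9 y10
    refine ⟨d, Bd, old d Bd y7 y5, ?_⟩
    rw [hv]
    have flip : ∀ {x y}, α x = y → α d = x → d = y := fun h1 h2 => by rw [← h1, ← h2, inv]
    refine old _ (hact _ (by rw [inv]; exact hd'.symm) ?_ ?_ ?_ ?_ ?_ ?_) ?_ ?_
    · exact fun hh => y7 (flip αa hh)
    · exact fun hh => y8 (flip αb hh)
    · exact fun hh => y4 (flip αe hh)
    · exact fun hh => y3 (flip αe' hh)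
    · exact fun hh => y9 (flip αt hh)
    · intro hh
      by_cases hst : s = t
      · exact y9 (flip αt (hh.trans hst))
      · exact y10 hst (flip (hs hst).1 hh)
    · exact fun hh => y1 (flip αa' hh)
    · exact fun hh => y9 (flip αt hh)
  · rw [τa', τc]
    set S : Finset ℕ := {N, kH a', kH c, kH t'} with hS
    have mN : N ∈ S := by simp [hS]
    have mf : kH a' ∈ S := by simp [hS]
    have mh : kH c ∈ S := by simp [hS]
    have mg : kH t' ∈ S := by simp [hS]
    clear_value S
    intro d hd' hd3
    by_cases lz : ℓ d = ℓ a'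
    · left
      rcases zf d hd' lz with rfl | rfl | rfl
      · rw [σa', σc, kc, kt', ka']; exact ⟨mN, mh, mg⟩
      · rw [h3, σa', kc, kt', ka']; exact ⟨mg, mN, mh⟩
      · rw [σc, h3, kc, kt', ka']; exact ⟨mh, mg, mN⟩
    by_cases lu : ℓ d = ℓ a
    · left
      rcases uf d hd' lu with rfl | rfl | rfl
      · rw [h1, σe, ka, ke, kb]; exact ⟨mh, mN, mf⟩
      · rw [σe, σb, ka, ke, kb]; exact ⟨mN, mf, mh⟩
      · rw [σb, h1, ka, ke, kb]; exact ⟨mf, mh, mN⟩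
    by_cases lw : ℓ d = ℓ e'
    · left
      have Ae' : α e' ≠ e' := by rw [αe']; exact d16
      have At : α t ≠ t := by rw [αt]; exact Ne.symm d27
      -- The degree of w is not assumed. If the orbit of d has period three and d leaves w, it
      -- contains e', and the faces there are `kH a'`, N and `kH t'`, all in the new bag.
      have hmem : e' = d ∨ e' = σ d ∨ e' = σ (σ d) := by
        refine D3.mem_of_sameCycle (S := {x | x = d ∨ x = σ d ∨ x = σ (σ d)}) ?_
          ((hσ.vert d e' hd' Ae').1 lw) (Or.inl rfl)
        rintro x (rfl | rfl | rfl)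
        · exact Or.inr (Or.inl rfl)
        · exact Or.inr (Or.inr rfl)
        · exact Or.inl hd3
      have kσt : k (σ t) = kH t' := by
        rw [← kt', hlab _ _ (hσ.active At) za2]
        exact (sameCycle_of_apply_eq (by rw [Perm.mul_apply, αt'])).symm
      rcases hmem with hh | hh | hh
      · rw [← hh, h2, kσt, ke', kt]; exact ⟨mf, mN, mg⟩
      · have : d = σ t := by rw [← h2, hh, hd3]
        rw [← hh, h2, ke', kt, this, kσt]; exact ⟨mg, mf, mN⟩
      · have : d = t := by rw [← h2, hh, hd3]
        rw [← hh, ke', this, kσt, kt]; exact ⟨mN, mg, mf⟩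
    · right
      have gen : ∀ x, α x ≠ x → ℓ x = ℓ d → β x ≠ x ∧ k x = kH x ∧ τ x = σ x := by
        intro x hx hl
        rw [← hl] at lz lu lw
        have x1 : x ≠ t := fun hh => lw (by rw [hh, eqw])
        have Bx : β x ≠ x := by
          refine hact x hx ?_ ?_ ?_ ?_ x1 ?_
          · exact fun hh => lu (by rw [hh])
          · exact fun hh => lu (by rw [hh, ue2])
          · exact fun hh => lu (by rw [hh, ue1])
          · exact fun hh => lw (by rw [hh])
          · intro hh
            by_cases hst : s = t
            · exact x1 (hh.trans hst)
            · exact lw (by rw [hh, sl hst])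
        exact ⟨Bx, old x Bx (fun hh => lz (by rw [hh])) x1, hτ x hx lu lw⟩
      obtain ⟨g1, g2, g3⟩ := gen d hd' rfl
      obtain ⟨-, g4, g5⟩ := gen (σ d) (hσ.active hd') (hσ.label hd')
      obtain ⟨-, g6, g7⟩ := gen (σ (σ d)) (hσ.active (hσ.active hd'))
        ((hσ.label (hσ.active hd')).trans (hσ.label hd'))
      refine ⟨d, g1, ?_, g2, ?_, ?_⟩
      · rw [g3, g5, g7, hd3]
      · rw [g3, g4]
      · rw [g3, g5, g6]
  · intro d hd'
    by_cases y1 : d = a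
    · exact Or.inr ⟨c, Bc, by rw [y1, ka]⟩
    by_cases y2 : d = b
    · exact Or.inr ⟨a', Ba', by rw [y2, kb]⟩
    by_cases y3 : d = e
    · exact Or.inl (by rw [y3, ke])
    by_cases y4 : d = e'
    · exact Or.inr ⟨a', Ba', by rw [y4, ke']⟩
    by_cases y5 : d = t
    · exact Or.inl (by rw [y5, kt])
    by_cases y6 : d = s
    · exact Or.inr ⟨t', Bt', by rw [y6, ks (y6 ▸ y5)]⟩
    by_cases y7 : d = a'
    · exact Or.inl (by rw [y7, ka'])
    have Bd := hact d hd' y1 y2 y3 y4 y5 y6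
    exact Or.inr ⟨d, Bd, old d Bd y7 y5⟩

end Decomposition

/-! ### The inductive invariant and the inverse of a D3b reduction -/

section Steps

variable {D W : Type*}

/-- All embeddings satisfy the genus inequality, a planar embedding exists, and all planar
embeddings are tight with a dual of treewidth at most three. -/
structure Good (α : Perm D) (ℓ : D → W) : Prop where
  le : ∀ σ, IsRot α ℓ σ → euler α σ ≤ 2
  planar : ∀ σ, IsRot α ℓ σ → euler α σ = 2 →
    ∃ κ, IsFaceLabel α σ κ ∧ Tight α ℓ κ ∧ HasDualDecomposition α σ κ
  exist : ∃ σ, IsRot α ℓ σ ∧ euler α σ = 2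

theorem IsRot.congr {W' : Type*} {α σ : Perm D} {ℓ : D → W} {ℓ' : D → W'}
    (hl : ∀ x y, α x ≠ x → α y ≠ y → (ℓ x = ℓ y ↔ ℓ' x = ℓ' y)) (h : IsRot α ℓ σ) : IsRot α ℓ' σ where
  fix := h.fix
  vert x y hx hy := by rw [← hl x y hx hy, h.vert x y hx hy]

/-- Labels matter only through the partition of the live darts into vertices, so reductions may
rename vertices freely. -/
theorem Good.congr {W' : Type*} {α : Perm D} {ℓ : D → W} {ℓ' : D → W'} (hα : ∀ x, α (α x) = x)
    (hl : ∀ x y, α x ≠ x → α y ≠ y → (ℓ x = ℓ y ↔ ℓ' x = ℓ' y)) (h : Good α ℓ) : Good α ℓ' where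
  le σ hσ := h.le σ (hσ.congr fun x y hx hy => (hl x y hx hy).symm)
  planar σ hσ h2 := by
    obtain ⟨κ, h3, h4, h5⟩ := h.planar σ (hσ.congr fun x y hx hy => (hl x y hx hy).symm) h2
    refine ⟨κ, h3, ⟨fun x y hx hy hxy => h4.inj x y hx hy ((hl x y hx hy).2 hxy), ?_⟩, h5⟩
    intro d x y hd hx hy e1 e2 e3
    rw [← hl x d hx hd, ← hl x (α d) hx (by rw [hα]; exact hd.symm)]
    exact h4.edge d x y hd hx hy e1 e2 ((hl x y hx hy).2 e3)
  exist := by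
    obtain ⟨σ, h1, h2⟩ := h.exist
    exact ⟨σ, h1.congr hl, h2⟩

theorem DegThree.sameCycle_iff [Finite D] {α σ : Perm D} {ℓ : D → W} {p q r : D}
    (h : DegThree α ℓ p q r) (h1 : σ p = q) (h2 : σ q = r) (h3 : σ r = p) {x y : D} (hy : α y ≠ y)
    (hx : x = p ∨ x = q ∨ x = r) : ℓ x = ℓ y ↔ σ.SameCycle x y := by
  have hpq := sameCycle_of_apply_eq h1
  have hpr := (sameCycle_of_apply_eq h3).symm
  have hl : ℓ x = ℓ p := by
    rcases hx with rfl | rfl | rfl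
    · rfl
    · exact h.eq_ab
    · exact h.eq_ac
  have hx' : σ.SameCycle p x := by
    rcases hx with rfl | rfl | rfl
    · exact SameCycle.refl _ _
    · exact hpq
    · exact hpr
  constructor
  · intro hh
    refine hx'.symm.trans ?_
    rcases h.fiber y hy (hh.symm.trans hl) with rfl | rfl | rfl
    · exact SameCycle.refl _ _
    · exact hpq
    · exact hpr
  · intro hh
    have : y = p ∨ y = q ∨ y = r := by
      refine D3.mem_of_sameCycle (S := {y | y = p ∨ y = q ∨ y = r}) ?_ hh hx
      rintro z (rfl | rfl | rfl)
      · exact Or.inr (Or.inl h1)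
      · exact Or.inr (Or.inr h2)
      · exact Or.inl h3
    rw [hl]
    rcases this with rfl | rfl | rfl
    · rfl
    · exact h.eq_ab.symm
    · exact h.eq_ac.symm

/-- Vertices that survive the cut are controlled by τ through representatives; the new ones, listed
explicitly as cycles, are handled by the second alternative. -/
theorem isRot_of_representatives {α β σ τ : Perm D} {ℓ : D → W} (hτ : IsRot β ℓ τ)
    (hfix : ∀ x, α x = x → σ x = x)
    (hs : ∀ x y, β x ≠ x → β y ≠ y → (σ.SameCycle x y ↔ τ.SameCycle x y))
    (hrep : ∀ x, α x ≠ x → (∃ y, β y ≠ y ∧ ℓ y = ℓ x ∧ σ.SameCycle x y) ∨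
      ∀ y, α y ≠ y → (ℓ x = ℓ y ↔ σ.SameCycle x y)) : IsRot α ℓ σ where
  fix := hfix
  vert x y hx hy := by
    rcases hrep x hx with ⟨x', hx1, hx2, hx3⟩ | h
    · rcases hrep y hy with ⟨y', hy1, hy2, hy3⟩ | h
      · rw [← hx2, ← hy2, hτ.vert _ _ hx1 hy1, ← hs _ _ hx1 hy1]
        exact ⟨fun hh => hx3.trans (hh.trans hy3.symm), fun hh => hx3.symm.trans (hh.trans hy3)⟩
      · rw [eq_comm, h x hx, sameCycle_comm]
    · exact h y hy

variable [DecidableEq D] [Finite D]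
variable {α σ : Perm D} {ℓ : D → W} {a b e e' t t' a' b' c : D}

namespace Corner

omit [Finite D] in
theorem cutσ_apply (h : Corner α ℓ a b e e' t t' a' b' c) (hσ : IsRot α ℓ σ) {x : D} (hx : α x ≠ x)
    (h1 : ℓ x ≠ ℓ a) (h2 : ℓ x ≠ ℓ e') : cutσ a e e' σ x = σ x := by
  have hl := hσ.label hx
  have i1 : ∀ y, ℓ y = ℓ a ∨ ℓ y = ℓ e' → x ≠ y ∧ σ x ≠ y := fun y hy =>
    ⟨fun hh => by rw [hh] at h1 h2; tauto, fun hh => by rw [← hh, hl] at hy; tauto⟩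
  have i2 := i1 a (Or.inl rfl)
  have i3 := i1 e (Or.inl h.u.eq_ab)
  have i4 := i1 e' (Or.inr rfl)
  simp only [cutσ, del_apply]
  simp [i2, i3, i4]

omit [Finite D] in
theorem active_cut (h : Corner α ℓ a b e e' t t' a' b' c) : cutα a b e e' α a' ≠ a' ∧
    cutα a b e e' α t' ≠ t' ∧ cutα a b e e' α t ≠ t ∧ cutα a b e e' α c ≠ c ∧ cutα a b e e' α b' ≠ b' := by
  have hd := h.distinct
  simp only [List.nodup_cons, List.mem_cons, List.not_mem_nil, or_false, not_or] at hd
  have inv := h.inv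
  have αb := h.αb
  have αt := h.αt
  have := h.z.act_a; have := h.z.act_b; have := h.z.act_c; have := h.u.act_c
  simp only [h.active_iff]
  grind

omit [Finite D] in
theorem cut_values (h : Corner α ℓ a b e e' t t' a' b' c) : cutα a b e e' α a' = b' ∧
    cutα a b e e' α b' = a' ∧ cutα a b e e' α t = t' ∧ cutα a b e e' α t' = t := by
  have hd := h.distinct
  simp only [List.nodup_cons, List.mem_cons, List.not_mem_nil, or_false, not_or] at hd
  have αt := h.αt
  have αt' : α t' = t := by rw [← αt, h.inv]
  simp only [h.cutα_apply]
  grind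

omit [Finite D] in
-- The same edge e can be viewed as cutting the corner across a or the one across b; deletion and
-- smoothing do not depend on this choice.
theorem cutα_swap (h : Corner α ℓ a b e e' t t' a' b' c) {t2 t2' c2 : D}
    (h2 : Corner α ℓ b a e e' t2 t2' b' a' c2) : cutα b a e e' α = cutα a b e e' α := by
  ext x
  have hd := h.distinct
  simp only [List.nodup_cons, List.mem_cons, List.not_mem_nil, or_false, not_or] at hd
  rw [h.cutα_apply, h2.cutα_apply]
  grind

theorem sameCycle_of_sameCycle (h : Corner α ℓ a b e e' t t' a' b' c) (hσ : IsRot α ℓ σ)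
    (hne : ¬ (σ * α).SameCycle e e') {x y : D}
    (hx : cutα a b e e' α x ≠ x) (hy : cutα a b e e' α y ≠ y) (hxy : (σ * α).SameCycle x y) :
    (cutσ a e e' σ * cutα a b e e' α).SameCycle x y :=
  (h.sameCycle_cut hσ hx hy).2 ((sameCycle_swap_mul_iff hne).2 (Or.inl hxy))

/-- In a planar embedding, the edge `e` cuts off the corner. -/
theorem coherent (h : Corner α ℓ a b e e' t t' a' b' c) (hσ : IsRot α ℓ σ)
    (hne : ¬ (σ * α).SameCycle e e') {kH : D → ℕ}
    (hH : IsFaceLabel (cutα a b e e' α) (cutσ a e e' σ) kH) (T : Tight (cutα a b e e' α) ℓ kH)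
    (h1 : σ a = e) : σ e' = t ∧ σ t' = a' := by
  have hd := h.distinct
  simp only [List.nodup_cons, List.mem_cons, List.not_mem_nil, or_false, not_or] at hd
  obtain ⟨Ba', Bt', Bt, Bc, Bb'⟩ := h.active_cut
  obtain ⟨va', vb', vt, vt'⟩ := h.cut_values
  have hτ := h.isRot hσ
  have αa' : α a' = a := by rw [← h.αa, h.inv]
  have αb' : α b' = b := by rw [← h.αb, h.inv]
  have Ae' : α e' ≠ e' := by rw [← h.αe, h.inv]; exact h.u.act_b.symm
  have At := (h.active_iff.1 Bt).1
  have lm := hσ.label Ae'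
  have Am := hσ.active Ae'
  have Bm : cutα a b e e' α (σ e') ≠ σ e' := by
    refine h.active_iff.2 ⟨Am, ?_, ?_, ?_, ?_⟩
    · intro hh; rw [hh] at lm; exact h.ne_uw lm.symm
    · intro hh; rw [hh, h.u.eq_ac] at lm; exact h.ne_uw lm.symm
    · intro hh; rw [hh, h.u.eq_ab] at lm; exact h.ne_uw lm.symm
    · intro hh
      exact hd.2.2.2.1.1 (((hσ.vert e' t Ae' At).1 h.eq_w.symm).eq_of_left hh)
  have k1 : kH a' = kH (σ e') := by
    refine (hH _ _ Ba' Bm).2 (h.sameCycle_of_sameCycle hσ hne Ba' Bm ?_)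
    exact (sameCycle_of_apply_eq (y := e) (by rw [Perm.mul_apply, αa', h1])).trans
      (sameCycle_of_apply_eq (by rw [Perm.mul_apply, h.αe]))
  have face : ∀ x y, cutα a b e e' α x ≠ x → cutα a b e e' α y ≠ y →
      (cutσ a e e' σ) (cutα a b e e' α x) = y → kH x = kH y := fun x y hx hy hxy =>
    (hH x y hx hy).2 (sameCycle_of_apply_eq hxy)
  have τa' := h.cutσ_apply hσ h.z.act_a h.ne_uz h.ne_zw.symm
  have τt' := h.cutσ_apply hσ h.z.act_b (by rw [h.z.eq_ab]; exact h.ne_uz)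
    (by rw [h.z.eq_ab]; exact h.ne_zw.symm)
  rcases hσ.cases h.z with ⟨z1, z2, z3⟩ | ⟨z1, z2, z3⟩
  -- With the opposite rotation at z, both sides of the edge of a' in the cut map would pass through
  -- w, which is not an end of it.
  · exfalso
    have k2 := face b' t' Bb' Bt' (by rw [vb', τa', z1])
    have k3 := face t' _ Bt' (hτ.active Bt) (by rw [vt'])
    have ln := hτ.label Bt
    have := T.edge a' _ _ Ba' Bm (hτ.active Bt) k1 (by rw [va', k2, k3]) (by rw [lm, ln, h.eq_w])
    rw [va', lm] at this
    exact this.elim h.ne_zw h.ne_wb.symm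
  -- Now `σ e'` and t leave w on the same face of the cut map, and a tight map visits w only once
  -- per face.
  · refine ⟨T.inj _ _ Bm Bt (lm.trans h.eq_w.symm) ?_, z3⟩
    rw [← k1]
    exact (face t a' Bt Ba' (by rw [vt, τt', z3])).symm

theorem planar_of_coherent (h : Corner α ℓ a b e e' t t' a' b' c) (hσ : IsRot α ℓ σ)
    {kH : D → ℕ} (hH : IsFaceLabel (cutα a b e e' α) (cutσ a e e' σ) kH)
    (T : Tight (cutα a b e e' α) ℓ kH)
    (hdec : HasDualDecomposition (cutα a b e e' α) (cutσ a e e' σ) kH)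
    (h1 : σ a = e) (h2 : σ e' = t) (h3 : σ t' = a') :
    ∃ κ, IsFaceLabel α σ κ ∧ Tight α ℓ κ ∧ HasDualDecomposition α σ κ := by
  have hd := h.distinct
  simp only [List.nodup_cons, List.mem_cons, List.not_mem_nil, or_false, not_or] at hd
  obtain ⟨Ba', Bt', Bt, Bc, Bb'⟩ := h.active_cut
  obtain ⟨va', vb', vt, vt'⟩ := h.cut_values
  have τt' := h.cutσ_apply hσ h.z.act_b (by rw [h.z.eq_ab]; exact h.ne_uz)
    (by rw [h.z.eq_ab]; exact h.ne_zw.symm)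
  have htf : kH t = kH a' := (hH _ _ Bt Ba').2
    (sameCycle_of_apply_eq (by rw [Perm.mul_apply, vt, τt', h3]))
  -- Taking s = t selects the variant in which w is kept.
  obtain ⟨k, N, cf, -, f1, f2⟩ := h.exists_faces (c' := α c) (s := t) (s' := t') hσ h1 h2 h3 rfl
    (fun x hx => by
      obtain ⟨x1, x2, x3, x4, x5⟩ := h.active_iff.1 hx
      exact ⟨x1, x2, x3, x4, x5, fun hh => absurd rfl hh⟩)
    (fun x x1 x2 x3 x4 x5 _ _ => h.active_iff.2 ⟨x1, x2, x3, x4, x5⟩)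
    (fun x _ x2 x3 x4 x5 _ _ x8 x9 _ _ => by
      rw [h.cutα_apply, if_neg (by tauto), if_neg x8, if_neg x9])
    vb' (fun x hx l1 l2 => h.cutσ_apply hσ hx l1 l2)
    (fun x y hx hy => h.sameCycle_cut hσ hx hy) (fun hh => absurd rfl hh) hH hdec
  have inv := h.inv
  have flip : ∀ x y, α x = y → α c = x → c = y := fun x y h1 h2 => by rw [← h1, ← h2, inv]
  have αe' : α e' = e := by rw [← h.αe, inv]
  have lc : ℓ (α c) ≠ ℓ a := by
    intro hh
    rcases h.u.fiber (α c) (by rw [inv]; exact h.z.act_c.symm) hh with hc | hc | hc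
    · exact hd.2.2.2.2.2.2.1.2 (flip _ _ h.αa hc).symm
    · exact hd.2.2.2.1.2.2.2.2 (flip _ _ h.αe hc).symm
    · exact hd.2.2.2.2.2.2.2.1 (flip _ _ h.αb hc).symm
  exact ⟨k, f1, h.tight T cf rfl (fun hh => h.z.ne_bc (flip _ _ h.αt hh).symm)
    (fun hh => hd.2.2.1.2.2.2.2.2 (flip _ _ αe' hh).symm) lc htf, f2⟩

/-- Insert an edge cutting off a corner into an embedding. -/
theorem exists_rotation (h : Corner α ℓ a b e e' t t' a' b' c) {τ : Perm D}
    (hτ : IsRot (cutα a b e e' α) ℓ τ) (h3 : τ t' = a') :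
    ∃ σ, IsRot α ℓ σ ∧ euler α σ = euler (cutα a b e e' α) τ := by
  have hd := h.distinct
  simp only [List.nodup_cons, List.mem_cons, List.not_mem_nil, or_false, not_or] at hd
  have fix : ∀ x, α x = x ∨ x = a ∨ x = b ∨ x = e ∨ x = e' → τ x = x := fun x hx => hτ.fix x (by
    by_contra hh
    have := h.active_iff.1 hh
    tauto)
  have Ta := fix a (by tauto)
  have Tb := fix b (by tauto)
  have Te := fix e (by tauto)
  have Te' := fix e' (by tauto)
  have i1 : ∀ x y, τ x = τ y → x = y := fun x y hh => τ.injective hh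
  obtain ⟨σ, hσ⟩ : ∃ σ : Perm D, ∀ x, σ x = if x = a then e else if x = e then b else
      if x = b then a else if x = e' then t else if τ x = t then e' else τ x := by
    -- Since τ fixes a, b, e and e', the factors restore the cycle a, e, b and insert e' directly
    -- before t.
    refine ⟨swap a e * swap e b * swap e' t * τ, fun x => ?_⟩
    simp only [Perm.mul_apply, swap_apply_def]
    have := i1 x a; have := i1 x b; have := i1 x e; have := i1 x e'
    clear i1 fix
    grind
  have σa : σ a = e := by rw [hσ, if_pos rfl]
  have σe' : σ e' = t := by rw [hσ]; clear i1 fix; grind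
  have σt' : σ t' = a' := by rw [hσ]; clear i1 fix; grind
  have σe : σ e = b := by rw [hσ]; clear i1 fix; grind
  have σb : σ b = a := by rw [hσ]; clear i1 fix; grind
  have hcut : cutσ a e e' σ = τ := by
    ext x
    simp only [cutσ, del_apply]
    have := i1 x a; have := i1 x b; have := i1 x e; have := i1 x e'
    have := hσ x
    clear i1 fix hσ
    grind
  obtain ⟨Ba', Bt', Bt, Bc, Bb'⟩ := h.active_cut
  have Ae' : α e' ≠ e' := by rw [← h.αe, h.inv]; exact h.u.act_b.symm
  have hrot : IsRot α ℓ σ := by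
    refine isRot_of_representatives hτ ?_ ?_ ?_
    · intro x hx
      have := fix x (Or.inl hx)
      have := h.u.act_a; have := h.u.act_b; have := h.u.act_c; have := (h.active_iff.1 Bt).1
      rw [hσ]
      clear i1 fix hσ
      grind
    · intro x y hx hy
      rw [h.active_iff] at hx hy
      rw [← hcut, cutσ, sameCycle_del hx.2.1 hy.2.1, sameCycle_del hx.2.2.2.1 hy.2.2.2.1,
        sameCycle_del hx.2.2.2.2 hy.2.2.2.2]
    · intro x hx
      by_cases hxu : x = a ∨ x = e ∨ x = b
      · exact Or.inr fun y hy => h.u.sameCycle_iff σa σe σb hy hxu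
      left
      by_cases hx2 : x = e'
      · rw [hx2]
        exact ⟨t, Bt, h.eq_w, sameCycle_of_apply_eq σe'⟩
      · exact ⟨x, h.active_iff.2 ⟨hx, by tauto, by tauto, by tauto, hx2⟩, rfl, SameCycle.refl _ _⟩
  refine ⟨σ, hrot, ?_⟩
  rw [← hcut]
  -- The face of e is the triangle a', e, t, which does not contain e'.
  refine ((h.euler_cut hrot).1 fun hh => ?_).symm
  have := h.mem_of_sameCycle σa σe' σt' hh
  clear i1 fix hσ
  grind

/-- The inverse of a D3b reduction. -/
theorem good (h : Corner α ℓ a b e e' t t' a' b' c) {t2 t2' c2 : D}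
    (h2 : Corner α ℓ b a e e' t2 t2' b' a' c2) (hG : Good (cutα a b e e' α) ℓ) : Good α ℓ := by
  have hG2 : Good (cutα b a e e' α) ℓ := by rw [h.cutα_swap h2]; exact hG
  refine ⟨fun σ hσ => ?_, fun σ hσ hE => ?_, ?_⟩
  · have e1 := h.euler_cut hσ
    have e2 := hG.le _ (h.isRot hσ)
    by_cases hs : (σ * α).SameCycle e e'
    · have := e1.2 hs
      omega
    · have := e1.1 hs
      omega
  -- Equal faces on both sides of e would give the cut map Euler number 4.
  · have hne : ¬ (σ * α).SameCycle e e' := fun hs => by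
      have e1 := (h.euler_cut hσ).2 hs
      have e2 := hG.le _ (h.isRot hσ)
      omega
    have hu := hσ.cases h.u
    -- At u, the dart e follows a or b, and this decides which of the two corners it cuts off.
    rcases hu with ⟨h1, -⟩ | ⟨-, h1, -⟩
    · obtain ⟨kH, k1, k2, k3⟩ := hG.planar _ (h.isRot hσ) (((h.euler_cut hσ).1 hne).trans hE)
      obtain ⟨c2, c3⟩ := h.coherent hσ hne k1 k2 h1
      exact h.planar_of_coherent hσ k1 k2 k3 h1 c2 c3
    · obtain ⟨kH, k1, k2, k3⟩ := hG2.planar _ (h2.isRot hσ) (((h2.euler_cut hσ).1 hne).trans hE)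
      obtain ⟨c2, c3⟩ := h2.coherent hσ hne k1 k2 h1
      exact h2.planar_of_coherent hσ k1 k2 k3 h1 c2 c3
  · obtain ⟨τ, hτ, hE⟩ := hG.exist
    obtain ⟨kH, k1, T, -⟩ := hG.planar τ hτ hE
    obtain ⟨Ba', Bt', Bt, Bc, Bb'⟩ := h.active_cut
    obtain ⟨va', vb', vt, vt'⟩ := h.cut_values
    obtain ⟨-, Bt2', Bt2, -, -⟩ := h2.active_cut
    obtain ⟨-, -, vt2, vt2'⟩ := h2.cut_values
    rw [h.cutα_swap h2] at Bt2' Bt2 vt2 vt2'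
    by_cases o1 : τ t' = a'
    · obtain ⟨σ, s1, s2⟩ := h.exists_rotation hτ o1
      exact ⟨σ, s1, s2.trans hE⟩
    by_cases o2 : τ t2' = b'
    · obtain ⟨σ, s1, s2⟩ := h2.exists_rotation (by rw [h.cutα_swap h2]; exact hτ) o2
      rw [h.cutα_swap h2] at s2
      exact ⟨σ, s1, s2.trans hE⟩
    -- If e fitted into neither corner, w would lie on both sides of the edge joining the vertices
    -- of a' and b', against tightness.
    exfalso
    have deg : ∀ {p q r : D}, DegThree α ℓ p q r → cutα a b e e' α p ≠ p → cutα a b e e' α q ≠ q →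
        cutα a b e e' α r ≠ r → DegThree (cutα a b e e' α) ℓ p q r := fun hh a1 a2 a3 =>
      ⟨a1, a2, a3, hh.ne_ab, hh.ne_ac, hh.ne_bc, hh.eq_ab, hh.eq_ac,
        fun x hx => hh.fiber x (h.active_iff.1 hx).1⟩
    have Bc2 := h2.active_cut.2.2.2.1
    rw [h.cutα_swap h2] at Bc2
    have z1 : τ a' = t' := by
      rcases hτ.cases (deg h.z Ba' Bt' Bc) with hh | hh
      · exact hh.1
      · exact absurd hh.2.2 o1
    have z2 : τ b' = t2' := by
      rcases hτ.cases (deg h2.z Bb' Bt2' Bc2) with hh | hh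
      · exact hh.1
      · exact absurd hh.2.2 o2
    have face : ∀ x y, cutα a b e e' α x ≠ x → cutα a b e e' α y ≠ y →
        τ (cutα a b e e' α x) = y → kH x = kH y := fun x y hx hy hxy =>
      (k1 x y hx hy).2 (sameCycle_of_apply_eq hxy)
    have f1 := face b' t' Bb' Bt' (by rw [vb', z1])
    have f2 := face t' _ Bt' (hτ.active Bt) (by rw [vt'])
    have f3 := face a' t2' Ba' Bt2' (by rw [va', z2])
    have f4 := face t2' _ Bt2' (hτ.active Bt2) (by rw [vt2'])
    have l1 := hτ.label Bt
    have l2 := hτ.label Bt2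
    have := T.edge a' _ _ Ba' (hτ.active Bt2) (hτ.active Bt) (f3.trans f4) (by rw [va', f1, f2])
      (by rw [l1, l2, h.eq_w, h2.eq_w])
    rw [va', l2, h2.eq_w] at this
    exact this.elim h.ne_zw h.ne_wb.symm

end Corner

end Steps

/-! ### The inverse of a D3a reduction -/

section Truncation

variable {D W : Type*} [DecidableEq D] [Finite D]
variable {α σ : Perm D} {ℓ : D → W} {a b e e' t t' a' b' c s s' : D}

namespace Truncation

omit [Finite D] in
theorem active (h : Truncation α ℓ a b e e' t t' a' b' c s s') :
    smooth t s (cutα a b e e' α) a' ≠ a' ∧ smooth t s (cutα a b e e' α) t' ≠ t' ∧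
    smooth t s (cutα a b e e' α) c ≠ c ∧ smooth t s (cutα a b e e' α) b' ≠ b' ∧
    smooth t s (cutα a b e e' α) s' ≠ s' := by
  obtain ⟨hd, h1, h2, h3, h4, h5, h6, h7, h8, h9, h10, h11, h12, h13, h14, h15, h16, h17, h18, h19⟩ :=
    h.distinct
  simp only [List.nodup_cons, List.mem_cons, List.not_mem_nil, or_false, not_or] at hd
  have Bs : α s' ≠ s' := by rw [← h.αs, h.corner.inv, h.αs]; exact h19.symm
  obtain ⟨Ba', Bt', Bt, Bc, Bb'⟩ := h.corner.active_cut
  simp only [h.active_iff]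
  rw [h.corner.active_iff] at Ba' Bt' Bt Bc Bb'
  grind

omit [Finite D] in
theorem cut_values (h : Truncation α ℓ a b e e' t t' a' b' c s s') :
    smooth t s (cutα a b e e' α) a' = b' ∧ smooth t s (cutα a b e e' α) b' = a' ∧
    smooth t s (cutα a b e e' α) t' = s' ∧ smooth t s (cutα a b e e' α) s' = t' := by
  obtain ⟨hd, h1, h2, h3, h4, h5, h6, h7, h8, h9, h10, h11, h12, h13, h14, h15, h16, h17, h18, h19⟩ :=
    h.distinct
  simp only [List.nodup_cons, List.mem_cons, List.not_mem_nil, or_false, not_or] at hd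
  simp only [h.cut_apply]
  grind

omit [Finite D] in
-- Exchanging the roles of u and w describes the same truncation, so only one rotation at z needs an
-- argument.
theorem cut_swap (h : Truncation α ℓ a b e e' t t' a' b' c s s') :
    smooth a b (cutα t s e' e α) = smooth t s (cutα a b e e' α) := by
  obtain ⟨hd, h1, h2, h3, h4, h5, h6, h7, h8, h9, h10, h11, h12, h13, h14, h15, h16, h17, h18, h19⟩ :=
    h.distinct
  simp only [List.nodup_cons, List.mem_cons, List.not_mem_nil, or_false, not_or] at hd
  ext x
  rw [h.cut_apply, h.swap.cut_apply]
  by_cases hx : x = a ∨ x = b ∨ x = e ∨ x = e' ∨ x = t ∨ x = s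
  · rw [if_pos hx, if_pos (by tauto)]
  · rw [if_neg hx, if_neg (by tauto)]
    grind

theorem cutσ_swap (h : Truncation α ℓ a b e e' t t' a' b' c s s') (hσ : IsRot α ℓ σ) :
    cutσ a e e' σ t = s ∧ cutσ a e e' σ s = t := by
  obtain ⟨hd, h1, h2, h3, h4, h5, h6, h7, h8, h9, h10, h11, h12, h13, h14, h15, h16, h17, h18, h19⟩ :=
    h.distinct
  simp only [List.nodup_cons, List.mem_cons, List.not_mem_nil, or_false, not_or] at hd
  have hw := hσ.cases h.w
  simp only [cutσ, del_apply]
  grind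

omit [Finite D] in
theorem smooth_conditions (h : Truncation α ℓ a b e e' t t' a' b' c s s') : t ≠ s ∧
    cutα a b e e' α t ≠ t ∧ cutα a b e e' α s ≠ s ∧ cutα a b e e' α t ≠ s := by
  obtain ⟨hd, h1, h2, h3, h4, h5, h6, h7, h8, h9, h10, h11, h12, h13, h14, h15, h16, h17, h18, h19⟩ :=
    h.distinct
  simp only [List.nodup_cons, List.mem_cons, List.not_mem_nil, or_false, not_or] at hd
  have hv := h.corner.cut_values.2.2.1
  have := h.corner.cutα_apply s
  have αs := h.αs
  grind

theorem isRot (h : Truncation α ℓ a b e e' t t' a' b' c s s') (hσ : IsRot α ℓ σ) :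
    IsRot (smooth t s (cutα a b e e' α)) ℓ (del t (cutσ a e e' σ)) where
  fix x hx := by
    have h1 := h.cutσ_swap hσ
    have h2 := (h.corner.isRot hσ).fix x
    have h3 := mt h.active_iff.2 (not_not.2 hx)
    have i1 : cutσ a e e' σ x = t → x = s := fun hh =>
      (cutσ a e e' σ).injective (hh.trans h1.2.symm)
    rw [del_apply]
    by_cases hx1 : x = t
    · rw [if_pos hx1, hx1]
    by_cases hx2 : x = s
    · rw [if_neg hx1, hx2, if_pos h1.2, h1.1]
    · have h5 : cutα a b e e' α x = x := by
        by_contra hh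
        have := h.corner.active_iff.1 hh
        tauto
      rw [if_neg hx1, if_neg fun hh => hx2 (i1 hh), h2 h5]
  vert x y hx hy := by
    have hx' := h.active_iff.1 hx
    have hy' := h.active_iff.1 hy
    rw [sameCycle_del hx'.2.2.2.2.2.1 hy'.2.2.2.2.2.1]
    exact (h.corner.isRot hσ).vert x y (h.corner.active_iff.2 (by tauto))
      (h.corner.active_iff.2 (by tauto))

theorem euler_cut (h : Truncation α ℓ a b e e' t t' a' b' c s s') (hσ : IsRot α ℓ σ) :
    euler (smooth t s (cutα a b e e' α)) (del t (cutσ a e e' σ)) =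
      euler (cutα a b e e' α) (cutσ a e e' σ) := by
  obtain ⟨h1, h2, h3, h4⟩ := h.smooth_conditions
  obtain ⟨h5, h6⟩ := h.cutσ_swap hσ
  exact euler_smooth h.corner.cutα_inv h1 h2 h3 h4 h5 h6

theorem sameCycle_cut (h : Truncation α ℓ a b e e' t t' a' b' c s s') (hσ : IsRot α ℓ σ) {x y : D}
    (hx : smooth t s (cutα a b e e' α) x ≠ x) (hy : smooth t s (cutα a b e e' α) y ≠ y) :
    (del t (cutσ a e e' σ) * smooth t s (cutα a b e e' α)).SameCycle x y ↔
      (Equiv.swap e e' * (σ * α)).SameCycle x y := by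
  obtain ⟨h1, h2, h3, h4⟩ := h.smooth_conditions
  obtain ⟨h5, h6⟩ := h.cutσ_swap hσ
  have hx' := h.active_iff.1 hx
  have hy' := h.active_iff.1 hy
  rw [mul_smooth h.corner.cutα_inv h1 h2 h3 h4 h5 h6,
    sameCycle_del hx'.2.2.2.2.2.1 hy'.2.2.2.2.2.1, sameCycle_del hx'.2.2.2.2.2.2 hy'.2.2.2.2.2.2]
  exact h.corner.sameCycle_cut hσ (h.corner.active_iff.2 (by tauto))
    (h.corner.active_iff.2 (by tauto))

omit [Finite D] in
theorem cutσ_apply (h : Truncation α ℓ a b e e' t t' a' b' c s s') (hσ : IsRot α ℓ σ) {x : D}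
    (hx : α x ≠ x) (h1 : ℓ x ≠ ℓ a) (h2 : ℓ x ≠ ℓ e') : del t (cutσ a e e' σ) x = σ x := by
  have h3 := h.corner.cutσ_apply hσ hx h1 h2
  have hl := hσ.label hx
  have hw := h.corner.eq_w
  rw [del_apply, h3, if_neg fun hh => h2 (by rw [hh, hw]), if_neg fun hh => h2 (by rw [← hl, hh, hw])]

/-- In a planar embedding, the edge `e` cuts off the corner. -/
theorem coherent (h : Truncation α ℓ a b e e' t t' a' b' c s s') (hσ : IsRot α ℓ σ)
    (hne : ¬ (σ * α).SameCycle e e') {kH : D → ℕ}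
    (hH : IsFaceLabel (smooth t s (cutα a b e e' α)) (del t (cutσ a e e' σ)) kH)
    (T : Tight (smooth t s (cutα a b e e' α)) ℓ kH)
    (h3 : σ t' = a') : σ a = e ∧ σ e' = t := by
  obtain ⟨Ba', Bt', Bc, Bb', Bs'⟩ := h.active
  obtain ⟨va', vb', vt', vs'⟩ := h.cut_values
  have hz := h.corner.z
  have αa' : α a' = a := by rw [← h.corner.αa, h.corner.inv]
  have αb' : α b' = b := by rw [← h.corner.αb, h.corner.inv]
  have αt' : α t' = t := by rw [← h.corner.αt, h.corner.inv]
  have σa' : σ a' = c := by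
    rcases hσ.cases hz with ⟨-, z2, z3⟩ | hh
    · exact absurd (h3.symm.trans z2) hz.ne_ac
    · exact hh.1
  have f1 : kH a' ≠ kH t' := fun hh => hz.ne_ab (T.inj _ _ Ba' Bt' hz.eq_ab.symm hh)
  have f2 : kH a' ≠ kH c := fun hh => hz.ne_ac (T.inj _ _ Ba' Bc hz.eq_ac.symm hh)
  have f3 : kH t' ≠ kH c := fun hh => hz.ne_bc (T.inj _ _ Bt' Bc (hz.eq_ab.trans hz.eq_ac.symm) hh)
  have f4 : kH b' = kH c := (hH _ _ Bb' Bc).2 (sameCycle_of_apply_eq (by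
    rw [Perm.mul_apply, vb', h.cutσ_apply hσ hz.act_a h.corner.ne_uz h.corner.ne_zw.symm, σa']))
  have merge : ∀ x y, smooth t s (cutα a b e e' α) x ≠ x → smooth t s (cutα a b e e' α) y ≠ y →
      ((σ * α).SameCycle x e ∨ (σ * α).SameCycle x e') →
      ((σ * α).SameCycle y e ∨ (σ * α).SameCycle y e') → kH x = kH y := fun x y hx hy h1 h2 =>
    (hH x y hx hy).2 ((h.sameCycle_cut hσ hx hy).2 ((sameCycle_swap_mul_iff hne).2 (Or.inr ⟨h1, h2⟩)))
  -- Deleting e fuses its two sides. For each of the three wrong choices of rotations at u and w,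
  -- two of the darts a', t', c at z would end up on one face of the truncated map, contrary to
  -- tightness.
  rcases hσ.cases h.corner.u with ⟨u1, -⟩ | ⟨-, u1, -⟩ <;>
    rcases hσ.cases h.w with ⟨w1, -⟩ | ⟨-, -, w1⟩
  · exact ⟨u1, w1⟩
  · exact absurd (merge a' t' Ba' Bt'
      (Or.inl (sameCycle_of_apply_eq (by rw [Perm.mul_apply, αa', u1])))
      (Or.inr (sameCycle_of_apply_eq (by rw [Perm.mul_apply, αt', w1])))) f1
  · refine absurd ((merge b' a' Bb' Ba'
      (Or.inl (sameCycle_of_apply_eq (by rw [Perm.mul_apply, αb', u1]))) (Or.inl ?_)).symm.trans f4) f2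
    refine SameCycle.symm ?_
    exact (sameCycle_of_apply_eq (y := t) (by rw [Perm.mul_apply, h.corner.αe, w1])).trans
      (sameCycle_of_apply_eq (by rw [Perm.mul_apply, h.corner.αt, h3]))
  · exact absurd ((merge b' t' Bb' Bt'
      (Or.inl (sameCycle_of_apply_eq (by rw [Perm.mul_apply, αb', u1])))
      (Or.inr (sameCycle_of_apply_eq (by rw [Perm.mul_apply, αt', w1])))).symm.trans f4) f3

theorem planar_of_coherent (h : Truncation α ℓ a b e e' t t' a' b' c s s') (hσ : IsRot α ℓ σ)
    {kH : D → ℕ} (hH : IsFaceLabel (smooth t s (cutα a b e e' α)) (del t (cutσ a e e' σ)) kH)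
    (T : Tight (smooth t s (cutα a b e e' α)) ℓ kH)
    (hdec : HasDualDecomposition (smooth t s (cutα a b e e' α)) (del t (cutσ a e e' σ)) kH)
    (h1 : σ a = e) (h2 : σ e' = t) (h3 : σ t' = a') :
    ∃ κ, IsFaceLabel α σ κ ∧ Tight α ℓ κ ∧ HasDualDecomposition α σ κ := by
  obtain ⟨hd, d1, d2, d3, d4, d5, d6, d7, d8, d9, d10, d11, d12, d13, d14, d15, d16, d17, d18, d19⟩ :=
    h.distinct
  simp only [List.nodup_cons, List.mem_cons, List.not_mem_nil, or_false, not_or] at hd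
  obtain ⟨Ba', Bt', Bc, Bb', Bs'⟩ := h.active
  obtain ⟨va', vb', vt', vs'⟩ := h.cut_values
  have hz := h.corner.z
  have inv := h.corner.inv
  have τt' := h.cutσ_apply hσ hz.act_b (by rw [hz.eq_ab]; exact h.corner.ne_uz)
    (by rw [hz.eq_ab]; exact h.corner.ne_zw.symm)
  have hs' : kH s' = kH a' := (hH _ _ Bs' Ba').2
    (sameCycle_of_apply_eq (by rw [Perm.mul_apply, vs', τt', h3]))
  have σt : σ t = s := by
    rcases hσ.cases h.w with hh | hh
    · exact hh.2.1
    · exact absurd (hh.1.symm.trans h2) d5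
  obtain ⟨k, N, cf, ks, f1, f2⟩ := h.corner.exists_faces (c' := α c) (s := s) (s' := s') hσ h1 h2 h3 rfl
    (fun x hx => by
      obtain ⟨x1, x2, x3, x4, x5, x6, x7⟩ := h.active_iff.1 hx
      exact ⟨x1, x2, x3, x4, x5, fun _ => x7⟩)
    (fun x x1 x2 x3 x4 x5 x6 x7 => h.active_iff.2 ⟨x1, x2, x3, x4, x5, x6, x7⟩)
    (fun x _ x2 x3 x4 x5 x6 x7 x8 x9 x10 x11 => by
      rw [h.cut_apply, if_neg (by simp [*]), if_neg x8, if_neg x9, if_neg x10, if_neg (x11 d5)])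
    vb' (fun x hx l1 l2 => h.cutσ_apply hσ hx l1 l2)
    (fun x y hx hy => h.sameCycle_cut hσ hx hy)
    (fun _ => ⟨h.αs, σt, hs', d16, d14, d11, d10, d19, d9, d6, d8, d7, d18, d4, h.w.eq_ac⟩) hH hdec
  have flip : ∀ x y, α x = y → α c = x → c = y := fun x y h1 h2 => by rw [← h1, ← h2, inv]
  have αe' : α e' = e := by rw [← h.corner.αe, inv]
  have Ac := hz.act_c
  have lc : ℓ (α c) ≠ ℓ a := by
    intro hh
    rcases h.corner.u.fiber (α c) (by rw [inv]; exact Ac.symm) hh with hc | hc | hc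
    · exact hd.2.2.2.2.2.2.1.2 (flip _ _ h.corner.αa hc).symm
    · exact hd.2.2.2.1.2.2.2.2 (flip _ _ h.corner.αe hc).symm
    · exact hd.2.2.2.2.2.2.2.1 (flip _ _ h.corner.αb hc).symm
  have lc' : ℓ (α c) ≠ ℓ e' := by
    intro hh
    rcases h.w.fiber (α c) (by rw [inv]; exact Ac.symm) hh with hc | hc | hc
    · exact hd.2.2.1.2.2.2.2.2 (flip _ _ αe' hc).symm
    · exact hz.ne_bc (flip _ _ h.corner.αt hc).symm
    · exact d18 (flip _ _ h.αs hc).symm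
  exact ⟨k, f1, h.tight T cf rfl lc lc' (ks d5) hs', f2⟩

set_option maxHeartbeats 800000 in
/-- Truncate a vertex of degree three of an embedding. -/
theorem exists_rotation (h : Truncation α ℓ a b e e' t t' a' b' c s s') {τ : Perm D}
    (hτ : IsRot (smooth t s (cutα a b e e' α)) ℓ τ) (h3 : τ t' = a') :
    ∃ σ, IsRot α ℓ σ ∧ euler α σ = euler (smooth t s (cutα a b e e' α)) τ := by
  obtain ⟨hd, d1, d2, d3, d4, d5, d6, d7, d8, d9, d10, d11, d12, d13, d14, d15, d16, d17, d18, d19⟩ :=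
    h.distinct
  simp only [List.nodup_cons, List.mem_cons, List.not_mem_nil, or_false, not_or] at hd
  have fix : ∀ x, α x = x ∨ x = a ∨ x = b ∨ x = e ∨ x = e' ∨ x = t ∨ x = s → τ x = x :=
    fun x hx => hτ.fix x (by
      by_contra hh
      have := h.active_iff.1 hh
      tauto)
  have Ta := fix a (by tauto)
  have Tb := fix b (by tauto)
  have Te := fix e (by tauto)
  have Te' := fix e' (by tauto)
  have Tt := fix t (by tauto)
  have Ts := fix s (by tauto)
  have i1 : ∀ x y, τ x = τ y → x = y := fun x y hh => τ.injective hh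
  obtain ⟨σ, hσ⟩ : ∃ σ : Perm D, ∀ x, σ x = if x = a then e else if x = e then b else
      if x = b then a else if x = e' then t else if x = t then s else if x = s then e' else τ x := by
    -- The new vertices receive the cycles a, e, b and e', t, s; everywhere else τ is kept.
    refine ⟨Equiv.swap a e * Equiv.swap e b * Equiv.swap e' t * Equiv.swap t s * τ, fun x => ?_⟩
    simp only [Perm.mul_apply, swap_apply_def]
    have := i1 x a; have := i1 x b; have := i1 x e; have := i1 x e'; have := i1 x t; have := i1 x s
    clear i1 fix
    by_cases x1 : x = a; · grind
    by_cases x2 : x = b; · grind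
    by_cases x3 : x = e; · grind
    by_cases x4 : x = e'; · grind
    by_cases x5 : x = t; · grind
    by_cases x6 : x = s; · grind
    grind
  have σa : σ a = e := by rw [hσ, if_pos rfl]
  have σe' : σ e' = t := by rw [hσ]; clear i1 fix; grind
  have σt' : σ t' = a' := by rw [hσ]; clear i1 fix; grind
  have σe : σ e = b := by rw [hσ]; clear i1 fix; grind
  have σb : σ b = a := by rw [hσ]; clear i1 fix; grind
  have σt : σ t = s := by rw [hσ]; clear i1 fix; grind
  have σs : σ s = e' := by rw [hσ]; clear i1 fix; grind
  have hcut : del t (cutσ a e e' σ) = τ := by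
    ext x
    simp only [cutσ, del_apply]
    have := i1 x a; have := i1 x b; have := i1 x e; have := i1 x e'; have := i1 x t; have := i1 x s
    have := hσ x
    clear i1 fix hσ
    by_cases x1 : x = a; · grind
    by_cases x2 : x = b; · grind
    by_cases x3 : x = e; · grind
    by_cases x4 : x = e'; · grind
    by_cases x5 : x = t; · grind
    by_cases x6 : x = s; · grind
    grind
  have hrot : IsRot α ℓ σ := by
    refine isRot_of_representatives hτ ?_ ?_ ?_
    · intro x hx
      have := h.corner.u.act_a; have := h.corner.u.act_b; have := h.corner.u.act_c
      have := h.w.act_a; have := h.w.act_b; have := h.w.act_c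
      have := fix x (Or.inl hx)
      rw [hσ, if_neg, if_neg, if_neg, if_neg, if_neg, if_neg, this] <;> rintro rfl <;> contradiction
    · intro x y hx hy
      rw [h.active_iff] at hx hy
      rw [← hcut, sameCycle_del hx.2.2.2.2.2.1 hy.2.2.2.2.2.1, cutσ, sameCycle_del hx.2.1 hy.2.1,
        sameCycle_del hx.2.2.2.1 hy.2.2.2.1, sameCycle_del hx.2.2.2.2.1 hy.2.2.2.2.1]
    · intro x hx
      by_cases hxu : x = a ∨ x = e ∨ x = b
      · exact Or.inr fun y hy => h.corner.u.sameCycle_iff σa σe σb hy hxu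
      by_cases hxw : x = e' ∨ x = t ∨ x = s
      · exact Or.inr fun y hy => h.w.sameCycle_iff σe' σt σs hy hxw
      · rw [not_or, not_or] at hxu hxw
        exact Or.inl ⟨x, h.active_iff.2 ⟨hx, hxu.1, hxu.2.2, hxu.2.1, hxw.1, hxw.2.1, hxw.2.2⟩, rfl,
          SameCycle.refl _ _⟩
  refine ⟨σ, hrot, ?_⟩
  rw [← hcut, h.euler_cut hrot]
  refine ((h.corner.euler_cut hrot).1 fun hh => ?_).symm
  have := h.corner.mem_of_sameCycle σa σe' σt' hh
  clear i1 fix hσ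
  grind

/-- The inverse of a D3a reduction. -/
theorem good (h : Truncation α ℓ a b e e' t t' a' b' c s s')
    (hG : Good (smooth t s (cutα a b e e' α)) ℓ) : Good α ℓ := by
  have hG2 : Good (smooth a b (cutα t s e' e α)) ℓ := by rw [h.cut_swap]; exact hG
  refine ⟨fun σ hσ => ?_, fun σ hσ hE => ?_, ?_⟩
  · have e1 := h.corner.euler_cut hσ
    have e2 := hG.le _ (h.isRot hσ)
    rw [h.euler_cut hσ] at e2
    by_cases hs : (σ * α).SameCycle e e'
    · have := e1.2 hs
      omega
    · have := e1.1 hs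
      omega
  · have hne : ¬ (σ * α).SameCycle e e' := fun hs => by
      have e1 := (h.corner.euler_cut hσ).2 hs
      have e2 := hG.le _ (h.isRot hσ)
      rw [h.euler_cut hσ] at e2
      omega
    have main : ∀ {a b e e' t t' a' b' c s s' : D}, Truncation α ℓ a b e e' t t' a' b' c s s' →
        Good (smooth t s (cutα a b e e' α)) ℓ → ¬ (σ * α).SameCycle e e' → σ t' = a' →
        ∃ κ, IsFaceLabel α σ κ ∧ Tight α ℓ κ ∧ HasDualDecomposition α σ κ := by
      intro a b e e' t t' a' b' c s s' h hG hne h3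
      obtain ⟨kH, k1, k2, k3⟩ := hG.planar _ (h.isRot hσ)
        ((h.euler_cut hσ).trans (((h.corner.euler_cut hσ).1 hne).trans hE))
      obtain ⟨h1, h2⟩ := h.coherent hσ hne k1 k2 h3
      exact h.planar_of_coherent hσ k1 k2 k3 h1 h2 h3
    -- The rotation at z decides between the truncation as given and its mirror image.
    rcases hσ.cases h.corner.z with ⟨z1, -⟩ | ⟨-, -, z3⟩
    · exact main h.swap hG2 (fun hh => hne hh.symm) z1
    · exact main h hG hne z3
  · obtain ⟨τ, hτ, hE⟩ := hG.exist
    obtain ⟨Ba', Bt', Bc, -, -⟩ := h.active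
    have hz := h.corner.z
    have hz' : DegThree (smooth t s (cutα a b e e' α)) ℓ a' t' c :=
      ⟨Ba', Bt', Bc, hz.ne_ab, hz.ne_ac, hz.ne_bc, hz.eq_ab, hz.eq_ac,
        fun x hx => hz.fiber x (h.active_iff.1 hx).1⟩
    rcases hτ.cases hz' with ⟨z1, -⟩ | ⟨-, -, z3⟩
    · obtain ⟨σ, s1, s2⟩ := h.swap.exists_rotation (by rw [h.cut_swap]; exact hτ) z1
      rw [h.cut_swap] at s2
      exact ⟨σ, s1, s2.trans hE⟩
    · obtain ⟨σ, s1, s2⟩ := h.exists_rotation hτ z3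
      exact ⟨σ, s1, s2.trans hE⟩

end Truncation

end Truncation

/-! ### The base of the induction: two vertices joined by three edges -/

section Dipole

variable {D W : Type*}

/-- Two vertices that are joined by three parallel edges. -/
structure Dipole (α : Perm D) (ℓ : D → W) (x₁ x₂ x₃ y₁ y₂ y₃ : D) : Prop where
  inv : ∀ x, α (α x) = x
  x : DegThree α ℓ x₁ x₂ x₃
  y : DegThree α ℓ y₁ y₂ y₃
  h₁ : α x₁ = y₁
  h₂ : α x₂ = y₂
  h₃ : α x₃ = y₃
  ne : ℓ x₁ ≠ ℓ y₁
  all : ∀ d, α d ≠ d → ℓ d = ℓ x₁ ∨ ℓ d = ℓ y₁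

variable {α σ : Perm D} {ℓ : D → W} {x₁ x₂ x₃ y₁ y₂ y₃ : D}

namespace Dipole

theorem swap (h : Dipole α ℓ x₁ x₂ x₃ y₁ y₂ y₃) : Dipole α ℓ x₃ x₂ x₁ y₃ y₂ y₁ where
  inv := h.inv
  x := h.x.swap
  y := h.y.swap
  h₁ := h.h₃
  h₂ := h.h₂
  h₃ := h.h₁
  ne := by rw [h.x.eq_ac, h.y.eq_ac]; exact h.ne
  all d hd := by rw [h.x.eq_ac, h.y.eq_ac]; exact h.all d hd

theorem distinct (h : Dipole α ℓ x₁ x₂ x₃ y₁ y₂ y₃) : [x₁, x₂, x₃, y₁, y₂, y₃].Nodup := by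
  obtain ⟨inv, ⟨ua1, ua2, ua3, un1, un2, un3, ue1, ue2, uf⟩, ⟨za1, za2, za3, zn1, zn2, zn3, ze1, ze2, zf⟩,
    h1, h2, h3, ne, all⟩ := h
  simp only [List.nodup_cons, List.mem_cons, List.not_mem_nil, or_false, not_or, not_false_eq_true,
    List.nodup_nil, and_true]
  clear uf zf all inv
  and_intros <;> grind

theorem cases (h : Dipole α ℓ x₁ x₂ x₃ y₁ y₂ y₃) {d : D} (hd : α d ≠ d) :
    d = x₁ ∨ d = x₂ ∨ d = x₃ ∨ d = y₁ ∨ d = y₂ ∨ d = y₃ := by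
  rcases h.all d hd with hl | hl
  · have := h.x.fiber d hd hl
    tauto
  · have := h.y.fiber d hd hl
    tauto

theorem inv_values (h : Dipole α ℓ x₁ x₂ x₃ y₁ y₂ y₃) : α y₁ = x₁ ∧ α y₂ = x₂ ∧ α y₃ = x₃ :=
  ⟨by rw [← h.h₁, h.inv], by rw [← h.h₂, h.inv], by rw [← h.h₃, h.inv]⟩

variable [Finite D]

/-- Opposite rotations at the two ends make every face a digon. With only three faces, one bag on a
single node suffices. -/
theorem planar_of_rotation (h : Dipole α ℓ x₁ x₂ x₃ y₁ y₂ y₃)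
    (a1 : σ x₁ = x₂) (a2 : σ x₂ = x₃) (a3 : σ x₃ = x₁) (b1 : σ y₁ = y₃) (b3 : σ y₃ = y₂) (b2 : σ y₂ = y₁) :
    ∃ κ, IsFaceLabel α σ κ ∧ Tight α ℓ κ ∧ HasDualDecomposition α σ κ := by
  classical
  have hd := h.distinct
  simp only [List.nodup_cons, List.mem_cons, List.not_mem_nil, or_false, not_or] at hd
  obtain ⟨c1, c2, c3⟩ := h.inv_values
  have h1 := h.h₁; have h2 := h.h₂; have h3 := h.h₃
  obtain ⟨k, k1, k2, k3, k4, k5, k6⟩ : ∃ k : D → ℕ, k x₁ = 0 ∧ k y₃ = 0 ∧ k x₂ = 1 ∧ k y₁ = 1 ∧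
      k x₃ = 2 ∧ k y₂ = 2 := by
    refine ⟨fun x => if x = x₁ ∨ x = y₃ then 0 else if x = x₂ ∨ x = y₁ then 1 else 2, ?_⟩
    grind
  have hk : ∀ d, α d ≠ d → k d = 0 ∨ k d = 1 ∨ k d = 2 := by
    intro d hdd
    rcases h.cases hdd with rfl | rfl | rfl | rfl | rfl | rfl <;> tauto
  have p1 : (σ * α) x₁ = y₃ := by rw [Perm.mul_apply, h1, b1]
  have p2 : (σ * α) x₂ = y₁ := by rw [Perm.mul_apply, h2, b2]
  have p3 : (σ * α) x₃ = y₂ := by rw [Perm.mul_apply, h3, b3]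
  have q1 : (σ * α) y₁ = x₂ := by rw [Perm.mul_apply, c1, a1]
  have q2 : (σ * α) y₂ = x₃ := by rw [Perm.mul_apply, c2, a2]
  have q3 : (σ * α) y₃ = x₁ := by rw [Perm.mul_apply, c3, a3]
  have act : ∀ d, (d = x₁ ∨ d = x₂ ∨ d = x₃ ∨ d = y₁ ∨ d = y₂ ∨ d = y₃) → α d ≠ d := by
    rintro d (rfl | rfl | rfl | rfl | rfl | rfl)
    exacts [h.x.act_a, h.x.act_b, h.x.act_c, h.y.act_a, h.y.act_b, h.y.act_c]
  refine ⟨k, ?_, ⟨?_, ?_⟩, Unit, inferInstance, ⊥, fun _ => {0, 1, 2}, ?_, ?_, ?_, ?_, ?_⟩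
  · intro x y hx hy
    constructor
    · intro hxy
      have s1 := sameCycle_of_apply_eq p1
      have s2 := sameCycle_of_apply_eq p2
      have s3 := sameCycle_of_apply_eq p3
      have s1' := s1.symm
      have s2' := s2.symm
      have s3' := s3.symm
      rcases h.cases hx with hx | hx | hx | hx | hx | hx <;>
        rcases h.cases hy with hy | hy | hy | hy | hy | hy <;> rw [hx, hy] at hxy ⊢ <;>
        first
          | exact SameCycle.refl _ _
          | assumption
          | (exfalso; omega)
    · intro hxy
      refine (D3.mem_of_sameCycle (S := {y | (y = x₁ ∨ y = x₂ ∨ y = x₃ ∨ y = y₁ ∨ y = y₂ ∨ y = y₃) ∧ k x = k y})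
        ?_ hxy ⟨h.cases hx, rfl⟩).2
      rintro z ⟨hz, hkz⟩
      rcases hz with hz | hz | hz | hz | hz | hz <;> rw [hz] at hkz ⊢
      · rw [p1]; exact ⟨by tauto, by omega⟩
      · rw [p2]; exact ⟨by tauto, by omega⟩
      · rw [p3]; exact ⟨by tauto, by omega⟩
      · rw [q1]; exact ⟨by tauto, by omega⟩
      · rw [q2]; exact ⟨by tauto, by omega⟩
      · rw [q3]; exact ⟨by tauto, by omega⟩
  · intro x y hx hy hl hkk
    have l1 := h.x.eq_ab; have l2 := h.x.eq_ac; have l3 := h.y.eq_ab; have l4 := h.y.eq_ac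
    have l5 := h.ne
    have c1 := h.cases hx
    have c2 := h.cases hy
    clear act hk
    rcases c1 with hx | hx | hx | hx | hx | hx <;>
        rcases c2 with hy | hy | hy | hy | hy | hy <;> rw [hx, hy] at hkk hl ⊢ <;>
        first
          | (exfalso; omega)
          | (exfalso; grind)
  · intro d x y hdd hx hy _ _ hl
    have l1 := h.x.eq_ab; have l2 := h.x.eq_ac; have l3 := h.y.eq_ab; have l4 := h.y.eq_ac
    have c4 := h.cases hdd
    have c5 := h.all x hx
    rcases c4 with rfl | rfl | rfl | rfl | rfl | rfl
    · rw [h1]; exact c5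
    · rw [h2, l1, l3]; exact c5
    · rw [h3, l2, l4]; exact c5
    · rw [c1]; exact c5.symm
    · rw [c2, l1, l3]; exact c5.symm
    · rw [c3, l2, l4]; exact c5.symm
  · exact SimpleGraph.IsTree.of_subsingleton
  · intro _
    exact Finset.card_le_three.trans (by norm_num)
  · intro d hdd
    refine ⟨(), ?_, ?_⟩
    · simpa using hk d hdd
    · simpa using hk (α d) (by rw [h.inv]; exact hdd.symm)
  · intro d hdd _
    have A1 : α (σ d) ≠ σ d := act _ (by
      rcases h.cases hdd with hh | hh | hh | hh | hh | hh <;> rw [hh] <;> simp [*])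
    have A2 : α (σ (σ d)) ≠ σ (σ d) := act _ (by
      rcases h.cases A1 with hh | hh | hh | hh | hh | hh <;> rw [hh] <;> simp [*])
    refine ⟨(), ?_, ?_, ?_⟩
    · simpa using hk d hdd
    · simpa using hk _ A1
    · simpa using hk _ A2
  · intro d hdd
    have : {i : Unit | k d ∈ ({0, 1, 2} : Finset ℕ)} = Set.univ := by
      ext i
      simpa using hk d hdd
    rw [this]
    exact (SimpleGraph.induceUnivIso _).connected_iff.2 SimpleGraph.IsTree.of_subsingleton.connected

variable [DecidableEq D]

/-- Deleting one edge and smoothing out an end leaves a single loop, a map with one vertex, one edge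
and two faces. Only the deletion can have changed the Euler number. -/
theorem euler_eq (h : Dipole α ℓ x₁ x₂ x₃ y₁ y₂ y₃) (hσ : IsRot α ℓ σ) :
    (¬ (σ * α).SameCycle x₁ y₁ → euler α σ = 2) ∧ ((σ * α).SameCycle x₁ y₁ → euler α σ = 0) := by
  have hd := h.distinct
  simp only [List.nodup_cons, List.mem_cons, List.not_mem_nil, or_false, not_or] at hd
  obtain ⟨c1, c2, c3⟩ := h.inv_values
  have h1 := h.h₁; have h2 := h.h₂; have h3 := h.h₃
  have hx := hσ.cases h.x
  have hy := hσ.cases h.y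
  have i1 : ∀ x, (Equiv.swap x₁ y₁ * α) x = if x = x₁ ∨ x = y₁ then x else α x := by
    intro x
    have := h.inv x
    simp only [Perm.mul_apply, swap_apply_def]
    grind
  obtain ⟨e1, e2⟩ := euler_delEdge (σ := σ) h.inv h1 (by grind) (by grind) (by grind) (by grind) (by grind)
  have r1 : del x₁ (del y₁ σ) x₂ = x₃ := by simp only [del_apply]; grind
  have r2 : del x₁ (del y₁ σ) x₃ = x₂ := by simp only [del_apply]; grind
  have i2 : ∀ x, (Equiv.swap x₁ y₁ * α) ((Equiv.swap x₁ y₁ * α) x) = x := by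
    intro x
    have := h.inv x
    simp only [i1]
    grind
  have v1 : (Equiv.swap x₁ y₁ * α) x₂ = y₂ := by rw [i1]; grind
  have v2 : (Equiv.swap x₁ y₁ * α) x₃ = y₃ := by rw [i1]; grind
  have n1 : (Equiv.swap x₁ y₁ * α) x₂ ≠ x₂ := by rw [v1]; grind
  have n2 : (Equiv.swap x₁ y₁ * α) x₃ ≠ x₃ := by rw [v2]; grind
  have n3 : (Equiv.swap x₁ y₁ * α) x₂ ≠ x₃ := by rw [v1]; grind
  have e3 := euler_smooth i2 hd.2.1.1 n1 n2 n3 r1 r2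
  have m1 : smooth x₂ x₃ (Equiv.swap x₁ y₁ * α) = Equiv.swap y₂ y₃ := by
    ext x
    have A : α x = x ∨ (x = x₁ ∨ x = x₂ ∨ x = x₃ ∨ x = y₁ ∨ x = y₂ ∨ x = y₃) := by
      by_cases hx : α x = x
      · exact Or.inl hx
      · exact Or.inr (h.cases hx)
    rw [smooth_apply i2 hd.2.1.1 n1 n2 n3, v1, v2, i1, swap_apply_def]
    grind
  have m2 : del x₂ (del x₁ (del y₁ σ)) = Equiv.swap y₂ y₃ := by
    ext x
    have A : σ x = x ∨ (x = x₁ ∨ x = x₂ ∨ x = x₃ ∨ x = y₁ ∨ x = y₂ ∨ x = y₃) := by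
      by_cases hx : α x = x
      · exact Or.inl (hσ.fix x hx)
      · exact Or.inr (h.cases hx)
    rw [swap_apply_def]
    simp only [del_apply]
    grind
  have e4 : euler (Equiv.swap y₂ y₃) (Equiv.swap y₂ y₃) = 2 := by
    have c1 : cyc (Equiv.swap y₂ y₃) + 1 = Nat.card D := by
      rw [← cyc_one, ← cyc_swap_mul_of_not_sameCycle (π := 1) (a := y₂) (b := y₃), mul_one]
      rw [sameCycle_one]
      exact hd.2.2.2.2.1
    unfold euler
    rw [swap_mul_self, cyc_one]
    omega
  rw [m1, m2, e4] at e3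
  exact ⟨fun hh => by rw [← e1 hh, ← e3], fun hh => by have := e2 hh; omega⟩

/-- Equal rotations at the two ends put x₁ and y₁ on one face, giving Euler number 0; so the planar
embeddings are exactly those with opposite rotations. -/
theorem good (h : Dipole α ℓ x₁ x₂ x₃ y₁ y₂ y₃) : Good α ℓ := by
  refine ⟨fun σ hσ => ?_, fun σ hσ hE => ?_, ?_⟩
  · have := h.euler_eq hσ
    by_cases hs : (σ * α).SameCycle x₁ y₁
    · rw [this.2 hs]; norm_num
    · rw [this.1 hs]
  · have hs : ¬ (σ * α).SameCycle x₁ y₁ := fun hs => by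
      have := (h.euler_eq hσ).2 hs
      omega
    obtain ⟨c1, c2, c3⟩ := h.inv_values
    rcases hσ.cases h.x with ⟨a1, a2, a3⟩ | ⟨a1, a3, a2⟩ <;>
      rcases hσ.cases h.y with ⟨b1, b2, b3⟩ | ⟨b1, b3, b2⟩
    · refine absurd ?_ hs
      exact (sameCycle_of_apply_eq (y := y₂) (by rw [Perm.mul_apply, h.h₁, b1])).trans
        ((sameCycle_of_apply_eq (y := x₃) (by rw [Perm.mul_apply, c2, a2])).trans
        (sameCycle_of_apply_eq (by rw [Perm.mul_apply, h.h₃, b3])))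
    · exact h.planar_of_rotation a1 a2 a3 b1 b3 b2
    · exact h.swap.planar_of_rotation a3 a2 a1 b3 b1 b2
    · refine absurd ?_ hs
      exact (sameCycle_of_apply_eq (y := y₃) (by rw [Perm.mul_apply, h.h₁, b1])).trans
        ((sameCycle_of_apply_eq (y := x₂) (by rw [Perm.mul_apply, c3, a3])).trans
        (sameCycle_of_apply_eq (by rw [Perm.mul_apply, h.h₂, b2])))
  · have hd := h.distinct
    simp only [List.nodup_cons, List.mem_cons, List.not_mem_nil, or_false, not_or] at hd
    obtain ⟨c1, c2, c3⟩ := h.inv_values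
    obtain ⟨σ, hσ⟩ : ∃ σ : Perm D, ∀ x, σ x = if x = x₁ then x₂ else if x = x₂ then x₃ else
        if x = x₃ then x₁ else if x = y₁ then y₃ else if x = y₃ then y₂ else if x = y₂ then y₁ else x := by
      refine ⟨Equiv.swap x₁ x₂ * Equiv.swap x₂ x₃ * (Equiv.swap y₁ y₃ * Equiv.swap y₃ y₂), fun x => ?_⟩
      simp only [Perm.mul_apply, swap_apply_def]
      by_cases z1 : x = x₁; · grind
      by_cases z2 : x = x₂; · grind
      by_cases z3 : x = x₃; · grind
      by_cases z4 : x = y₁; · grind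
      by_cases z5 : x = y₂; · grind
      by_cases z6 : x = y₃; · grind
      grind
    have a1 : σ x₁ = x₂ := by rw [hσ]; grind
    have a2 : σ x₂ = x₃ := by rw [hσ]; grind
    have a3 : σ x₃ = x₁ := by rw [hσ]; grind
    have b1 : σ y₁ = y₃ := by rw [hσ]; grind
    have b3 : σ y₃ = y₂ := by rw [hσ]; grind
    have b2 : σ y₂ = y₁ := by rw [hσ]; grind
    have hy : DegThree α ℓ y₁ y₃ y₂ := ⟨h.y.act_a, h.y.act_c, h.y.act_b, h.y.ne_ac, h.y.ne_ab,
      h.y.ne_bc.symm, h.y.eq_ac, h.y.eq_ab, fun x hx hl => by have := h.y.fiber x hx hl; tauto⟩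
    have hrot : IsRot α ℓ σ := by
      refine ⟨fun x hx => ?_, fun x y hx hy' => ?_⟩
      · have := h.x.act_a; have := h.x.act_b; have := h.x.act_c
        have := h.y.act_a; have := h.y.act_b; have := h.y.act_c
        rw [hσ, if_neg, if_neg, if_neg, if_neg, if_neg, if_neg] <;> rintro rfl <;> contradiction
      · rcases h.cases hx with hh | hh | hh | hh | hh | hh
        · exact h.x.sameCycle_iff a1 a2 a3 hy' (by tauto)
        · exact h.x.sameCycle_iff a1 a2 a3 hy' (by tauto)
        · exact h.x.sameCycle_iff a1 a2 a3 hy' (by tauto)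
        · exact hy.sameCycle_iff b1 b3 b2 hy' (by tauto)
        · exact hy.sameCycle_iff b1 b3 b2 hy' (by tauto)
        · exact hy.sameCycle_iff b1 b3 b2 hy' (by tauto)
    refine ⟨σ, hrot, (h.euler_eq hrot).1 fun hh => ?_⟩
    have := D3.mem_of_sameCycle (S := {x | x = x₁ ∨ x = y₃}) (by
      rintro z (rfl | rfl)
      · right; rw [Perm.mul_apply, h.h₁, b1]
      · left; rw [Perm.mul_apply, c3, a3]) hh (Or.inl rfl)
    rcases this with hh | hh
    · exact hd.1.2.2.1 hh.symm
    · exact hd.2.2.2.1.2 hh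

end Dipole

end Dipole

/-! ### From graphs to maps: K₄ and D3a reductions -/

section DartsOf

variable {D : Type*} {W : Type u}

/-- The points of `D` that are moved by `α` are the darts of `G`: `ℓ` is the initial vertex and `α`
is the reversal. -/
structure DartsOf (G : SimpleGraph W) (α : Perm D) (ℓ : D → W) : Prop where
  inv : ∀ d, α (α d) = d
  adj : ∀ d, α d ≠ d → G.Adj (ℓ d) (ℓ (α d))
  surj : ∀ x y, G.Adj x y → ∃ d, α d ≠ d ∧ ℓ d = x ∧ ℓ (α d) = y
  inj : ∀ d e, α d ≠ d → α e ≠ e → ℓ d = ℓ e → ℓ (α d) = ℓ (α e) → d = e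

theorem eq_or_of_ncard_eq_three {s : Set W} (hs : s.ncard = 3) {x y z : W} (hx : x ∈ s) (hy : y ∈ s)
    (hz : z ∈ s) (hxy : x ≠ y) (hxz : x ≠ z) (hyz : y ≠ z) {w : W} (hw : w ∈ s) :
    w = x ∨ w = y ∨ w = z := by
  obtain ⟨a, b, c, hab, hac, hbc, rfl⟩ := Set.ncard_eq_three.1 hs
  simp only [Set.mem_insert_iff, Set.mem_singleton_iff] at hx hy hz hw
  grind

theorem exists_third_of_ncard_eq_three {s : Set W} (hs : s.ncard = 3) {x y : W} (hx : x ∈ s)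
    (hy : y ∈ s) (hxy : x ≠ y) : ∃ z, z ≠ x ∧ z ≠ y ∧ ∀ w, w ∈ s ↔ w = x ∨ w = y ∨ w = z := by
  obtain ⟨a, b, c, hab, hac, hbc, rfl⟩ := Set.ncard_eq_three.1 hs
  simp only [Set.mem_insert_iff, Set.mem_singleton_iff] at hx hy ⊢
  rcases hx with rfl | rfl | rfl <;> rcases hy with rfl | rfl | rfl <;> first
    | exact absurd rfl hxy
    | exact ⟨c, by tauto, by tauto, fun w => by tauto⟩
    | exact ⟨b, by tauto, by tauto, fun w => by tauto⟩
    | exact ⟨a, by tauto, by tauto, fun w => by tauto⟩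

variable {G : SimpleGraph W} {α : Perm D} {ℓ : D → W}

theorem DartsOf.degThree (h : DartsOf G α ℓ) {x y₁ y₂ y₃ : W}
    (hx : ∀ y, G.Adj x y ↔ y = y₁ ∨ y = y₂ ∨ y = y₃) (h₁₂ : y₁ ≠ y₂) (h₁₃ : y₁ ≠ y₃) (h₂₃ : y₂ ≠ y₃)
    {a b c : D} (ha : α a ≠ a ∧ ℓ a = x ∧ ℓ (α a) = y₁) (hb : α b ≠ b ∧ ℓ b = x ∧ ℓ (α b) = y₂)
    (hc : α c ≠ c ∧ ℓ c = x ∧ ℓ (α c) = y₃) : DegThree α ℓ a b c where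
  act_a := ha.1
  act_b := hb.1
  act_c := hc.1
  ne_ab hh := h₁₂ (by rw [← ha.2.2, ← hb.2.2, hh])
  ne_ac hh := h₁₃ (by rw [← ha.2.2, ← hc.2.2, hh])
  ne_bc hh := h₂₃ (by rw [← hb.2.2, ← hc.2.2, hh])
  eq_ab := hb.2.1.trans ha.2.1.symm
  eq_ac := hc.2.1.trans ha.2.1.symm
  fiber d hd hl := by
    have had := h.adj d hd
    rw [hl, ha.2.1] at had
    rcases (hx _).1 had with h1 | h1 | h1
    · exact Or.inl (h.inj _ _ hd ha.1 hl (h1.trans ha.2.2.symm))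
    · exact Or.inr (Or.inl (h.inj _ _ hd hb.1 (hl.trans (ha.2.1.trans hb.2.1.symm)) (h1.trans hb.2.2.symm)))
    · exact Or.inr (Or.inr (h.inj _ _ hd hc.1 (hl.trans (ha.2.1.trans hc.2.1.symm)) (h1.trans hc.2.2.symm)))

theorem DartsOf.rev (h : DartsOf G α ℓ) {d : D} {x y : W} (hd : α d ≠ d ∧ ℓ d = x ∧ ℓ (α d) = y) :
    α (α d) ≠ α d ∧ ℓ (α d) = y ∧ ℓ (α (α d)) = x := by
  rw [h.inv]
  exact ⟨hd.1.symm, hd.2.2, hd.2.1⟩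

/-- The deleted edge is pr, and q plays the role of z: it survives as the vertex replacing the
triangle. The outside neighbours may coincide, as they do in K₄. -/
theorem DartsOf.exists_truncation (h : DartsOf G α ℓ) {p q r p' q' r' : W}
    (hp : ∀ x, G.Adj p x ↔ x = q ∨ x = r ∨ x = p') (hq : ∀ x, G.Adj q x ↔ x = p ∨ x = r ∨ x = q')
    (hr : ∀ x, G.Adj r x ↔ x = p ∨ x = q ∨ x = r') (hp' : p' ≠ q ∧ p' ≠ r) (hq' : q' ≠ p ∧ q' ≠ r)
    (hr' : r' ≠ p ∧ r' ≠ q) :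
    ∃ a b e e' t t' a' b' c s s', Truncation α ℓ a b e e' t t' a' b' c s s' ∧
      ℓ a = p ∧ ℓ a' = q ∧ ℓ e' = r ∧ ℓ b' = p' ∧ ℓ (α c) = q' ∧ ℓ s' = r' := by
  obtain ⟨a, ha⟩ := h.surj p q ((hp _).2 (by tauto))
  obtain ⟨b, hb⟩ := h.surj p p' ((hp _).2 (by tauto))
  obtain ⟨e, he⟩ := h.surj p r ((hp _).2 (by tauto))
  obtain ⟨t, ht⟩ := h.surj r q ((hr _).2 (by tauto))
  obtain ⟨s, hs⟩ := h.surj r r' ((hr _).2 (by tauto))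
  obtain ⟨c, hc⟩ := h.surj q q' ((hq _).2 (by tauto))
  have pq : p ≠ q := ((hp q).2 (by tauto)).ne
  have pr : p ≠ r := ((hp r).2 (by tauto)).ne
  have qr : q ≠ r := ((hq r).2 (by tauto)).ne
  have pp' : p ≠ p' := ((hp p').2 (by tauto)).ne
  have rr' : r ≠ r' := ((hr r').2 (by tauto)).ne
  have la' := h.rev ha
  have le' := h.rev he
  have lt' := h.rev ht
  refine ⟨a, b, e, α e, t, α t, α a, α b, c, s, α s, ⟨⟨h.inv, ?_, ?_, rfl, rfl, rfl, rfl, ?_, ?_, ?_, ?_, ?_, ?_, ?_⟩,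
    ?_, rfl, ?_, ?_, ?_⟩, ha.2.1, ha.2.2, he.2.2, hb.2.2, hc.2.2, hs.2.2⟩
  · exact h.degThree hp qr hp'.1.symm hp'.2.symm ha he hb
  · exact h.degThree hq pr hq'.1.symm hq'.2.symm la' lt' hc
  · rw [ht.2.1, he.2.2]
  · rw [ha.2.2, ha.2.1]; exact pq.symm
  · rw [he.2.2, ha.2.1]; exact pr.symm
  · rw [he.2.2, ha.2.2]; exact qr.symm
  · rw [hb.2.2, ha.2.1]; exact pp'.symm
  · rw [hb.2.2, ha.2.2]; exact hp'.1
  · rw [hb.2.2, he.2.2]; exact hp'.2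
  · exact h.degThree hr pq hr'.1.symm hr'.2.symm le' ht hs
  · rw [hs.2.2, ha.2.1]; exact hr'.1
  · rw [hs.2.2, ha.2.2]; exact hr'.2
  · rw [hs.2.2, he.2.2]; exact rr'.symm

theorem exists_adj_iff_of_iso_completeGraph {G : SimpleGraph W}
    (f : G ≃g SimpleGraph.completeGraph (Fin 4)) :
    ∃ p q r v : W, p ≠ q ∧ p ≠ r ∧ p ≠ v ∧ q ≠ r ∧ q ≠ v ∧ r ≠ v ∧
      (∀ x, x = p ∨ x = q ∨ x = r ∨ x = v) ∧ ∀ x y, G.Adj x y ↔ x ≠ y := by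
  refine ⟨f.symm 0, f.symm 1, f.symm 2, f.symm 3, ?_, ?_, ?_, ?_, ?_, ?_, fun x => ?_, fun x y => ?_⟩
  iterate 6 exact fun hh => by simpa using f.symm.injective hh
  · have : f x = 0 ∨ f x = 1 ∨ f x = 2 ∨ f x = 3 := by
      generalize f x = i
      fin_cases i <;> simp
    rcases this with h | h | h | h <;> rw [← h] <;> simp
  · rw [← f.map_adj_iff]
    simp

section Cut

variable [DecidableEq D] {a b e e' t t' a' b' c s s' : D}

theorem Truncation.cut_cases (h : Truncation α ℓ a b e e' t t' a' b' c s s') {x : D}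
    (hx : smooth t s (cutα a b e e' α) x ≠ x) : x = a' ∨ x = b' ∨ x = t' ∨ x = s' ∨
      smooth t s (cutα a b e e' α) x = α x ∧ smooth t s (cutα a b e e' α) (α x) = x := by
  obtain ⟨h0, h1, h2, h3, h4, h5, h6⟩ := h.active_iff.1 hx
  by_cases g1 : x = a'
  · exact Or.inl g1
  by_cases g2 : x = b'
  · exact Or.inr (Or.inl g2)
  by_cases g3 : x = t'
  · exact Or.inr (Or.inr (Or.inl g3))
  by_cases g4 : x = s'
  · exact Or.inr (Or.inr (Or.inr (Or.inl g4)))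
  refine Or.inr (Or.inr (Or.inr (Or.inr ?_)))
  have hne : ∀ {y y'}, α y = y' → x ≠ y' → α x ≠ y := fun hy hxy hh => by
    rw [← hy, ← hh, h.corner.inv] at hxy
    exact hxy rfl
  have hne' : ∀ {y y'}, α y = y' → x ≠ y → α x ≠ y' := fun hy hxy hh =>
    hxy (α.injective (hh.trans hy.symm))
  rw [h.cut_apply, h.cut_apply, h.corner.inv]
  have k1 := hne h.corner.αa g1
  have k2 := hne h.corner.αb g2
  have k3 := hne h.corner.αt g3
  have k4 := hne h.αs g4
  have k5 := hne h.corner.αe h4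
  have k6 := hne' h.corner.αe h3
  have k7 := hne' h.corner.αa h1
  have k8 := hne' h.corner.αb h2
  have k9 := hne' h.corner.αt h5
  have k10 := hne' h.αs h6
  constructor
  · rw [if_neg, if_neg g1, if_neg g2, if_neg g3, if_neg g4]
    simp only [h1, h2, h3, h4, h5, h6, or_self, not_false_eq_true]
  · rw [if_neg, if_neg k7, if_neg k8, if_neg k9, if_neg k10]
    simp only [k1, k2, k3, k4, k5, k6, or_self, not_false_eq_true]

theorem Truncation.cut_inv (h : Truncation α ℓ a b e e' t t' a' b' c s s') (x : D) :
    smooth t s (cutα a b e e' α) (smooth t s (cutα a b e e' α) x) = x := by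
  by_cases hx : smooth t s (cutα a b e e' α) x = x
  · rw [hx, hx]
  obtain ⟨v1, v2, v3, v4⟩ := h.cut_values
  rcases h.cut_cases hx with rfl | rfl | rfl | rfl | ⟨g1, g2⟩
  · rw [v1, v2]
  · rw [v2, v1]
  · rw [v3, v4]
  · rw [v4, v3]
  · rw [g1, g2]

theorem Truncation.active_iff_label (h : Truncation α ℓ a b e e' t t' a' b' c s s') {x : D} :
    smooth t s (cutα a b e e' α) x ≠ x ↔ α x ≠ x ∧ ℓ x ≠ ℓ a ∧ ℓ x ≠ ℓ e' := by
  rw [h.active_iff]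
  have hu := h.corner.u
  have hw := h.w
  constructor
  · rintro ⟨h0, h1, h2, h3, h4, h5, h6⟩
    refine ⟨h0, fun hl => ?_, fun hl => ?_⟩
    · rcases hu.fiber x h0 hl with rfl | rfl | rfl <;> contradiction
    · rcases hw.fiber x h0 hl with rfl | rfl | rfl <;> contradiction
  · rintro ⟨h0, h1, h2⟩
    refine ⟨h0, ?_, ?_, ?_, ?_, ?_, ?_⟩ <;> rintro rfl
    · exact h1 rfl
    · exact h1 hu.eq_ac
    · exact h1 hu.eq_ab
    · exact h2 rfl
    · exact h2 hw.eq_ab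
    · exact h2 hw.eq_ac

end Cut

variable [DecidableEq D] [Finite D]

/-- Shrinking a triangle of K₄ to one vertex leaves three parallel edges to the fourth. This is not
a D3a reduction, but it is a legitimate truncation of maps. -/
theorem DartsOf.good_of_iso_completeGraph (h : DartsOf G α ℓ)
    (f : G ≃g SimpleGraph.completeGraph (Fin 4)) : Good α ℓ := by
  obtain ⟨p, q, r, v, pq, pr, pv, qr, qv, rv, hall, hadj⟩ := exists_adj_iff_of_iso_completeGraph f
  have hN : ∀ x y₁ y₂ y₃ : W, x ≠ y₁ → x ≠ y₂ → x ≠ y₃ → (∀ y, y = x ∨ y = y₁ ∨ y = y₂ ∨ y = y₃) →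
      ∀ y, G.Adj x y ↔ y = y₁ ∨ y = y₂ ∨ y = y₃ := by
    intro x y₁ y₂ y₃ h1 h2 h3 hx y
    rw [hadj]
    have := hx y
    grind
  obtain ⟨a, b, e, e', t, t', a', b', c, s, s', hT, la, la', le', lb', lc, ls'⟩ :=
    h.exists_truncation (p := p) (q := q) (r := r) (p' := v) (q' := v) (r' := v)
      (hN p q r v pq pr pv hall) (hN q p r v pq.symm qr qv fun y => by have := hall y; tauto)
      (hN r p q v pr.symm qr.symm rv fun y => by have := hall y; tauto)
      ⟨qv.symm, rv.symm⟩ ⟨pv.symm, rv.symm⟩ ⟨pv.symm, qv.symm⟩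
  have hb : α b' ≠ b' ∧ ℓ b' = v ∧ ℓ (α b') = p := by
    rw [← hT.corner.αb, h.inv, hT.corner.αb, hT.corner.u.eq_ac]
    exact ⟨hT.corner.αb ▸ hT.corner.u.act_c.symm, lb', la⟩
  have hs : α s' ≠ s' ∧ ℓ s' = v ∧ ℓ (α s') = r := by
    rw [← hT.αs, h.inv, hT.αs, hT.w.eq_ac]
    exact ⟨hT.αs ▸ hT.w.act_c.symm, ls', le'⟩
  have hc : α (α c) ≠ α c ∧ ℓ (α c) = v ∧ ℓ (α (α c)) = q := by
    rw [h.inv, hT.corner.z.eq_ac]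
    exact ⟨hT.corner.z.act_c.symm, lc, la'⟩
  have hy : DegThree α ℓ b' s' (α c) :=
    h.degThree (hN v p r q pv.symm rv.symm qv.symm fun y => by have := hall y; tauto) pr pq qr.symm hb hs hc
  have act := fun x => hT.active_iff_label (x := x)
  have hz := hT.corner.z
  obtain ⟨v1, -, v2, -⟩ := hT.cut_values
  have cc : smooth t s (cutα a b e e' α) c = α c := by
    have hd := hT.distinct
    simp only [List.nodup_cons, List.mem_cons, List.not_mem_nil, or_false, not_or] at hd
    rw [hT.cut_apply]
    have : ℓ c ≠ v := by rw [hz.eq_ac, la']; exact qv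
    have : ℓ b' = v := hb.2.1
    have : ℓ s' = v := hs.2.1
    grind
  rw [la, le'] at act
  refine hT.good (Dipole.good (x₁ := a') (x₂ := t') (x₃ := c) (y₁ := b') (y₂ := s') (y₃ := α c)
    ⟨hT.cut_inv, ⟨?_, ?_, ?_, hz.ne_ab, hz.ne_ac, hz.ne_bc, hz.eq_ab, hz.eq_ac, ?_⟩,
      ⟨?_, ?_, ?_, hy.ne_ab, hy.ne_ac, hy.ne_bc, hy.eq_ab, hy.eq_ac, ?_⟩, v1, v2, cc, ?_, ?_⟩)
  · rw [act, la']; exact ⟨hz.act_a, pq.symm, qr⟩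
  · rw [act, hz.eq_ab, la']; exact ⟨hz.act_b, pq.symm, qr⟩
  · rw [act, hz.eq_ac, la']; exact ⟨hz.act_c, pq.symm, qr⟩
  · exact fun x hx => hz.fiber x ((act x).1 hx).1
  · rw [act, hb.2.1]; exact ⟨hb.1, pv.symm, rv.symm⟩
  · rw [act, hs.2.1]; exact ⟨hs.1, pv.symm, rv.symm⟩
  · rw [act, hc.2.1]; exact ⟨hc.1, pv.symm, rv.symm⟩
  · exact fun x hx => hy.fiber x ((act x).1 hx).1
  · rw [la', lb']; exact qv
  · intro d hd
    obtain ⟨-, h1, h2⟩ := (act d).1 hd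
    have := hall (ℓ d)
    rw [la', lb']
    tauto

theorem good_of_stepA {p q r : W} (h : DartsOf G α ℓ) (hA : CanReduceA G p q r)
    (ih : ∀ (α' : Perm D) ℓ', DartsOf (reduceA G p q r) α' ℓ' → Good α' ℓ') : Good α ℓ := by
  classical
  obtain ⟨dp, dq, dr, pq, qr, pr, hpq, hqr, hpr⟩ := hA
  obtain ⟨p', p1, p2, hp⟩ := exists_third_of_ncard_eq_three dp pq pr qr.ne
  obtain ⟨q', q1, q2, hq⟩ := exists_third_of_ncard_eq_three dq pq.symm qr pr.ne
  obtain ⟨r', r1, r2, hr⟩ := exists_third_of_ncard_eq_three dr pr.symm qr.symm pq.ne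
  simp only [SimpleGraph.mem_neighborSet] at hp hq hr
  obtain ⟨a, b, e, e', t, t', a', b', c, s, s', hT, la, la', le', lb', lc, ls'⟩ :=
    h.exists_truncation hp hq hr ⟨p1, p2⟩ ⟨q1, q2⟩ ⟨r1, r2⟩
  have pp' : p' ≠ p := ((hp p').2 (by tauto)).ne'
  have qq' : q' ≠ q := ((hq q').2 (by tauto)).ne'
  have rr' : r' ≠ r := ((hr r').2 (by tauto)).ne'
  have npq : p' ≠ q' := fun hh => hpq p' p2 ⟨(hp _).2 (by tauto), (hq _).2 (by tauto)⟩
  have nqr : q' ≠ r' := fun hh => hqr q' q1 ⟨(hq _).2 (by tauto), (hr _).2 (by tauto)⟩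
  have npr : p' ≠ r' := fun hh => hpr p' p1 ⟨(hp _).2 (by tauto), (hr _).2 (by tauto)⟩
  have act := fun x => hT.active_iff_label (x := x)
  rw [la, le'] at act
  obtain ⟨v1, v2, v3, v4⟩ := hT.cut_values
  have hz := hT.corner.z
  have hcases := fun x => hT.cut_cases (x := x)
  have binv := hT.cut_inv
  have lt' : ℓ t' = q := hz.eq_ab.trans la'
  have llc : ℓ c = q := hz.eq_ac.trans la'
  have ab' : α b' ≠ b' := by
    rw [← hT.corner.αb, h.inv, hT.corner.αb]
    exact hT.corner.αb ▸ hT.corner.u.act_c.symm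
  have as' : α s' ≠ s' := by
    rw [← hT.αs, h.inv, hT.αs]
    exact hT.αs ▸ hT.w.act_c.symm
  have vc : smooth t s (cutα a b e e' α) c = α c := by
    rcases hcases c ((act c).2 ⟨hz.act_c, by rw [llc]; exact ⟨pq.ne', qr.ne⟩⟩) with hh | hh | hh | hh | hh
    · exact absurd hh hz.ne_ac.symm
    · exact absurd (hT.corner.ne_zb) (by rw [← hh, hz.eq_ac]; simp)
    · exact absurd hh hz.ne_bc.symm
    · exact absurd (hT.ne_zs) (by rw [← hh, hz.eq_ac]; simp)
    · exact hh.1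
  refine hT.good ?_
  generalize smooth t s (cutα a b e e' α) = β at *
  have bact : ∀ x, β x ≠ x → β (β x) ≠ β x := fun x hx => by rw [binv]; exact hx.symm
  have badj : ∀ x, β x ≠ x → (ℓ x = q ∧ ℓ (β x) = p') ∨ (ℓ x = p' ∧ ℓ (β x) = q) ∨
      (ℓ x = q ∧ ℓ (β x) = r') ∨ (ℓ x = r' ∧ ℓ (β x) = q) ∨ G.Adj (ℓ x) (ℓ (β x)) := by
    intro x hx
    rcases hcases x hx with rfl | rfl | rfl | rfl | ⟨g, -⟩
    · exact Or.inl ⟨la', by rw [v1, lb']⟩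
    · exact Or.inr (Or.inl ⟨lb', by rw [v2, la']⟩)
    · exact Or.inr (Or.inr (Or.inl ⟨lt', by rw [v3, ls']⟩))
    · exact Or.inr (Or.inr (Or.inr (Or.inl ⟨ls', by rw [v4, lt']⟩)))
    · rw [g]
      exact Or.inr (Or.inr (Or.inr (Or.inr (h.adj x ((act x).1 hx).1))))
  -- Distinctness of the outside neighbours enters here: the new edges qp' and qr' are parallel
  -- neither to each other nor to an old edge.
  have hinj : ∀ x y, β x ≠ x → β y ≠ y → ℓ x = ℓ y → ℓ (β x) = ℓ (β y) → x = y := by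
    have n1 : ¬ G.Adj q p' := fun hh => hpq p' p2 ⟨(hp _).2 (by tauto), hh⟩
    have n2 : ¬ G.Adj q r' := fun hh => hqr r' r1 ⟨hh, (hr _).2 (by tauto)⟩
    have n3 : ¬ G.Adj p' q := fun hh => n1 hh.symm
    have n4 : ¬ G.Adj r' q := fun hh => n2 hh.symm
    intro x y hx hy hxy hxy'
    have adx := h.adj x ((act x).1 hx).1
    have ady := h.adj y ((act y).1 hy).1
    have key := h.inj x y ((act x).1 hx).1 ((act y).1 hy).1 hxy
    have h1 := hcases x hx
    have h2 := hcases y hy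
    clear hcases badj bact act binv hp hq hr hpq hqr hpr ih
    grind
  -- The live darts at q become those of the new vertex; the darts at p and r are all dead.
  let ℓ' : D → Option {v : W // v ≠ p ∧ v ≠ q ∧ v ≠ r} := fun d =>
    if hd : ℓ d ≠ p ∧ ℓ d ≠ q ∧ ℓ d ≠ r then some ⟨ℓ d, hd⟩ else none
  have lN : ∀ d, ℓ d = q → ℓ' d = none := fun d hd => dif_neg (by tauto)
  have lS : ∀ d (hd : ℓ d ≠ p ∧ ℓ d ≠ q ∧ ℓ d ≠ r), ℓ' d = some ⟨ℓ d, hd⟩ := fun d hd => dif_pos hd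
  clear_value ℓ'
  have lE : ∀ x y, β x ≠ x → β y ≠ y → (ℓ' x = ℓ' y ↔ ℓ x = ℓ y) := by
    intro x y hx hy
    obtain ⟨-, x1, x2⟩ := (act x).1 hx
    obtain ⟨-, y1, y2⟩ := (act y).1 hy
    by_cases x3 : ℓ x = q <;> by_cases y3 : ℓ y = q
    · rw [lN x x3, lN y y3, x3, y3]; simp
    · rw [lN x x3, lS y ⟨y1, y3, y2⟩, x3]; simp [Ne.symm y3]
    · rw [lN y y3, lS x ⟨x1, x3, x2⟩, y3]; simp [x3]
    · rw [lS x ⟨x1, x3, x2⟩, lS y ⟨y1, y3, y2⟩]; simp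
  have ba' : β a' ≠ a' := (act a').2 ⟨hz.act_a, by rw [la']; exact ⟨pq.ne', qr.ne⟩⟩
  have bt' : β t' ≠ t' := (act t').2 ⟨hz.act_b, by rw [lt']; exact ⟨pq.ne', qr.ne⟩⟩
  have bc : β c ≠ c := (act c).2 ⟨hz.act_c, by rw [llc]; exact ⟨pq.ne', qr.ne⟩⟩
  have hnone : ∀ y : {v : W // v ≠ p ∧ v ≠ q ∧ v ≠ r}, G.Adj p y ∨ G.Adj q y ∨ G.Adj r y →
      ∃ d, β d ≠ d ∧ ℓ' d = none ∧ ℓ' (β d) = some y := by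
    rintro ⟨y, hy⟩ (hyy | hyy | hyy)
    · have : y = p' := by have := (hp y).1 hyy; tauto
      subst this
      exact ⟨a', ba', lN _ la', by rw [v1, lS b' (by rw [lb']; exact hy)]; simp only [lb']⟩
    · have : y = q' := by have := (hq y).1 hyy; tauto
      subst this
      exact ⟨c, bc, lN _ llc, by rw [vc, lS (α c) (by rw [lc]; exact hy)]; simp only [lc]⟩
    · have : y = r' := by have := (hr y).1 hyy; tauto
      subst this
      exact ⟨t', bt', lN _ lt', by rw [v3, lS s' (by rw [ls']; exact hy)]; simp only [ls']⟩
  refine (ih β ℓ' ⟨binv, ?_, ?_, fun x y hx hy h1 h2 => hinj x y hx hy ((lE x y hx hy).1 h1)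
    ((lE _ _ (bact x hx) (bact y hy)).1 h2)⟩).congr binv lE
  · intro x hx
    obtain ⟨-, x1, x2⟩ := (act x).1 hx
    obtain ⟨-, y1, y2⟩ := (act _).1 (bact x hx)
    have hxx := badj x hx
    by_cases x3 : ℓ x = q <;> by_cases y3 : ℓ (β x) = q
    · rw [x3, y3] at hxx
      rcases hxx with hh | hh | hh | hh | hh
      · exact absurd hh.2.symm p1
      · exact absurd hh.1.symm p1
      · exact absurd hh.2.symm r2
      · exact absurd hh.1.symm r2
      · exact absurd hh (G.irrefl)
    · rw [lN x x3, lS _ ⟨y1, y3, y2⟩]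
      change G.Adj p (ℓ (β x)) ∨ G.Adj q (ℓ (β x)) ∨ G.Adj r (ℓ (β x))
      rcases hxx with hh | hh | hh | hh | hh
      · exact Or.inl ((hp _).2 (by tauto))
      · exact absurd hh.2 y3
      · exact Or.inr (Or.inr ((hr _).2 (by tauto)))
      · exact absurd hh.2 y3
      · exact Or.inr (Or.inl (x3 ▸ hh))
    · rw [lN _ y3, lS _ ⟨x1, x3, x2⟩]
      change G.Adj p (ℓ x) ∨ G.Adj q (ℓ x) ∨ G.Adj r (ℓ x)
      rcases hxx with hh | hh | hh | hh | hh
      · exact absurd hh.1 x3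
      · exact Or.inl ((hp _).2 (by tauto))
      · exact absurd hh.1 x3
      · exact Or.inr (Or.inr ((hr _).2 (by tauto)))
      · exact Or.inr (Or.inl (y3 ▸ hh.symm))
    · rw [lS _ ⟨y1, y3, y2⟩, lS _ ⟨x1, x3, x2⟩]
      change G.Adj (ℓ x) (ℓ (β x))
      tauto
  · rintro (_ | x) (_ | y) hxy
    · exact absurd hxy not_false
    · exact hnone y hxy
    · obtain ⟨d, h1, h2, h3⟩ := hnone x hxy
      exact ⟨β d, bact d h1, h3, by rw [binv, h2]⟩
    · obtain ⟨d, h1, h2, h3⟩ := h.surj x y hxy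
      obtain ⟨x1, x2, x3⟩ := x.2
      obtain ⟨y1, y2, y3⟩ := y.2
      have hd : β d ≠ d := (act d).2 ⟨h1, by rw [h2]; exact ⟨x1, x3⟩⟩
      have hd' : β d = α d := by
        rcases hcases d hd with rfl | rfl | rfl | rfl | hh
        · exact absurd (h2.symm.trans la') x2
        · rw [← hT.corner.αb, h.inv, hT.corner.u.eq_ac, la] at h3
          exact absurd h3.symm y1
        · exact absurd (h2.symm.trans lt') x2
        · rw [← hT.αs, h.inv, hT.w.eq_ac, le'] at h3
          exact absurd h3.symm y3
        · exact hh.1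
      refine ⟨d, hd, ?_, ?_⟩
      · rw [lS d (by rw [h2]; exact x.2)]
        simp only [h2]
      · rw [hd', lS (α d) (by rw [h3]; exact y.2)]
        simp only [h3]

end DartsOf

/-! ### D3b reductions and the induction -/

section StepB

variable {D : Type*} {W : Type u} {G : SimpleGraph W} {α : Perm D} {ℓ : D → W}

/-- The edge qs lies in the triangles qsp and qsr, hence the two corners, at p and at r. -/
theorem DartsOf.exists_corners (h : DartsOf G α ℓ) {p q r s p' r' : W}
    (hp : ∀ x, G.Adj p x ↔ x = q ∨ x = s ∨ x = p') (hq : ∀ x, G.Adj q x ↔ x = p ∨ x = r ∨ x = s)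
    (hr : ∀ x, G.Adj r x ↔ x = q ∨ x = s ∨ x = r') (hp' : p' ≠ q ∧ p' ≠ s) (hr' : r' ≠ q ∧ r' ≠ s)
    (hpr : p ≠ r) :
    ∃ a b e e' t t' a' b' c t₂ t₂' c₂, Corner α ℓ a b e e' t t' a' b' c ∧
      Corner α ℓ b a e e' t₂ t₂' b' a' c₂ ∧ ℓ a = q ∧ ℓ a' = p ∧ ℓ b' = r ∧ ℓ e' = s := by
  obtain ⟨a, ha⟩ := h.surj q p ((hq _).2 (by tauto))
  obtain ⟨b, hb⟩ := h.surj q r ((hq _).2 (by tauto))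
  obtain ⟨e, he⟩ := h.surj q s ((hq _).2 (by tauto))
  obtain ⟨t, ht⟩ := h.surj s p ((hp _).2 (by tauto)).symm
  obtain ⟨t₂, ht₂⟩ := h.surj s r ((hr _).2 (by tauto)).symm
  obtain ⟨c, hc⟩ := h.surj p p' ((hp _).2 (by tauto))
  obtain ⟨c₂, hc₂⟩ := h.surj r r' ((hr _).2 (by tauto))
  have qp : q ≠ p := ((hq p).2 (by tauto)).ne
  have qr : q ≠ r := ((hq r).2 (by tauto)).ne
  have qs : q ≠ s := ((hq s).2 (by tauto)).ne
  have ps : p ≠ s := ((hp s).2 (by tauto)).ne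
  have rs : r ≠ s := ((hr s).2 (by tauto)).ne
  have la' := h.rev ha
  have lb' := h.rev hb
  have lt' := h.rev ht
  have lt₂' := h.rev ht₂
  refine ⟨a, b, e, α e, t, α t, α a, α b, c, t₂, α t₂, c₂,
    ⟨h.inv, ?_, ?_, rfl, rfl, rfl, rfl, ?_, ?_, ?_, ?_, ?_, ?_, ?_⟩,
    ⟨h.inv, ?_, ?_, rfl, rfl, rfl, rfl, ?_, ?_, ?_, ?_, ?_, ?_, ?_⟩, ha.2.1, ha.2.2, hb.2.2, he.2.2⟩
  · exact h.degThree (fun x => (hq x).trans (by tauto)) ps hpr rs.symm ha he hb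
  · exact h.degThree hp qs hp'.1.symm hp'.2.symm la' lt' hc
  · rw [ht.2.1, he.2.2]
  · rw [ha.2.2, ha.2.1]; exact qp.symm
  · rw [he.2.2, ha.2.1]; exact qs.symm
  · rw [he.2.2, ha.2.2]; exact ps.symm
  · rw [hb.2.2, ha.2.1]; exact qr.symm
  · rw [hb.2.2, ha.2.2]; exact hpr.symm
  · rw [hb.2.2, he.2.2]; exact rs
  · exact h.degThree (fun x => (hq x).trans (by tauto)) rs hpr.symm ps.symm hb he ha
  · exact h.degThree hr qs hr'.1.symm hr'.2.symm lb' lt₂' hc₂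
  · rw [ht₂.2.1, he.2.2]
  · rw [hb.2.2, hb.2.1]; exact qr.symm
  · rw [he.2.2, hb.2.1]; exact qs.symm
  · rw [he.2.2, hb.2.2]; exact rs.symm
  · rw [ha.2.2, hb.2.1]; exact qp.symm
  · rw [ha.2.2, hb.2.2]; exact hpr
  · rw [ha.2.2, he.2.2]; exact ps

variable [DecidableEq D] [Finite D]

theorem good_of_stepB {p q r s : W} (h : DartsOf G α ℓ) (hB : CanReduceB G p q r s)
    (ih : ∀ (α' : Perm D) ℓ', DartsOf (reduceB G p q r) α' ℓ' → Good α' ℓ') : Good α ℓ := by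
  classical
  obtain ⟨dp, dq, dr, npr, pq, qr, hpr, ps, qs, rs⟩ := hB
  obtain ⟨p', p1, p2, hp⟩ := exists_third_of_ncard_eq_three dp pq ps qs.ne
  obtain ⟨r', r1, r2, hr⟩ := exists_third_of_ncard_eq_three dr qr.symm rs qs.ne
  have hq : ∀ x, G.Adj q x ↔ x = p ∨ x = r ∨ x = s := fun x =>
    ⟨fun hx => eq_or_of_ncard_eq_three dq (x := p) (y := r) (z := s) pq.symm qr qs npr ps.ne rs.ne hx, by
      rintro (rfl | rfl | rfl)
      · exact pq.symm
      · exact qr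
      · exact qs⟩
  simp only [SimpleGraph.mem_neighborSet] at hp hr
  obtain ⟨a, b, e, e', t, t', a', b', c, t₂, t₂', c₂, hC, hC₂, la, la', lb', le'⟩ :=
    h.exists_corners hp hq hr ⟨p1, p2⟩ ⟨r1, r2⟩ npr
  refine hC.good hC₂ ?_
  have act : ∀ x, cutα a b e e' α x ≠ x ↔ α x ≠ x ∧ ℓ x ≠ q ∧ ℓ (α x) ≠ q ∨ x = a' ∨ x = b' := by
    intro x
    rw [hC.active_iff]
    have hu := hC.u
    have hd := hC.distinct
    simp only [List.nodup_cons, List.mem_cons, List.not_mem_nil, or_false, not_or] at hd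
    have inv := h.inv
    have αa := hC.αa
    have αb := hC.αb
    have αe := hC.αe
    have : ℓ e = q := hu.eq_ab.trans la
    have : ℓ b = q := hu.eq_ac.trans la
    have fib := hu.fiber x
    have fib' := hu.fiber (α x)
    have := hC.u.act_a
    have := hC.u.act_c
    have := inv x; have := inv a; have := inv b; have := inv e
    clear inv hq hr hp ih hC hC₂ hu
    grind
  have hd := hC.distinct
  simp only [List.nodup_cons, List.mem_cons, List.not_mem_nil, or_false, not_or] at hd
  have v1 : cutα a b e e' α a' = b' := by rw [hC.cutα_apply]; grind
  have v2 : cutα a b e e' α b' = a' := by rw [hC.cutα_apply]; grind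
  have v3 : ∀ x, α x ≠ x ∧ ℓ x ≠ q ∧ ℓ (α x) ≠ q → cutα a b e e' α x = α x := by
    intro x hx
    have : ℓ e = q := hC.u.eq_ab.trans la
    have : ℓ b = q := hC.u.eq_ac.trans la
    have : α e' = e := by rw [← hC.αe, h.inv]
    have : α a' = a := by rw [← hC.αa, h.inv]
    have : α b' = b := by rw [← hC.αb, h.inv]
    rw [hC.cutα_apply]
    clear v1 v2 act ih hp hq hr hC hC₂
    grind
  have binv := hC.cutα_inv
  generalize cutα a b e e' α = β at *
  have qp := pq.ne
  have rq := qr.ne'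
  have bact : ∀ x, β x ≠ x → β (β x) ≠ β x := fun x hx => by rw [binv]; exact hx.symm
  have hcases : ∀ x, β x ≠ x → (ℓ x ≠ q ∧ ℓ (β x) ≠ q) ∧ ((β x = α x ∧ α x ≠ x ∧ G.Adj (ℓ x) (ℓ (β x))) ∨
      (x = a' ∧ ℓ x = p ∧ ℓ (β x) = r) ∨ (x = b' ∧ ℓ x = r ∧ ℓ (β x) = p)) := by
    intro x hx
    rcases (act x).1 hx with hh | rfl | rfl
    · rw [v3 x hh]
      exact ⟨hh.2, Or.inl ⟨rfl, hh.1, h.adj x hh.1⟩⟩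
    · rw [v1, la', lb']
      exact ⟨⟨qp, rq⟩, Or.inr (Or.inl ⟨rfl, rfl, rfl⟩)⟩
    · rw [v2, la', lb']
      exact ⟨⟨rq, qp⟩, Or.inr (Or.inr ⟨rfl, rfl, rfl⟩)⟩
  -- The new edge pr is not parallel to an old one, because p and r are not adjacent.
  have hinj : ∀ x y, β x ≠ x → β y ≠ y → ℓ x = ℓ y → ℓ (β x) = ℓ (β y) → x = y := by
    have n' : ¬ G.Adj r p := fun hh => hpr hh.symm
    intro x y hx hy hxy hxy'
    obtain ⟨-, h1⟩ := hcases x hx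
    obtain ⟨-, h2⟩ := hcases y hy
    have key := h.inj x y
    clear hcases act bact binv hp hq hr v3 ih
    grind
  -- The value p is a dummy for dead darts: no live dart leaves q.
  let ℓ' : D → {v : W // v ≠ q} := fun d => if hd : ℓ d ≠ q then ⟨ℓ d, hd⟩ else ⟨p, qp⟩
  have lS : ∀ d, ℓ d ≠ q → (ℓ' d : W) = ℓ d := fun d hd => by
    simp only [ℓ', dif_pos hd]
  clear_value ℓ'
  have lE : ∀ x y, β x ≠ x → β y ≠ y → (ℓ' x = ℓ' y ↔ ℓ x = ℓ y) := by
    intro x y hx hy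
    rw [Subtype.ext_iff, lS x (hcases x hx).1.1, lS y (hcases y hy).1.1]
  refine (ih β ℓ' ⟨binv, ?_, ?_, fun x y hx hy h1 h2 => hinj x y hx hy ((lE x y hx hy).1 h1)
    ((lE _ _ (bact x hx) (bact y hy)).1 h2)⟩).congr binv lE
  · intro x hx
    obtain ⟨⟨h1, h2⟩, h3⟩ := hcases x hx
    change G.Adj (ℓ' x) (ℓ' (β x)) ∨ _
    rw [lS x h1, lS _ h2]
    rcases h3 with h3 | h3 | h3
    · exact Or.inl h3.2.2
    · exact Or.inr ⟨by rw [h3.2.1, h3.2.2]; exact npr, Or.inl h3.2⟩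
    · exact Or.inr ⟨by rw [h3.2.1, h3.2.2]; exact npr.symm, Or.inr h3.2⟩
  · rintro ⟨x, hx⟩ ⟨y, hy⟩ (hxy | ⟨-, hh⟩)
    · obtain ⟨d, h1, h2, h3⟩ := h.surj x y hxy
      have hd : α d ≠ d ∧ ℓ d ≠ q ∧ ℓ (α d) ≠ q := ⟨h1, by rwa [h2], by rwa [h3]⟩
      refine ⟨d, (act d).2 (Or.inl hd), Subtype.ext ?_, Subtype.ext ?_⟩
      · rw [lS d hd.2.1, h2]
      · rw [v3 d hd, lS _ hd.2.2, h3]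
    · rcases hh with ⟨h1, h2⟩ | ⟨h1, h2⟩
      · refine ⟨a', (act a').2 (by tauto), Subtype.ext ?_, Subtype.ext ?_⟩
        · rw [lS a' (by rwa [la']), la']; exact h1.symm
        · rw [v1, lS b' (by rwa [lb']), lb']; exact h2.symm
      · refine ⟨b', (act b').2 (by tauto), Subtype.ext ?_, Subtype.ext ?_⟩
        · rw [lS b' (by rwa [lb']), lb']; exact h1.symm
        · rw [v2, lS a' (by rwa [la']), la']; exact h2.symm

/-- The dart type stays fixed while graph, vertex labels and edge involution vary, so the induction
hypothesis must hold for all of these. -/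
theorem Reducible.good (hG : Reducible G) (h : DartsOf G α ℓ) : Good α ℓ := by
  induction hG generalizing α with
  | completeFour G f => exact h.good_of_iso_completeGraph f.some
  | stepA G p q r hA _ ih => exact good_of_stepA h hA fun α' ℓ' h' => ih h'
  | stepB G p q r s hB _ ih => exact good_of_stepB h hB fun α' ℓ' h' => ih h'

end StepB

/-! ### Connectedness and minimum degree -/

section Connected

variable {W : Type u} {G : SimpleGraph W}

theorem connected_of_forall_reachable {W' : Type u} {H : SimpleGraph W'} (hH : H.Connected) (f : W' → W)
    (hadj : ∀ x y, H.Adj x y → G.Reachable (f x) (f y)) (hsurj : ∀ v, ∃ x, G.Reachable v (f x)) :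
    G.Connected := by
  have key : ∀ x y, H.Reachable x y → G.Reachable (f x) (f y) := by
    rintro x y ⟨w⟩
    induction w with
    | nil => exact .refl _
    | cons h _ ih => exact (hadj _ _ h).trans ih
  have : Nonempty W := hH.nonempty.map f
  refine ⟨fun v w => ?_⟩
  obtain ⟨x, hx⟩ := hsurj v
  obtain ⟨y, hy⟩ := hsurj w
  exact hx.trans ((key x y (hH.preconnected x y)).trans hy.symm)

theorem Reducible.connected (hG : Reducible G) : G.Connected := by
  induction hG with
  | completeFour G f =>
    obtain ⟨f⟩ := f
    exact f.connected_iff.2 SimpleGraph.connected_top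
  | stepA G p q r hA _ ih =>
    have hq : G.Reachable p q := hA.adj_pq.reachable
    have hr : G.Reachable p r := hA.adj_pr.reachable
    refine connected_of_forall_reachable ih (fun x => x.elim p Subtype.val) ?_ fun v => ?_
    · have key : ∀ y, G.Adj p y ∨ G.Adj q y ∨ G.Adj r y → G.Reachable p y := by
        rintro y (h | h | h)
        · exact h.reachable
        · exact hq.trans h.reachable
        · exact hr.trans h.reachable
      rintro (_ | x) (_ | y) h
      · exact .refl _
      · exact key y h
      · exact (key x h).symm
      · exact SimpleGraph.Adj.reachable h
    · by_cases hv : v ≠ p ∧ v ≠ q ∧ v ≠ r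
      · exact ⟨some ⟨v, hv⟩, .refl _⟩
      · refine ⟨none, ?_⟩
        have : v = p ∨ v = q ∨ v = r := by tauto
        rcases this with rfl | rfl | rfl
        · exact .refl _
        · exact hq.symm
        · exact hr.symm
  | stepB G p q r s hB _ ih =>
    have hpr : G.Reachable p r := hB.adj_pq.reachable.trans hB.adj_qr.reachable
    refine connected_of_forall_reachable ih Subtype.val ?_ fun v => ?_
    · rintro ⟨x, hx⟩ ⟨y, hy⟩ (h | ⟨-, ⟨h1, h2⟩ | ⟨h1, h2⟩⟩)
      · exact h.reachable
      · exact h1 ▸ h2 ▸ hpr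
      · exact h1 ▸ h2 ▸ hpr.symm
    · by_cases hv : v = q
      · exact ⟨⟨p, hB.adj_pq.ne⟩, hv ▸ hB.adj_pq.reachable.symm⟩
      · exact ⟨⟨v, hv⟩, .refl _⟩

/-- One neighbour ensures that the cycles of the rotation count all vertices; the second ensures
that the rotation fixes no dart. -/
theorem Reducible.exists_two_adj (hG : Reducible G) (v : W) : ∃ x y, G.Adj v x ∧ G.Adj v y ∧ x ≠ y := by
  induction hG with
  | completeFour G f =>
    obtain ⟨p, q, r, w, pq, pr, pw, qr, qw, rw', hall, hadj⟩ := exists_adj_iff_of_iso_completeGraph f.some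
    simp only [hadj]
    by_cases h1 : v = p
    · exact ⟨q, r, h1 ▸ pq, h1 ▸ pr, qr⟩
    · by_cases h2 : v = q
      · exact ⟨p, r, h1, h2 ▸ qr, pr⟩
      · exact ⟨p, q, h1, h2, pq⟩
  | stepA G p q r hA _ ih =>
    by_cases hv : v ≠ p ∧ v ≠ q ∧ v ≠ r
    · obtain ⟨x, y, hx, hy, hxy⟩ := ih (some ⟨v, hv⟩)
      have key : G.Adj p v ∨ G.Adj q v ∨ G.Adj r v → ∃ z, G.Adj v z ∧ (z = p ∨ z = q ∨ z = r) := by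
        rintro (h | h | h)
        · exact ⟨p, h.symm, by tauto⟩
        · exact ⟨q, h.symm, by tauto⟩
        · exact ⟨r, h.symm, by tauto⟩
      rcases x with _ | ⟨x, x'⟩ <;> rcases y with _ | ⟨y, y'⟩
      · exact absurd rfl hxy
      · obtain ⟨z, hz, hz'⟩ := key hx
        exact ⟨z, y, hz, hy, by rintro rfl; tauto⟩
      · obtain ⟨z, hz, hz'⟩ := key hy
        exact ⟨z, x, hz, hx, by rintro rfl; tauto⟩
      · exact ⟨x, y, hx, hy, by rintro rfl; exact hxy rfl⟩
    · have : v = p ∨ v = q ∨ v = r := by tauto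
      rcases this with rfl | rfl | rfl
      · exact ⟨q, r, hA.adj_pq, hA.adj_pr, hA.adj_qr.ne⟩
      · exact ⟨p, r, hA.adj_pq.symm, hA.adj_qr, hA.adj_pr.ne⟩
      · exact ⟨p, q, hA.adj_pr.symm, hA.adj_qr.symm, hA.adj_pq.ne⟩
  | stepB G p q r s hB _ ih =>
    by_cases h1 : v = q
    · exact ⟨p, r, h1 ▸ hB.adj_pq.symm, h1 ▸ hB.adj_qr, hB.ne_pr⟩
    by_cases h2 : v = p
    · exact ⟨q, s, h2 ▸ hB.adj_pq, h2 ▸ hB.adj_ps, hB.adj_qs.ne⟩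
    by_cases h3 : v = r
    · exact ⟨q, s, h3 ▸ hB.adj_qr.symm, h3 ▸ hB.adj_rs, hB.adj_qs.ne⟩
    obtain ⟨⟨x, x'⟩, ⟨y, y'⟩, hx, hy, hxy⟩ := ih ⟨v, h1⟩
    have key : ∀ z, (reduceB G p q r).Adj ⟨v, h1⟩ z → G.Adj v z := by
      rintro z (h | ⟨-, ⟨h, -⟩ | ⟨h, -⟩⟩)
      · exact h
      · exact absurd h h2
      · exact absurd h h3
    exact ⟨x, y, key _ hx, key _ hy, fun hh => hxy (Subtype.ext hh)⟩

end Connected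

/-! ### Rotation systems as maps, and the treewidth of the dual -/

section Rotation

variable {V : Type u} {G : SimpleGraph V}

/-- The reversal of the darts of a graph. -/
def rev (G : SimpleGraph V) : Perm G.Dart := (SimpleGraph.Dart.symm_involutive (G := G)).toPerm

theorem rev_ne (d : G.Dart) : rev G d ≠ d := d.symm_ne

theorem dartsOf_rev : DartsOf G (rev G) (fun d => d.fst) where
  inv d := d.symm_symm
  adj d _ := d.adj
  surj x y h := ⟨⟨(x, y), h⟩, rev_ne _, rfl, rfl⟩
  inj d e _ _ h1 h2 := SimpleGraph.Dart.ext d e (Prod.ext h1 h2)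

theorem finite_dart [Finite V] : Finite G.Dart :=
  Finite.of_injective (fun d : G.Dart => d.toProd) fun _ _ h => SimpleGraph.Dart.ext _ _ h

namespace RotationSystem

theorem fst_eq_of_sameCycle [Finite V] (R : RotationSystem G) {x y : G.Dart} (h : R.next.SameCycle x y) :
    x.fst = y.fst := by
  have := finite_dart (G := G)
  have key : ∀ z, x.fst = z.fst → x.fst = (R.next z).fst := fun z hz => hz.trans (R.next_fst z).symm
  exact mem_of_sameCycle (S := {z : G.Dart | x.fst = z.fst}) key h (Eq.refl x.fst)

theorem isRot [Finite V] (R : RotationSystem G) : IsRot (rev G) (fun d : G.Dart => d.fst) R.next where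
  fix d h := absurd h (rev_ne d)
  vert x y _ _ := ⟨R.sameCycle x y, R.fst_eq_of_sameCycle⟩

/-- The rotation system given by a rotation of the darts. -/
def ofIsRot {σ : Perm G.Dart} (h : IsRot (rev G) (fun d : G.Dart => d.fst) σ) : RotationSystem G where
  next := σ
  next_fst _ := h.label (rev_ne _)
  sameCycle x y := (h.vert x y (rev_ne x) (rev_ne y)).1

theorem finite_face [Finite V] (R : RotationSystem G) : Finite R.Face :=
  have := finite_dart (G := G)
  inferInstanceAs (Finite (Quotient (SameCycle.setoid R.faceNext)))

/-- An isolated vertex has no dart and would be missed by the cycle count, hence the condition on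
neighbours. -/
theorem euler_eq [Finite V] (R : RotationSystem G) (hG : ∀ v, ∃ w, G.Adj v w) : euler (rev G) R.next =
    (Nat.card V : ℤ) - (Nat.card G.edgeSet : ℤ) + (Nat.card R.Face : ℤ) := by
  classical
  have := finite_dart (G := G)
  have h1 : cyc R.next = Nat.card V := by
    refine Nat.card_congr (Equiv.ofBijective (Quotient.lift (fun d : G.Dart => d.fst) fun x y h =>
      (R.isRot.vert x y (rev_ne x) (rev_ne y)).2 h) ⟨?_, fun v => ?_⟩)
    · rintro ⟨x⟩ ⟨y⟩ h
      exact Quotient.sound (R.sameCycle x y h)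
    · obtain ⟨w, hw⟩ := hG v
      exact ⟨Quotient.mk _ ⟨(v, w), hw⟩, rfl⟩
  have key : ∀ x y : G.Dart, (rev G).SameCycle x y ↔ x.edge = y.edge := fun x y => by
    rw [sameCycle_of_sq_eq_one dartsOf_rev.inv, SimpleGraph.dart_edge_eq_iff]
    constructor
    · rintro (rfl | rfl)
      · exact Or.inl rfl
      · exact Or.inr x.symm_symm.symm
    · rintro (rfl | rfl)
      · exact Or.inl rfl
      · exact Or.inr y.symm_symm.symm
  have h2 : cyc (rev G) = Nat.card G.edgeSet := by
    refine Nat.card_congr (Equiv.ofBijective (Quotient.lift (fun d : G.Dart => (⟨d.edge, d.edge_mem⟩ : G.edgeSet))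
      fun x y h => Subtype.ext ((key x y).1 h)) ⟨?_, ?_⟩)
    · rintro ⟨x⟩ ⟨y⟩ h
      exact Quotient.sound ((key x y).2 (congrArg Subtype.val h))
    · rintro ⟨e, he⟩
      induction e with
      | h v w => exact ⟨Quotient.mk _ ⟨(v, w), he⟩, rfl⟩
  have h3 : Nat.card G.Dart = 2 * Nat.card G.edgeSet := by
    have := Fintype.ofFinite V
    rw [Nat.card_eq_fintype_card, G.dart_card_eq_twice_card_edges, ← SimpleGraph.coe_edgeFinset,
      Nat.card_coe_set_eq, Set.ncard_coe_finset]
  have h4 : cyc (R.next * rev G) = Nat.card R.Face := rfl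
  rw [euler, h1, h2, h3, h4]
  push_cast
  ring

end RotationSystem

variable {R : RotationSystem G} {κ : G.Dart → ℕ}

/-- The labels of the faces. -/
def faceLabel (hκ : IsFaceLabel (rev G) R.next κ) : R.Face → ℕ :=
  Quotient.lift κ fun x y h => (hκ x y (rev_ne x) (rev_ne y)).2 h

theorem exists_faceOf (F : R.Face) : ∃ d, R.faceOf d = F := Quotient.exists_rep F

theorem faceOf_eq_iff (hκ : IsFaceLabel (rev G) R.next κ) (d e : G.Dart) :
    R.faceOf d = R.faceOf e ↔ κ d = κ e :=
  Quotient.eq.trans (hκ d e (rev_ne d) (rev_ne e)).symm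

theorem faceLabel_injective (hκ : IsFaceLabel (rev G) R.next κ) :
    Function.Injective (faceLabel hκ) := fun E F h => by
  obtain ⟨d, rfl⟩ := exists_faceOf E
  obtain ⟨e, rfl⟩ := exists_faceOf F
  exact (faceOf_eq_iff hκ d e).2 h

/-- Bags of labels are pulled back along the injective labelling of faces, which cannot enlarge
them. -/
theorem hasTreeDecompositionOfWidth_dual (hκ : IsFaceLabel (rev G) R.next κ)
    (h : HasDualDecomposition (rev G) R.next κ) : HasTreeDecompositionOfWidth R.dual 3 := by
  obtain ⟨ι, hι, T, bag, hT, hcard, hedge, -, hconn⟩ := h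
  have hmem : ∀ i F, F ∈ (bag i).preimage (faceLabel hκ) (faceLabel_injective hκ).injOn ↔
      faceLabel hκ F ∈ bag i := fun i F => Finset.mem_preimage
  refine ⟨ι, hι, ⟨T, hT, fun i => (bag i).preimage (faceLabel hκ) (faceLabel_injective hκ).injOn, ?_, ?_⟩,
    fun i => ?_⟩
  · rintro _ _ ⟨-, d, rfl, rfl⟩
    obtain ⟨i, h1, h2⟩ := hedge d (rev_ne d)
    exact ⟨i, (hmem _ _).2 h1, (hmem _ _).2 h2⟩
  · intro F
    obtain ⟨d, rfl⟩ := exists_faceOf F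
    have hset : {i | R.faceOf d ∈ (bag i).preimage (faceLabel hκ) (faceLabel_injective hκ).injOn} =
        {i | κ d ∈ bag i} := Set.ext fun i => hmem i _
    rw [hset]
    exact hconn d (rev_ne d)
  · refine le_trans ?_ (hcard i)
    exact Finset.card_le_card_of_injOn (faceLabel hκ) (fun F hF => (hmem _ _).1 hF)
      (faceLabel_injective hκ).injOn

/-- Three consecutive darts of a face are distinct, and tightness makes the faces across them
distinct from each other and from the given face. -/
theorem exists_three_adj_dual (hκ : IsFaceLabel (rev G) R.next κ)
    (ht : Tight (rev G) (fun d : G.Dart => d.fst) κ) (hnext : ∀ d, R.next d ≠ d) (F : R.Face) :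
    ∃ E₁ E₂ E₃, R.dual.Adj F E₁ ∧ R.dual.Adj F E₂ ∧ R.dual.Adj F E₃ ∧ E₁ ≠ E₂ ∧ E₁ ≠ E₃ ∧ E₂ ≠ E₃ := by
  obtain ⟨d, rfl⟩ := exists_faceOf F
  have hφ : ∀ x : G.Dart, R.faceOf (R.faceNext x) = R.faceOf x := fun x =>
    Quotient.sound (sameCycle_apply _ x).symm
  have hfst : ∀ x : G.Dart, (R.faceNext x).fst = x.snd := fun x => R.next_fst _
  -- If both sides of x were one face, the dart following x and the reversal of x would leave the
  -- same vertex on that face, hence agree, and the rotation would fix a dart.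
  have hne : ∀ x : G.Dart, R.faceOf x ≠ R.faceOf x.symm := fun x hx => by
    have h1 : R.faceNext x = x.symm := ht.inj _ _ (rev_ne _) (rev_ne _) (hfst x)
      ((faceOf_eq_iff hκ _ _).1 ((hφ x).trans hx))
    exact hnext _ h1
  -- If x and y bordered the same pair of faces, tightness would make both ends of y ends of x. As G
  -- is simple, y is x or its reversal, and the latter is excluded by `hne`.
  have hdist : ∀ x y : G.Dart, R.faceOf x = R.faceOf y → x ≠ y → R.faceOf x.symm ≠ R.faceOf y.symm := by
    intro x y hxy hne' hh
    have k1 := (faceOf_eq_iff hκ _ _).1 hxy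
    have k2 := (faceOf_eq_iff hκ _ _).1 hh
    have h1 : y.fst = x.fst ∨ y.fst = x.snd :=
      ht.edge x y (R.faceNext y.symm) (rev_ne _) (rev_ne _) (rev_ne _) k1
        (k2.trans ((faceOf_eq_iff hκ _ _).1 (hφ y.symm).symm)) (hfst y.symm).symm
    have h2 : y.snd = x.fst ∨ y.snd = x.snd := by
      have := ht.edge x (R.faceNext y) y.symm (rev_ne _) (rev_ne _) (rev_ne _)
        (k1.trans ((faceOf_eq_iff hκ _ _).1 (hφ y).symm)) k2 (hfst y)
      rwa [hfst y] at this
    have h3 := y.adj.ne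
    rcases h1 with h1 | h1 <;> rcases h2 with h2 | h2
    · exact h3 (h1.trans h2.symm)
    · exact hne' (SimpleGraph.Dart.ext _ _ (Prod.ext h1.symm h2.symm))
    · have : y = x.symm := SimpleGraph.Dart.ext _ _ (Prod.ext h1 h2)
      exact hne x (this ▸ hxy)
    · exact h3 (h1.trans h2.symm)
  have h1 : ∀ x, R.faceNext x ≠ x := fun x hh => x.adj.ne (by rw [← hfst, hh])
  have h2 : R.faceNext (R.faceNext d) ≠ d := fun hh => by
    have : R.faceNext d = d.symm := SimpleGraph.Dart.ext _ _
      (Prod.ext (hfst d) ((hfst (R.faceNext d)).symm.trans (by rw [hh]; rfl)))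
    exact hnext _ this
  have hd1 := hφ d
  have hd2 := (hφ (R.faceNext d)).trans hd1
  refine ⟨R.faceOf d.symm, R.faceOf (R.faceNext d).symm, R.faceOf (R.faceNext (R.faceNext d)).symm,
    ⟨hne d, d, rfl, rfl⟩, ⟨hd1 ▸ hne _, _, hd1, rfl⟩, ⟨hd2 ▸ hne _, _, hd2, rfl⟩,
    hdist _ _ hd1.symm (h1 d).symm, hdist _ _ hd2.symm h2.symm, hdist _ _ (hd1.trans hd2.symm) (h1 _).symm⟩

end Rotation

end D3

theorem mainTheorem10 {V : Type u} [Finite V] (G : SimpleGraph V) (hG : D3.Reducible G) :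
    (∃ R : D3.RotationSystem G, R.IsPlanar) ∧
      ∀ R : D3.RotationSystem G, R.IsPlanar → D3.treewidth R.dual = 3 := by
  classical
  have := D3.finite_dart (G := G)
  have hgood := hG.good D3.dartsOf_rev
  have hdeg := hG.exists_two_adj
  have hadj : ∀ v, ∃ w, G.Adj v w := fun v => let ⟨x, _, hx, _⟩ := hdeg v; ⟨x, hx⟩
  refine ⟨?_, fun R hR => ?_⟩
  · obtain ⟨σ, hσ, hσ'⟩ := hgood.exist
    refine ⟨D3.RotationSystem.ofIsRot hσ, hG.connected, ?_⟩
    rw [← D3.RotationSystem.euler_eq _ hadj]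
    exact hσ'
  · obtain ⟨κ, hκ, ht, hd⟩ := hgood.planar R.next R.isRot ((R.euler_eq hadj).trans hR.2)
    -- The rotation is transitive on the darts at a vertex, so a fixed dart would be the only one
    -- there, contradicting the two neighbours.
    have hnext : ∀ d, R.next d ≠ d := by
      intro d hfix
      obtain ⟨x, y, hx, hy, hxy⟩ := hdeg d.fst
      have key : ∀ z (hz : G.Adj d.fst z), z = d.snd := fun z hz => by
        have h1 : (⟨(d.fst, z), hz⟩ : G.Dart) = d := D3.mem_of_sameCycle (S := {d})
          (fun w hw => by rw [Set.mem_singleton_iff] at hw ⊢; rw [hw, hfix])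
          (R.sameCycle d ⟨(d.fst, z), hz⟩ rfl) rfl
        exact congrArg (fun e : G.Dart => e.snd) h1
      exact hxy ((key x hx).trans (key y hy).symm)
    have := R.finite_face
    have : Nonempty R.Face := by
      obtain ⟨v⟩ := hG.connected.nonempty
      obtain ⟨w, hw⟩ := hadj v
      exact ⟨R.faceOf ⟨(v, w), hw⟩⟩
    refine le_antisymm (iInf₂_le 3 (D3.hasTreeDecompositionOfWidth_dual hκ hd)) (le_iInf₂ fun k hk => ?_)
    exact_mod_cast D3.le_of_hasTreeDecompositionOfWidth hk (D3.exists_three_adj_dual hκ ht hnext)
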